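/- \textbf{Theorem (PWS-type theorem).} Let $n\ge 1$ and let $C\subseteq\mathbb R^n$ be a non-empty open convex cone with vertex at the origin ($x\in C,\ \lambda>0\Rightarrow\lambda x\in C$), where $C\ne\mathbb R$ if $n=1$. Let $C^*=\{\xi\in\mathbb R^n : \langle\xi,x\rangle\ge 0\ \forall x\in C\}$ be its dual cone and $h_{C^*}(y)=\sup_{\xi\in C^*}(-\langle\xi,y\rangle)\in[0,\infty]$ its indicator (support function). For an open cone $C'$ write $C'\Subset C$ if $\overline{C'}\cap S^{n-1}\subseteq C\cap S^{n-1}$, and for $r>0$ put $T(C';r)=\mathbb R^n+i\bigl(C'\setminus (C'\cap B[0;r])\bigr)\subseteq\mathbb C^n$, where $B[0;r]$ is the closed ball. Given radii $r(C')>0$, let $\mathscr H(C,r)$ be the set of functions $f$ for which there is $N\ge 0$ such that, for every open cone $C'\Subset C$, $f$ is holomorphic in $T(C';r(C'))$ and there is a constant $K(C')$ with $$|f(z)|\le K(C')(1+|z|)^N e^{h_{C^*}(y)},\qquad z=x+iy\in T(C';r(C')).\tag{1}$$ Let $O\subseteq\mathbb R^n$ be a non-empty convex open set. $H(\mathbb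 R^n;O)$ is the space of all $\varphi\in C^\infty(\mathbb R^n)$ such that $e^{h_K(\xi)}D^\alpha\varphi(\xi)$ is bounded for every $\alpha$ and every convex compact $K\subseteq O$, where $h_K(\xi)=\sup_{x\in K}|\langle\xi,x\rangle|$, with the topology given by the corresponding suprema; $H'(\mathbb R^n;O)$ is its dual (distributions of exponential growth), and $H'_{C^*}(\mathbb R^n;O)$ is the subspace of the $V$ with $\operatorname{supp}V\subseteq C^*$. For $V\in H'_{C^*}(\mathbb R^n;O)$ the pairing $(V,e^{i\langle\xi,z\rangle})$ is understood as $\lim_{k\to\infty}(V,\eta(\xi/k)e^{i\langle\xi,z\rangle})$, provided that the limit exists and is the same for all $\eta\in C_c^\infty(\mathbb R^n)$ that equal $1$ near the origin. (i) Let $r(C')>0$ be radii and $f\in\mathscr H(C,r)$, and suppose that $O$ contains a point $y\in C'$ with $|y|>r(C')$ for some open cone $C'\Subset C$ (this always holds if $O=\mathbb R^n$). Then there is exactly one $V\in H'_{C^*}(\mathbb R^n;O)$ such that $$f(z)=(2\pi)^{-n}\,(V,e^{i\langle\xi,z\rangle})\tag{2}$$ for all open cones $C'\Subset C$ and all $z\in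 T(C';r(C'))$. (ii) Conversely, for every $V\in H'_{C^*}(\mathbb R^n;O)$ there are radii $r(C')>0$ and a function $f\in\mathscr H(C,r)$ such that, for all open cones $C'\Subset C$ and all $z\in T(C';r(C'))$, the pairing in (2) exists and its value, which is unique, is given by (2). Thus $V$ has a uniquely determined inverse Fourier–Laplace transform, which is holomorphic in the sets $T(C';r(C'))$ and satisfies (1). -/

import Mathlib

noncomputable section

namespace PWS

open Set Filter Topology
open scoped ContDiff

/-! ### Cones and truncated tubes -/

/-- An open cone in `ℝⁿ` with vertex at the origin. -/
def IsOpenCone {n : ℕ} (C : Set (EuclideanSpace ℝ (Fin n))) : Prop :=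
  IsOpen C ∧ ∀ x ∈ C, ∀ t : ℝ, 0 < t → t • x ∈ C

/-- `C' ⋐ C`: the closure of `C'` and `C` have projections to the unit sphere, the first of which
is contained in the second. -/
def CompactIn {n : ℕ} (C' C : Set (EuclideanSpace ℝ (Fin n))) : Prop :=
  closure C' ∩ Metric.sphere 0 1 ⊆ C ∩ Metric.sphere 0 1

/-- The open cones `C'` that are compact in `C`. -/
def IsSubcone {n : ℕ} (C C' : Set (EuclideanSpace ℝ (Fin n))) : Prop :=
  IsOpenCone C' ∧ CompactIn C' C

/-- The dual cone `C* = {ξ | ⟨ξ, x⟩ ≥ 0 for all x ∈ C}`. -/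
def dualCone {n : ℕ} (C : Set (EuclideanSpace ℝ (Fin n))) : Set (EuclideanSpace ℝ (Fin n)) :=
  {ξ | ∀ x ∈ C, 0 ≤ inner ℝ ξ x}

/-- The imaginary part `y` of `z = x + iy ∈ ℂⁿ`. -/
def imPart {n : ℕ} (z : EuclideanSpace ℂ (Fin n)) : EuclideanSpace ℝ (Fin n) :=
  WithLp.toLp 2 fun j => (z j).im

/-- `T(C'; r) = ℝⁿ + i (C' \ (C' ∩ B[0; r]))`. -/
def truncTube {n : ℕ} (C' : Set (EuclideanSpace ℝ (Fin n))) (r : ℝ) :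
    Set (EuclideanSpace ℂ (Fin n)) :=
  {z | imPart z ∈ C' \ (C' ∩ Metric.closedBall 0 r)}

/-- The indicator (support function) `h_S(y) = sup_{ξ ∈ S} (-⟨ξ, y⟩)` of a set `S`, with values in
the extended reals; `exp (h_S (y))` is the supremum over `ξ ∈ S` of `|exp (i⟨ξ, x + iy⟩)|`. -/
def indicatorFn {n : ℕ} (S : Set (EuclideanSpace ℝ (Fin n))) (y : EuclideanSpace ℝ (Fin n)) :
    EReal :=
  ⨆ ξ ∈ S, ((-(inner ℝ ξ y) : ℝ) : EReal)

/-- The functions that are holomorphic in `T(C'; r(C'))` and satisfy there the estimate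
`|f(z)| ≤ K(C') (1 + |z|)^N exp (h_{C*}(y))`, for every open cone `C' ⋐ C`; the exponent `N` does
not depend on `C'`. The truncation radius `r` may depend on `C'` (a constant `r` is allowed). -/
def HolGrowth {n : ℕ} (C : Set (EuclideanSpace ℝ (Fin n)))
    (r : Set (EuclideanSpace ℝ (Fin n)) → ℝ) (f : EuclideanSpace ℂ (Fin n) → ℂ) : Prop :=
  ∃ N : ℝ, 0 ≤ N ∧ ∀ C', IsSubcone C C' →
    DifferentiableOn ℂ f (truncTube C' (r C')) ∧
    ∃ K : ℝ, 0 ≤ K ∧ ∀ z ∈ truncTube C' (r C'),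
      ‖f z‖ₑ ≤ ENNReal.ofReal (K * (1 + ‖z‖) ^ N) *
        EReal.exp (indicatorFn (dualCone C) (imPart z))

/-! ### The spaces `H(ℝⁿ; O)`, `H'(ℝⁿ; O)` and `H'_S(ℝⁿ; O)` -/

/-- `h_K(ξ) = sup_{x ∈ K} |⟨ξ, x⟩|`, for compact `K`. -/
def hK {n : ℕ} (K : Set (EuclideanSpace ℝ (Fin n))) (ξ : EuclideanSpace ℝ (Fin n)) : ℝ :=
  ⨆ x : K, |inner ℝ ξ (x : EuclideanSpace ℝ (Fin n))|

theorem hK_le {n : ℕ} {K : Set (EuclideanSpace ℝ (Fin n))} (hK' : IsCompact K) :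
    ∃ R : ℝ, 0 ≤ R ∧ ∀ ξ, hK K ξ ≤ ‖ξ‖ * R := by
  obtain ⟨R, hR0, hR⟩ := hK'.isBounded.exists_pos_norm_le
  refine ⟨R, hR0.le, fun ξ => Real.iSup_le (fun x => ?_) (by positivity)⟩
  exact (abs_real_inner_le_norm _ _).trans
    (mul_le_mul_of_nonneg_left (hR _ x.2) (norm_nonneg _))

/-- The space `H(ℝⁿ; O)` of the smooth functions `φ` all of whose derivatives, multiplied by
`exp (h_K)`, are bounded, for every convex compact set `K ⊆ O`. -/
def testSpace {n : ℕ} (O : Set (EuclideanSpace ℝ (Fin n))) :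
    Submodule ℂ (EuclideanSpace ℝ (Fin n) → ℂ) where
  carrier := {φ | ContDiff ℝ ∞ φ ∧ ∀ K ⊆ O, Convex ℝ K → IsCompact K → ∀ m : ℕ,
    ∃ B : ℝ, ∀ ξ, Real.exp (hK K ξ) * ‖iteratedFDeriv ℝ m φ ξ‖ ≤ B}
  zero_mem' := by
    refine ⟨contDiff_const, fun K _ _ _ m => ⟨0, fun ξ => ?_⟩⟩
    have h : iteratedFDeriv ℝ m (0 : EuclideanSpace ℝ (Fin n) → ℂ) ξ = 0 := by
      rw [iteratedFDeriv_zero]; rfl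
    simp [h]
  add_mem' := by
    rintro φ ψ ⟨hφ, hφ'⟩ ⟨hψ, hψ'⟩
    refine ⟨hφ.add hψ, fun K h1 h2 h3 m => ?_⟩
    obtain ⟨B₁, hB₁⟩ := hφ' K h1 h2 h3 m
    obtain ⟨B₂, hB₂⟩ := hψ' K h1 h2 h3 m
    refine ⟨B₁ + B₂, fun ξ => ?_⟩
    have hm : ((m : ℕ∞) : WithTop ℕ∞) ≤ ∞ := mod_cast le_top
    rw [iteratedFDeriv_add_apply (hφ.of_le hm).contDiffAt (hψ.of_le hm).contDiffAt]
    refine le_trans (mul_le_mul_of_nonneg_left (norm_add_le _ _) (Real.exp_pos _).le) ?_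
    rw [mul_add]
    exact add_le_add (hB₁ ξ) (hB₂ ξ)
  smul_mem' := by
    rintro c φ ⟨hφ, hφ'⟩
    refine ⟨hφ.const_smul c, fun K h1 h2 h3 m => ?_⟩
    obtain ⟨B, hB⟩ := hφ' K h1 h2 h3 m
    refine ⟨‖c‖ * B, fun ξ => ?_⟩
    have hm : ((m : ℕ∞) : WithTop ℕ∞) ≤ ∞ := mod_cast le_top
    rw [iteratedFDeriv_const_smul_apply (hφ.of_le hm).contDiffAt, norm_smul]
    calc Real.exp (hK K ξ) * (‖c‖ * ‖iteratedFDeriv ℝ m φ ξ‖)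
        = ‖c‖ * (Real.exp (hK K ξ) * ‖iteratedFDeriv ℝ m φ ξ‖) := by ring
      _ ≤ ‖c‖ * B := mul_le_mul_of_nonneg_left (hB ξ) (norm_nonneg _)

/-- Smooth functions with compact support belong to `H(ℝⁿ; O)`. -/
theorem mem_testSpace {n : ℕ} (O : Set (EuclideanSpace ℝ (Fin n)))
    {φ : EuclideanSpace ℝ (Fin n) → ℂ} (h : ContDiff ℝ ∞ φ) (hc : HasCompactSupport φ) :
    φ ∈ testSpace O := by
  refine ⟨h, fun K _ _ hKc m => ?_⟩
  obtain ⟨R, hR0, hR⟩ := hK_le hKc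
  have hm : ((m : ℕ∞) : WithTop ℕ∞) ≤ ∞ := mod_cast le_top
  have h0 : Continuous (iteratedFDeriv ℝ m φ) := h.continuous_iteratedFDeriv hm
  have h1 : Continuous (fun ξ => Real.exp (‖ξ‖ * R) * ‖iteratedFDeriv ℝ m φ ξ‖) := by
    fun_prop
  have h2 : HasCompactSupport (fun ξ => Real.exp (‖ξ‖ * R) * ‖iteratedFDeriv ℝ m φ ξ‖) :=
    (hc.iteratedFDeriv m).norm.mul_left
  obtain ⟨B, hB⟩ := h1.bounded_above_of_compact_support h2
  refine ⟨B, fun ξ => le_trans ?_ ((le_abs_self _).trans (hB ξ))⟩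
  exact mul_le_mul_of_nonneg_right (Real.exp_le_exp.2 (hR ξ)) (norm_nonneg _)

/-- The dual space `H'(ℝⁿ; O)`: the linear functionals on `H(ℝⁿ; O)` that are continuous for the
projective limit topology, which is given by the seminorms
`max_{j ≤ m} sup_ξ exp (h_K(ξ)) |D^j φ(ξ)|` (a directed family when `O` is convex). -/
def expDual {n : ℕ} (O : Set (EuclideanSpace ℝ (Fin n))) : Set (testSpace O →ₗ[ℂ] ℂ) :=
  {V | ∃ K ⊆ O, Convex ℝ K ∧ IsCompact K ∧ ∃ (m : ℕ) (M : ℝ), 0 ≤ M ∧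
    ∀ (φ : testSpace O) (B : ℝ),
      (∀ j ≤ m, ∀ ξ, Real.exp (hK K ξ) *
        ‖iteratedFDeriv ℝ j (φ : EuclideanSpace ℝ (Fin n) → ℂ) ξ‖ ≤ B) → ‖V φ‖ ≤ M * B}

/-- The subspace `H'_S(ℝⁿ; O)` of the `V ∈ H'(ℝⁿ; O)` with `supp V ⊆ S`, for closed `S`: `V`
vanishes on the smooth functions with compact support in the complement of `S`. -/
def expDualSupp {n : ℕ} (O S : Set (EuclideanSpace ℝ (Fin n))) : Set (testSpace O →ₗ[ℂ] ℂ) :=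
  {V | V ∈ expDual O ∧ ∀ φ : testSpace O,
    HasCompactSupport (φ : EuclideanSpace ℝ (Fin n) → ℂ) →
    Disjoint (tsupport (φ : EuclideanSpace ℝ (Fin n) → ℂ)) S → V φ = 0}

/-! ### The inverse Fourier-Laplace transform -/

/-- `⟨ξ, z⟩ = ∑ ξ_j z_j` for `ξ ∈ ℝⁿ`, `z ∈ ℂⁿ`. -/
def pairing {n : ℕ} (ξ : EuclideanSpace ℝ (Fin n)) (z : EuclideanSpace ℂ (Fin n)) : ℂ :=
  ∑ j, (ξ j : ℂ) * z j

/-- A smooth cut-off function: compact support, equal to `1` in a neighbourhood of the origin. -/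
def IsCutoff {n : ℕ} (η : EuclideanSpace ℝ (Fin n) → ℂ) : Prop :=
  ContDiff ℝ ∞ η ∧ HasCompactSupport η ∧ ∀ᶠ ξ in 𝓝 0, η ξ = 1

/-- The function `ξ ↦ η(ξ / (k + 1)) exp (i⟨ξ, z⟩)`. -/
def cutExp {n : ℕ} (η : EuclideanSpace ℝ (Fin n) → ℂ) (z : EuclideanSpace ℂ (Fin n)) (k : ℕ)
    (ξ : EuclideanSpace ℝ (Fin n)) : ℂ :=
  η (((k : ℝ) + 1)⁻¹ • ξ) * Complex.exp (Complex.I * pairing ξ z)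

theorem cutExp_mem {n : ℕ} (O : Set (EuclideanSpace ℝ (Fin n)))
    {η : EuclideanSpace ℝ (Fin n) → ℂ} (hη : IsCutoff η) (z : EuclideanSpace ℂ (Fin n)) (k : ℕ) :
    cutExp η z k ∈ testSpace O := by
  have hk : ((k : ℝ) + 1)⁻¹ ≠ 0 := by positivity
  refine mem_testSpace O ?_ ?_
  · have h1 : ContDiff ℝ ∞ fun ξ : EuclideanSpace ℝ (Fin n) => η (((k : ℝ) + 1)⁻¹ • ξ) :=
      hη.1.comp (contDiff_const_smul _)
    have h2 : ContDiff ℝ ∞ fun ξ : EuclideanSpace ℝ (Fin n) => pairing ξ z := by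
      unfold pairing
      refine ContDiff.sum fun j _ => ContDiff.mul ?_ contDiff_const
      exact Complex.ofRealCLM.contDiff.comp (EuclideanSpace.proj (𝕜 := ℝ) j).contDiff
    exact h1.mul (contDiff_const.mul h2).cexp
  · exact (hη.2.1.comp_smul hk).mul_right

/-- `w` is the value at `z` of the inverse Fourier-Laplace transform of `V`, that is
`w = (2π)^{-n} (V, exp (i⟨ξ, z⟩))`. The exponential is not a test function, and the pairing is
understood in the usual sense, as the limit of the pairings of `V` with the smooth truncations
`η(ξ / k) exp (i⟨ξ, z⟩)`, which has to exist and to be the same for all cut-off functions `η`. -/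
def HasInvFourierLaplace {n : ℕ} {O : Set (EuclideanSpace ℝ (Fin n))}
    (V : testSpace O →ₗ[ℂ] ℂ) (z : EuclideanSpace ℂ (Fin n)) (w : ℂ) : Prop :=
  ∀ (η : EuclideanSpace ℝ (Fin n) → ℂ) (hη : IsCutoff η),
    Tendsto (fun k : ℕ => (((2 * Real.pi : ℝ) : ℂ) ^ n)⁻¹ * V ⟨cutExp η z k, cutExp_mem O hη z k⟩)
      atTop (𝓝 w)

end PWS

end

noncomputable section

namespace PWS

open Set Filter Topology
open scoped ContDiff BoundedContinuousFunction SchwartzMap FourierTransform Manifold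

/-! ### Exponentials of linear functionals -/

section ExpLinear

variable {E : Type*} [NormedAddCommGroup E] [NormedSpace ℝ E]

/-! On a subcone `C'` compactness of directions gives `⟨ξ, y⟩ ≥ c‖y‖‖ξ‖` for `ξ ∈ C*`
(`IsSubcone.exists_le_inner`), and `h_{C*}` vanishes on `C`. Hence the growth condition is just
polynomial growth, and near `C*` the function `exp (i⟨ξ, z⟩)` decays like `exp (-c‖y‖‖ξ‖)`.

From `V` to `f`: `V` has finite order `m` and is controlled by a weight `exp (R‖ξ‖)`, so by
Hahn–Banach it acts on compactly supported functions through a continuous functional `Λ` of weighted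
jets (`exists_jet_extension`). With a cut-off `χ` equal to `1` near `C*`, the jet of `χ exp (i⟨·,
z⟩)` exists once `c‖y‖ > R`, depends holomorphically on `z`, and is the limit of its truncations; so
`f(z)` is `(2π)⁻ⁿ` times `Λ` of this jet. Polynomial growth follows by replacing `χ` with a cut-off
adapted to a neighbourhood of `C*` of width `1/‖y‖`, which does not change the value.

Uniqueness: Fourier inversion for `φ exp ⟨·, y⟩` writes a test function `φ` as a superposition of
the exponentials with `z = 2πu + iy`. Applying `Λ` under the integral expresses `V φ` by the values
of `f` on one plane `Im z = y` (`apply_eq_integral`), and compactly supported functions are dense.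

Existence: the same formula on a plane with `y ∈ O` defines `V`; a ball around `y` inside `O` gives
continuity. Cauchy's theorem, in the form that a holomorphic function constant along the real
direction has derivative zero, makes the integral independent of the plane (`planeIntegral_eq`).
Moving the plane to infinity along `e ∈ C` kills functions supported in `⟨ξ, e⟩ < 0`, and these half
spaces cover the complement of `C*`. Moving it to `Im z` turns the pairing with truncated
exponentials into an approximate identity applied to `f` at `z`. -/

theorem contDiff_exp_clm (L : E →L[ℝ] ℂ) : ContDiff ℝ ∞ fun ξ => Complex.exp (L ξ) :=
  L.contDiff.cexp

/-- Multiplication of a continuous linear functional by complex scalars. -/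
def scaleCLM (L : E →L[ℝ] ℂ) : ℂ →L[ℝ] E →L[ℝ] ℂ :=
  LinearMap.mkContinuous
    { toFun := fun c => c • L
      map_add' := fun a b => add_smul a b L
      map_smul' := fun a b => smul_assoc a b L } ‖L‖
    fun c => by
      change ‖c • L‖ ≤ _
      rw [norm_smul, mul_comm]

theorem norm_scaleCLM_le (L : E →L[ℝ] ℂ) : ‖scaleCLM L‖ ≤ ‖L‖ :=
  LinearMap.mkContinuous_norm_le _ (norm_nonneg _) _

/-- If the derivative of `g` is `h • L`, then the derivatives of `g` of order `j + 1` are controlled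
by those of `h` of order `j`. -/
theorem norm_iteratedFDeriv_succ_le_of_hasFDerivAt_smul {g h : E → ℂ} {L : E →L[ℝ] ℂ}
    (hh : ContDiff ℝ ∞ h) (hg : ∀ ξ, HasFDerivAt g (h ξ • L) ξ) (j : ℕ) (ξ : E) :
    ‖iteratedFDeriv ℝ (j + 1) g ξ‖ ≤ ‖L‖ * ‖iteratedFDeriv ℝ j h ξ‖ := by
  have hfd : fderiv ℝ g = scaleCLM L ∘ h := by
    funext η
    exact (hg η).fderiv
  have hj : ((j : ℕ∞) : WithTop ℕ∞) ≤ ∞ := mod_cast le_top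
  rw [← norm_iteratedFDeriv_fderiv, hfd]
  exact ((scaleCLM L).norm_iteratedFDeriv_comp_left hh.contDiffAt hj).trans
    (mul_le_mul_of_nonneg_right (norm_scaleCLM_le L) (norm_nonneg _))

theorem hasFDerivAt_exp_clm (L : E →L[ℝ] ℂ) (ξ : E) :
    HasFDerivAt (fun ξ => Complex.exp (L ξ)) (Complex.exp (L ξ) • L) ξ :=
  L.hasFDerivAt.cexp

/-- Each differentiation of `exp ∘ L` reproduces it with a factor `L`. -/
theorem norm_iteratedFDeriv_exp_clm_le (L : E →L[ℝ] ℂ) (j : ℕ) (ξ : E) :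
    ‖iteratedFDeriv ℝ j (fun ξ => Complex.exp (L ξ)) ξ‖ ≤ ‖L‖ ^ j * ‖Complex.exp (L ξ)‖ := by
  induction j with
  | zero => simp
  | succ j ih =>
    refine (norm_iteratedFDeriv_succ_le_of_hasFDerivAt_smul (contDiff_exp_clm L)
      (hasFDerivAt_exp_clm L) j ξ).trans ?_
    rw [pow_succ', mul_assoc]
    exact mul_le_mul_of_nonneg_left ih (norm_nonneg _)

theorem norm_exp_clm_le (L : E →L[ℝ] ℂ) (ξ : E) :
    ‖Complex.exp (L ξ)‖ ≤ Real.exp (‖L‖ * ‖ξ‖) :=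
  (Complex.norm_exp_le_exp_norm _).trans (Real.exp_le_exp.2 (L.le_opNorm ξ))

/-- The derivatives of the second order Taylor remainder of `exp ∘ L` are `O(‖L‖²)`. -/
theorem norm_iteratedFDeriv_exp_clm_sub_le (L : E →L[ℝ] ℂ) (hL : ‖L‖ ≤ 1) (j : ℕ) (ξ : E) :
    ‖iteratedFDeriv ℝ j (fun ξ => Complex.exp (L ξ) - 1 - L ξ) ξ‖ ≤
      ‖L‖ ^ 2 * ((1 + ‖ξ‖) ^ 2 * Real.exp (‖L‖ * ‖ξ‖)) := by
  have hE := norm_exp_clm_le L ξ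
  have hLξ := L.le_opNorm ξ
  have h1 : ContDiff ℝ ∞ fun ξ => Complex.exp (L ξ) - 1 := (contDiff_exp_clm L).sub contDiff_const
  have d1 : ∀ ξ, HasFDerivAt (fun ξ => Complex.exp (L ξ) - 1) (Complex.exp (L ξ) • L) ξ :=
    fun ξ => (hasFDerivAt_exp_clm L ξ).sub_const 1
  have d2 : ∀ ξ, HasFDerivAt (fun ξ => Complex.exp (L ξ) - 1 - L ξ)
      ((Complex.exp (L ξ) - 1) • L) ξ := fun ξ => by
    have h : (Complex.exp (L ξ) - 1) • L = Complex.exp (L ξ) • L - L :=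
      (sub_smul _ _ L).trans (congrArg _ (one_smul ℂ L))
    rw [h]
    exact (d1 ξ).sub L.hasFDerivAt
  have hx : 0 ≤ ‖ξ‖ := norm_nonneg ξ
  have hl : 0 ≤ ‖L‖ := norm_nonneg L
  have hexp : Real.exp ‖L ξ‖ ≤ Real.exp (‖L‖ * ‖ξ‖) := Real.exp_le_exp.2 hLξ
  -- Orders 0 and 1 get the factor `‖L‖²` from the remainders of the exponential series; from order
  -- 2 on, two differentiations already supply it.
  match j with
  | 0 =>
    rw [norm_iteratedFDeriv_zero]
    have h := Complex.norm_exp_sub_sum_le_norm_mul_exp (L ξ) 2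
    simp only [Finset.sum_range_succ, Finset.range_zero, Finset.sum_empty, zero_add, pow_zero,
      pow_one, Nat.factorial, Nat.cast_one, div_one, mul_one, Nat.succ_eq_add_one] at h
    rw [sub_sub]
    refine h.trans ?_
    rw [← mul_assoc, ← mul_pow]
    gcongr
    exact hLξ.trans (by gcongr; linarith)
  | 1 =>
    refine (norm_iteratedFDeriv_succ_le_of_hasFDerivAt_smul h1 d2 0 ξ).trans ?_
    rw [norm_iteratedFDeriv_zero, pow_two, mul_assoc]
    gcongr
    have h := Complex.norm_exp_sub_sum_le_norm_mul_exp (L ξ) 1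
    simp only [Finset.sum_range_succ, Finset.range_zero, Finset.sum_empty, zero_add, pow_zero,
      pow_one, Nat.factorial, Nat.cast_one, div_one] at h
    refine h.trans ?_
    rw [← mul_assoc]
    gcongr
    exact hLξ.trans (by gcongr; nlinarith)
  | j + 2 =>
    refine (norm_iteratedFDeriv_succ_le_of_hasFDerivAt_smul h1 d2 (j + 1) ξ).trans ?_
    rw [pow_two, mul_assoc]
    gcongr
    refine (norm_iteratedFDeriv_succ_le_of_hasFDerivAt_smul (contDiff_exp_clm L) d1 j ξ).trans ?_
    gcongr
    refine (norm_iteratedFDeriv_exp_clm_le L j ξ).trans ?_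
    gcongr
    · exact (pow_le_one₀ hl hL).trans (one_le_pow₀ (by linarith))

end ExpLinear

/-! ### The exponentials `exp (i⟨ξ, z⟩)` -/

section ExpPairing

variable {n : ℕ}

/-- The linear functional `ξ ↦ i⟨ξ, z⟩`. -/
def phase (z : EuclideanSpace ℂ (Fin n)) : EuclideanSpace ℝ (Fin n) →L[ℝ] ℂ :=
  ∑ j, (Complex.I * z j) • (Complex.ofRealCLM.comp (EuclideanSpace.proj (𝕜 := ℝ) j))

theorem phase_apply (z : EuclideanSpace ℂ (Fin n)) (ξ : EuclideanSpace ℝ (Fin n)) :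
    phase z ξ = Complex.I * pairing ξ z := by
  simp only [phase, pairing, sum_apply, Finset.mul_sum]
  refine Finset.sum_congr rfl fun j _ => ?_
  simp [mul_comm, mul_assoc]

theorem phase_add (z w : EuclideanSpace ℂ (Fin n)) : phase (z + w) = phase z + phase w := by
  ext ξ
  simp only [add_apply, phase_apply, pairing, PiLp.add_apply, mul_add, Finset.sum_add_distrib]

theorem phase_smul (c : ℂ) (z : EuclideanSpace ℂ (Fin n)) : phase (c • z) = c • phase z := by
  ext ξ
  simp only [smul_apply, phase_apply, pairing, PiLp.smul_apply, smul_eq_mul,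
    Finset.mul_sum]
  refine Finset.sum_congr rfl fun j _ => ?_
  ring

theorem norm_phase_le (z : EuclideanSpace ℂ (Fin n)) : ‖phase z‖ ≤ ‖z‖ := by
  refine ContinuousLinearMap.opNorm_le_bound _ (norm_nonneg _) fun ξ => ?_
  rw [phase_apply, norm_mul, Complex.norm_I, one_mul, pairing]
  -- Viewing `ξ` as a complex vector of the same norm reduces the bound to the Cauchy–Schwarz
  -- inequality in `ℂⁿ`.
  let ζ : EuclideanSpace ℂ (Fin n) := WithLp.toLp 2 fun j => (ξ j : ℂ)
  have h1 : ∑ j, (ξ j : ℂ) * z j = inner ℂ ζ z := by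
    rw [PiLp.inner_apply]
    refine Finset.sum_congr rfl fun j _ => ?_
    simp [ζ, mul_comm]
  have h2 : ‖ζ‖ = ‖ξ‖ := by
    rw [EuclideanSpace.norm_eq, EuclideanSpace.norm_eq]
    simp [ζ]
  rw [h1, mul_comm, ← h2]
  exact norm_inner_le_norm ζ z

theorem phase_re (z : EuclideanSpace ℂ (Fin n)) (ξ : EuclideanSpace ℝ (Fin n)) :
    (phase z ξ).re = -inner ℝ ξ (imPart z) := by
  rw [phase_apply, pairing, PiLp.inner_apply]
  simp [imPart, mul_comm]

theorem norm_exp_phase (z : EuclideanSpace ℂ (Fin n)) (ξ : EuclideanSpace ℝ (Fin n)) :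
    ‖Complex.exp (phase z ξ)‖ = Real.exp (-inner ℝ ξ (imPart z)) := by
  rw [Complex.norm_exp, phase_re]

theorem norm_imPart_le (z : EuclideanSpace ℂ (Fin n)) : ‖imPart z‖ ≤ ‖z‖ := by
  rw [EuclideanSpace.norm_eq, EuclideanSpace.norm_eq]
  refine Real.sqrt_le_sqrt (Finset.sum_le_sum fun j _ => ?_)
  gcongr
  simpa [imPart] using Complex.abs_im_le_norm (z j)

theorem norm_iteratedFDeriv_exp_phase_le (z : EuclideanSpace ℂ (Fin n)) (j : ℕ)
    (ξ : EuclideanSpace ℝ (Fin n)) :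
    ‖iteratedFDeriv ℝ j (fun ξ => Complex.exp (phase z ξ)) ξ‖ ≤
      ‖z‖ ^ j * Real.exp (-inner ℝ ξ (imPart z)) := by
  refine (norm_iteratedFDeriv_exp_clm_le (phase z) j ξ).trans ?_
  rw [norm_exp_phase]
  gcongr
  exact norm_phase_le z

end ExpPairing

/-! ### Products of functions with bounded derivatives -/

section Leibniz

variable {E : Type*} [NormedAddCommGroup E] [NormedSpace ℝ E]

/-- A pointwise Leibniz bound. -/
theorem norm_iteratedFDeriv_mul_le_of_le {f g : E → ℂ} (hf : ContDiff ℝ ∞ f)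
    (hg : ContDiff ℝ ∞ g) {j : ℕ} {ξ : E} {A B : ℝ}
    (hA : ∀ i ≤ j, ‖iteratedFDeriv ℝ i f ξ‖ ≤ A) (hB : ∀ i ≤ j, ‖iteratedFDeriv ℝ i g ξ‖ ≤ B) :
    ‖iteratedFDeriv ℝ j (fun ξ => f ξ * g ξ) ξ‖ ≤ 2 ^ j * (A * B) := by
  have hj : ((j : ℕ∞) : WithTop ℕ∞) ≤ ∞ := mod_cast le_top
  have hA0 : 0 ≤ A := (norm_nonneg _).trans (hA 0 (Nat.zero_le _))
  refine (norm_iteratedFDeriv_mul_le hf hg ξ hj).trans ?_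
  calc _ ≤ ∑ i ∈ Finset.range (j + 1), (j.choose i : ℝ) * (A * B) := by
        refine Finset.sum_le_sum fun i hi => ?_
        have hi' : i ≤ j := Nat.lt_succ_iff.1 (Finset.mem_range.1 hi)
        rw [mul_assoc]
        gcongr
        · exact hA i hi'
        · exact hB _ (Nat.sub_le _ _)
    _ = 2 ^ j * (A * B) := by
        rw [← Finset.sum_mul]
        congr 1
        exact_mod_cast Nat.sum_range_choose j

end Leibniz

/-! ### Smooth approximations of indicator functions -/

section SmoothIndicator

open MeasureTheory Convolution

/-- All derivatives can be put on the smooth factor `g`, and `‖h‖ ≤ 1` leaves an `L¹` norm. The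
target spaces and the bilinear map are quantified after `j` because differentiating replaces `L` by
`L.precompL E`, so the induction hypothesis is needed for a different map. -/
theorem exists_bound_iteratedFDeriv_convolution {E : Type} [NormedAddCommGroup E]
    [NormedSpace ℝ E] [FiniteDimensional ℝ E] [MeasurableSpace E] [BorelSpace E]
    {μ : Measure E} [μ.IsAddHaarMeasure] {h : E → ℂ} (hh : AEStronglyMeasurable h μ)
    (hb : ∀ t, ‖h t‖ ≤ 1) (j : ℕ) :
    ∀ {F F' : Type} [NormedAddCommGroup F] [NormedSpace ℝ F]
      [NormedAddCommGroup F'] [NormedSpace ℝ F'] (L : F →L[ℝ] ℂ →L[ℝ] F')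
      (g : E → F), ContDiff ℝ ∞ g → HasCompactSupport g →
      ∃ A : ℝ, ∀ ξ, ‖iteratedFDeriv ℝ j (g ⋆[L, μ] h) ξ‖ ≤ A := by
  have hli : LocallyIntegrable h μ := by
    refine (locallyIntegrable_const (1 : ℝ)).mono hh (Eventually.of_forall fun t => ?_)
    simpa using hb t
  induction j with
  | zero =>
    intro F F' _ _ _ _ L g hg hgc
    refine ⟨∫ t, ‖L‖ * ‖g t‖ ∂μ, fun ξ => ?_⟩
    rw [norm_iteratedFDeriv_zero, convolution_def]
    refine norm_integral_le_of_norm_le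
      ((hg.continuous.integrable_of_hasCompactSupport hgc).norm.const_mul _)
      (Eventually.of_forall fun t => ?_)
    calc ‖L (g t) (h (ξ - t))‖ ≤ ‖L‖ * ‖g t‖ * ‖h (ξ - t)‖ := L.le_opNorm₂ _ _
      _ ≤ ‖L‖ * ‖g t‖ * 1 := by gcongr; exact hb _
      _ = _ := mul_one _
  | succ j ih =>
    intro F F' _ _ _ _ L g hg hgc
    obtain ⟨A, hA⟩ := ih (L.precompL E) (fderiv ℝ g) (hg.fderiv_right (by simp)) (hgc.fderiv ℝ)
    refine ⟨A, fun ξ => ?_⟩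
    have hfd : fderiv ℝ (g ⋆[L, μ] h) = fderiv ℝ g ⋆[L.precompL E, μ] h := by
      funext η
      exact (hgc.hasFDerivAt_convolution_left L (hg.of_le (by simp)) hli η).fderiv
    rw [← norm_iteratedFDeriv_fderiv, hfd]
    exact hA ξ

/-- A smooth function with bounded derivatives that is `1` near `S` and vanishes far from `S`. -/
theorem exists_smooth_indicator {n : ℕ} (S : Set (EuclideanSpace ℝ (Fin n))) :
    ∃ χ : EuclideanSpace ℝ (Fin n) → ℂ, ContDiff ℝ ∞ χ ∧
      (∀ j : ℕ, ∃ A : ℝ, ∀ ξ, ‖iteratedFDeriv ℝ j χ ξ‖ ≤ A) ∧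
      (∀ ξ ∈ Metric.thickening (1 / 4) S, χ ξ = 1) ∧
      ∀ ξ, χ ξ ≠ 0 → ξ ∈ Metric.thickening 1 S := by
  -- The indicator of the `1/2`-neighbourhood is mollified at scale `1/4`: it stays `1` within `1/4`
  -- of `S`, and vanishes beyond `3/4`, in particular beyond `1`.
  let ρ : ContDiffBump (0 : EuclideanSpace ℝ (Fin n)) := ⟨1 / 8, 1 / 4, by norm_num, by norm_num⟩
  let h : EuclideanSpace ℝ (Fin n) → ℂ := (Metric.thickening (1 / 2) S).indicator 1
  have hm : Measurable h := measurable_const.indicator Metric.isOpen_thickening.measurableSet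
  have hb : ∀ t, ‖h t‖ ≤ 1 := fun t => by
    by_cases ht : t ∈ Metric.thickening (1 / 2) S
    · simp only [h, indicator_of_mem ht, Pi.one_apply, norm_one, le_refl]
    · simp only [h, indicator_of_notMem ht, norm_zero, zero_le_one]
  have hli : LocallyIntegrable h volume := by
    refine (locallyIntegrable_const (1 : ℝ)).mono hm.aestronglyMeasurable
      (Eventually.of_forall fun t => ?_)
    simpa using hb t
  have hρ : ContDiff ℝ ∞ (ρ.normed volume) := ρ.contDiff_normed
  have hρc : HasCompactSupport (ρ.normed volume) := ρ.hasCompactSupport_normed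
  have hconst : ∀ ξ, (∀ t ∈ Metric.ball ξ (1 / 4), h t = h ξ) →
      (ρ.normed volume ⋆[ContinuousLinearMap.lsmul ℝ ℝ, volume] h) ξ = h ξ := fun ξ hξ =>
    ContDiffBump.normed_convolution_eq_right (φ := ρ) hξ
  refine ⟨ρ.normed volume ⋆[ContinuousLinearMap.lsmul ℝ ℝ, volume] h,
    hρc.contDiff_convolution_left _ hρ hli,
    fun j => exists_bound_iteratedFDeriv_convolution hm.aestronglyMeasurable hb j _ _ hρ hρc,
    fun ξ hξ => ?_, fun ξ hξ => ?_⟩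
  · have h1 : ∀ t ∈ Metric.ball ξ (1 / 4), h t = 1 := fun t ht => by
      have : t ∈ Metric.thickening (1 / 2) S := by
        obtain ⟨s, hs, hd⟩ := Metric.mem_thickening_iff.1 hξ
        refine Metric.mem_thickening_iff.2 ⟨s, hs, ?_⟩
        have := dist_triangle t ξ s
        have := Metric.mem_ball.1 ht
        linarith
      exact indicator_of_mem this _
    have h2 := h1 ξ (Metric.mem_ball_self (by norm_num))
    rw [hconst ξ fun t ht => (h1 t ht).trans h2.symm, h2]
  · by_contra hcon
    have h1 : ∀ t ∈ Metric.ball ξ (1 / 4), h t = 0 := fun t ht => by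
      have : t ∉ Metric.thickening (1 / 2) S := fun htS => hcon <| by
        obtain ⟨s, hs, hd⟩ := Metric.mem_thickening_iff.1 htS
        refine Metric.mem_thickening_iff.2 ⟨s, hs, ?_⟩
        have := dist_triangle ξ t s
        have := Metric.mem_ball'.1 ht
        linarith
      exact indicator_of_notMem this _
    have h2 := h1 ξ (Metric.mem_ball_self (by norm_num))
    exact hξ ((hconst ξ fun t ht => (h1 t ht).trans h2.symm).trans h2)

end SmoothIndicator

/-! ### Cones -/

section Cones

variable {n : ℕ} {C C' : Set (EuclideanSpace ℝ (Fin n))}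

/-- The origin must be excluded because `CompactIn` compares directions only. -/
theorem IsSubcone.mem (hC : IsOpenCone C) (h : IsSubcone C C') {y : EuclideanSpace ℝ (Fin n)}
    (hy : y ∈ C') (h0 : y ≠ 0) : y ∈ C := by
  have hpos : 0 < ‖y‖ := norm_pos_iff.2 h0
  have h1 : ‖y‖⁻¹ • y ∈ C' := h.1.2 y hy _ (inv_pos.2 hpos)
  have h2 : ‖y‖⁻¹ • y ∈ Metric.sphere (0 : EuclideanSpace ℝ (Fin n)) 1 := by
    rw [mem_sphere_zero_iff_norm, norm_smul, norm_inv, norm_norm, inv_mul_cancel₀ hpos.ne']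
  have h3 := hC.2 _ (h.2 ⟨subset_closure h1, h2⟩).1 _ hpos
  rwa [smul_smul, mul_inv_cancel₀ hpos.ne', one_smul] at h3

theorem zero_mem_dualCone : (0 : EuclideanSpace ℝ (Fin n)) ∈ dualCone C := fun x _ => by simp

theorem smul_mem_dualCone {ξ : EuclideanSpace ℝ (Fin n)} (hξ : ξ ∈ dualCone C) {t : ℝ}
    (ht : 0 ≤ t) : t • ξ ∈ dualCone C := fun x hx => by
  rw [real_inner_smul_left]
  exact mul_nonneg ht (hξ x hx)

/-- The supremum is attained at `ξ = 0`. This reduces the weight in the growth condition to `1` on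
`C`. -/
theorem indicatorFn_dualCone {y : EuclideanSpace ℝ (Fin n)} (hy : y ∈ C) :
    indicatorFn (dualCone C) y = 0 := by
  refine le_antisymm (iSup₂_le fun ξ hξ => ?_) ?_
  · have : -(inner ℝ ξ y) ≤ (0 : ℝ) := neg_nonpos.2 (hξ y hy)
    exact_mod_cast this
  · refine le_trans ?_ (le_iSup₂ (0 : EuclideanSpace ℝ (Fin n)) zero_mem_dualCone)
    simp

/-- On a cone that is compact in `C`, the elements of the dual cone are uniformly positive. -/
theorem IsSubcone.exists_le_inner (hC : IsOpenCone C) (h : IsSubcone C C') :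
    ∃ c : ℝ, 0 < c ∧ c ≤ 1 ∧ ∀ y ∈ C', ∀ ξ ∈ dualCone C, c * ‖y‖ * ‖ξ‖ ≤ inner ℝ ξ y := by
  have hK : IsCompact (closure C' ∩ Metric.sphere (0 : EuclideanSpace ℝ (Fin n)) 1) :=
    (isCompact_sphere _ _).inter_left isClosed_closure
  obtain ⟨δ, hδ, hδC⟩ := hK.exists_cthickening_subset_open hC.1 (h.2.trans inter_subset_left)
  refine ⟨min δ 1, lt_min hδ one_pos, min_le_right _ _, fun y hy ξ hξ => ?_⟩
  rcases eq_or_ne y 0 with rfl | hy0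
  · simp
  rcases eq_or_ne ξ 0 with rfl | hξ0
  · simp
  have hpos : 0 < ‖y‖ := norm_pos_iff.2 hy0
  have hξpos : 0 < ‖ξ‖ := norm_pos_iff.2 hξ0
  have h1 : ‖y‖⁻¹ • y ∈ closure C' ∩ Metric.sphere (0 : EuclideanSpace ℝ (Fin n)) 1 := by
    refine ⟨subset_closure (h.1.2 y hy _ (inv_pos.2 hpos)), ?_⟩
    rw [mem_sphere_zero_iff_norm, norm_smul, norm_inv, norm_norm, inv_mul_cancel₀ hpos.ne']
  -- The unit vector `y/‖y‖` is moved by `δ` against `ξ` without leaving `C`; testing `ξ ∈ C*` on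
  -- the new point yields the gain `δ‖ξ‖`.
  have h2 : ‖y‖⁻¹ • y - (δ * ‖ξ‖⁻¹) • ξ ∈ C := by
    refine hδC (Metric.mem_cthickening_of_dist_le _ _ _ _ h1 ?_)
    rw [dist_eq_norm, sub_sub_cancel_left, norm_neg, norm_smul, norm_mul, norm_inv, norm_norm,
      Real.norm_of_nonneg hδ.le, mul_assoc, inv_mul_cancel₀ hξpos.ne', mul_one]
  have h3 := hξ _ h2
  rw [inner_sub_right, real_inner_smul_right, real_inner_smul_right,
    real_inner_self_eq_norm_sq] at h3
  have h4 : δ * ‖ξ‖⁻¹ * ‖ξ‖ ^ 2 = δ * ‖ξ‖ := by field_simp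
  rw [h4] at h3
  have h5 : δ * ‖ξ‖ ≤ ‖y‖⁻¹ * inner ℝ ξ y := by linarith
  calc min δ 1 * ‖y‖ * ‖ξ‖ ≤ δ * ‖y‖ * ‖ξ‖ := by gcongr; exact min_le_left _ _
    _ = ‖y‖ * (δ * ‖ξ‖) := by ring
    _ ≤ ‖y‖ * (‖y‖⁻¹ * inner ℝ ξ y) := by gcongr
    _ = inner ℝ ξ y := by rw [← mul_assoc, mul_inv_cancel₀ hpos.ne', one_mul]

/-- Every compact subset of `C \ {0}` is contained in an open cone that is compact in `C`. -/
theorem exists_isSubcone_of_isCompact (hC : IsOpenCone C) {S : Set (EuclideanSpace ℝ (Fin n))}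
    (hS : IsCompact S) (hSC : S ⊆ C) (h0 : (0 : EuclideanSpace ℝ (Fin n)) ∉ S) :
    ∃ C', IsSubcone C C' ∧ S ⊆ C' := by
  let ν : EuclideanSpace ℝ (Fin n) → EuclideanSpace ℝ (Fin n) := fun x => ‖x‖⁻¹ • x
  have hν : ContinuousOn ν {0}ᶜ := fun x hx =>
    ((continuousAt_id.norm.inv₀ (norm_ne_zero_iff.2 hx)).smul continuousAt_id).continuousWithinAt
  have hSν : IsCompact (ν '' S) :=
    hS.image_of_continuousOn (hν.mono fun x hx hx0 => h0 (by rwa [← mem_singleton_iff.1 hx0]))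
  have hSνC : ν '' S ⊆ C := by
    rintro _ ⟨x, hx, rfl⟩
    refine hC.2 x (hSC hx) _ (inv_pos.2 (norm_pos_iff.2 ?_))
    rintro rfl
    exact h0 hx
  obtain ⟨δ, hδ, hδC⟩ := hSν.exists_cthickening_subset_open hC.1 hSνC
  -- The cone consists of the directions within `δ` of the radial projection of `S`, where the
  -- closed `δ`-neighbourhood is still inside `C`.
  refine ⟨{0}ᶜ ∩ ν ⁻¹' Metric.thickening δ (ν '' S), ⟨⟨?_, ?_⟩, ?_⟩, ?_⟩
  · exact hν.isOpen_inter_preimage isOpen_compl_singleton Metric.isOpen_thickening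
  · rintro x ⟨hx0, hx⟩ t ht
    refine ⟨smul_ne_zero ht.ne' hx0, ?_⟩
    have : ν (t • x) = ν x := by
      simp only [ν, norm_smul, Real.norm_of_nonneg ht.le, smul_smul, mul_inv]
      rw [mul_right_comm, inv_mul_cancel₀ ht.ne', one_mul]
    rwa [mem_preimage, this]
  · rintro x ⟨hx, hx1⟩
    refine ⟨hδC ?_, hx1⟩
    have hxn : ‖x‖ = 1 := mem_sphere_zero_iff_norm.1 hx1
    have hx0 : x ≠ 0 := norm_ne_zero_iff.1 (by rw [hxn]; exact one_ne_zero)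
    have hνx : ν x = x := by simp [ν, hxn]
    refine Metric.closure_thickening_subset_cthickening _ _ ?_
    rw [← hνx]
    have hc : ContinuousWithinAt ν ({0}ᶜ ∩ ν ⁻¹' Metric.thickening δ (ν '' S)) x :=
      (hν.continuousAt (isOpen_compl_singleton.mem_nhds hx0)).continuousWithinAt
    exact hc.mem_closure hx fun y hy => hy.2
  · intro x hx
    refine ⟨fun hx0 => h0 (by rwa [← mem_singleton_iff.1 hx0]), ?_⟩
    have hx' : ν x ∈ ν '' S := ⟨x, hx, rfl⟩
    exact mem_preimage.2 (Metric.self_subset_thickening hδ (ν '' S) hx')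

end Cones

/-! ### Exponentially weighted spaces of finite order -/

section WeightedJets

variable {n : ℕ}

/-- The smooth functions whose derivatives up to order `m` are `O(exp (-R‖ξ‖))`. -/
def weightedSpace (n : ℕ) (R : ℝ) (m : ℕ) : Submodule ℂ (EuclideanSpace ℝ (Fin n) → ℂ) where
  carrier := {φ | ContDiff ℝ ∞ φ ∧ ∃ B : ℝ, ∀ j ≤ m, ∀ ξ,
    Real.exp (R * ‖ξ‖) * ‖iteratedFDeriv ℝ j φ ξ‖ ≤ B}
  zero_mem' := by
    refine ⟨contDiff_const, 0, fun j _ ξ => ?_⟩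
    have h : iteratedFDeriv ℝ j (0 : EuclideanSpace ℝ (Fin n) → ℂ) ξ = 0 := by
      rw [iteratedFDeriv_zero]; rfl
    simp [h]
  add_mem' := by
    rintro φ ψ ⟨hφ, B₁, hB₁⟩ ⟨hψ, B₂, hB₂⟩
    refine ⟨hφ.add hψ, B₁ + B₂, fun j hj ξ => ?_⟩
    have hm : ((j : ℕ∞) : WithTop ℕ∞) ≤ ∞ := mod_cast le_top
    rw [iteratedFDeriv_add_apply (hφ.of_le hm).contDiffAt (hψ.of_le hm).contDiffAt]
    refine (mul_le_mul_of_nonneg_left (norm_add_le _ _) (Real.exp_pos _).le).trans ?_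
    rw [mul_add]
    exact add_le_add (hB₁ j hj ξ) (hB₂ j hj ξ)
  smul_mem' := by
    rintro c φ ⟨hφ, B, hB⟩
    refine ⟨hφ.const_smul c, ‖c‖ * B, fun j hj ξ => ?_⟩
    have hm : ((j : ℕ∞) : WithTop ℕ∞) ≤ ∞ := mod_cast le_top
    rw [iteratedFDeriv_const_smul_apply (hφ.of_le hm).contDiffAt, norm_smul, mul_left_comm]
    exact mul_le_mul_of_nonneg_left (hB j hj ξ) (norm_nonneg _)

/-- The space of weighted jets. -/
def JetSpace (n m : ℕ) : Type :=
  (j : Fin (m + 1)) → EuclideanSpace ℝ (Fin n) →ᵇ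
    ContinuousMultilinearMap ℝ (fun _ : Fin (j : ℕ) => EuclideanSpace ℝ (Fin n)) ℂ

instance (m : ℕ) : NormedAddCommGroup (JetSpace n m) :=
  inferInstanceAs (NormedAddCommGroup ((j : Fin (m + 1)) → EuclideanSpace ℝ (Fin n) →ᵇ
    ContinuousMultilinearMap ℝ (fun _ : Fin (j : ℕ) => EuclideanSpace ℝ (Fin n)) ℂ))

instance (m : ℕ) : NormedSpace ℂ (JetSpace n m) :=
  inferInstanceAs (NormedSpace ℂ ((j : Fin (m + 1)) → EuclideanSpace ℝ (Fin n) →ᵇ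
    ContinuousMultilinearMap ℝ (fun _ : Fin (j : ℕ) => EuclideanSpace ℝ (Fin n)) ℂ))

instance (m : ℕ) : CompleteSpace (JetSpace n m) :=
  inferInstanceAs (CompleteSpace ((j : Fin (m + 1)) → EuclideanSpace ℝ (Fin n) →ᵇ
    ContinuousMultilinearMap ℝ (fun _ : Fin (j : ℕ) => EuclideanSpace ℝ (Fin n)) ℂ))

/-- Evaluation of one entry of a jet at a point. -/
def jetEval {m : ℕ} (j : Fin (m + 1)) (ξ : EuclideanSpace ℝ (Fin n)) : JetSpace n m →L[ℂ]
    ContinuousMultilinearMap ℝ (fun _ : Fin (j : ℕ) => EuclideanSpace ℝ (Fin n)) ℂ :=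
  LinearMap.mkContinuous
    { toFun := fun J => (show (j : Fin (m + 1)) → EuclideanSpace ℝ (Fin n) →ᵇ
        ContinuousMultilinearMap ℝ (fun _ : Fin (j : ℕ) => EuclideanSpace ℝ (Fin n)) ℂ from J) j ξ
      map_add' := fun _ _ => rfl
      map_smul' := fun _ _ => rfl } 1 fun J => by
    rw [one_mul]
    exact (BoundedContinuousFunction.norm_coe_le_norm _ ξ).trans (norm_le_pi_norm
      (show (j : Fin (m + 1)) → EuclideanSpace ℝ (Fin n) →ᵇ
        ContinuousMultilinearMap ℝ (fun _ : Fin (j : ℕ) => EuclideanSpace ℝ (Fin n)) ℂ from J) j)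

theorem norm_jetEval_le {m : ℕ} (j : Fin (m + 1)) (ξ : EuclideanSpace ℝ (Fin n))
    (J : JetSpace n m) : ‖jetEval j ξ J‖ ≤ ‖J‖ :=
  (BoundedContinuousFunction.norm_coe_le_norm _ ξ).trans (norm_le_pi_norm
    (show (j : Fin (m + 1)) → EuclideanSpace ℝ (Fin n) →ᵇ
      ContinuousMultilinearMap ℝ (fun _ : Fin (j : ℕ) => EuclideanSpace ℝ (Fin n)) ℂ from J) j)

theorem jetSpace_norm_le {m : ℕ} {J : JetSpace n m} {B : ℝ} (hB0 : 0 ≤ B)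
    (hB : ∀ j ξ, ‖jetEval j ξ J‖ ≤ B) : ‖J‖ ≤ B :=
  (pi_norm_le_iff_of_nonneg hB0).2 fun j => (BoundedContinuousFunction.norm_le hB0).2 fun ξ =>
    hB j ξ

theorem jetSpace_ext {m : ℕ} {J J' : JetSpace n m} (h : ∀ j ξ, jetEval j ξ J = jetEval j ξ J') :
    J = J' :=
  funext fun j => BoundedContinuousFunction.ext fun ξ => h j ξ

/-- The weighted jet of order `m` of a function. -/
def jetMap (n : ℕ) (R : ℝ) (m : ℕ) : weightedSpace n R m →ₗ[ℂ] JetSpace n m where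
  toFun φ := fun j => BoundedContinuousFunction.ofNormedAddCommGroup
    (fun ξ => Real.exp (R * ‖ξ‖) • iteratedFDeriv ℝ (j : ℕ) (φ : EuclideanSpace ℝ (Fin n) → ℂ) ξ)
    (by
      have h0 : Continuous (iteratedFDeriv ℝ (j : ℕ) (φ : EuclideanSpace ℝ (Fin n) → ℂ)) :=
        φ.2.1.continuous_iteratedFDeriv (mod_cast le_top)
      fun_prop)
    φ.2.2.choose
    (fun ξ => by
      rw [norm_smul, Real.norm_of_nonneg (Real.exp_pos _).le]
      exact φ.2.2.choose_spec j (Nat.lt_succ_iff.1 j.2) ξ)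
  map_add' φ ψ := by
    refine jetSpace_ext fun j ξ => ?_
    change Real.exp (R * ‖ξ‖) • iteratedFDeriv ℝ (j : ℕ)
        ((φ : EuclideanSpace ℝ (Fin n) → ℂ) + (ψ : EuclideanSpace ℝ (Fin n) → ℂ)) ξ =
      Real.exp (R * ‖ξ‖) • iteratedFDeriv ℝ (j : ℕ) (φ : EuclideanSpace ℝ (Fin n) → ℂ) ξ +
      Real.exp (R * ‖ξ‖) • iteratedFDeriv ℝ (j : ℕ) (ψ : EuclideanSpace ℝ (Fin n) → ℂ) ξ
    have hm : (((j : ℕ) : ℕ∞) : WithTop ℕ∞) ≤ ∞ := mod_cast le_top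
    rw [iteratedFDeriv_add_apply (φ.2.1.of_le hm).contDiffAt (ψ.2.1.of_le hm).contDiffAt, smul_add]
  map_smul' c φ := by
    refine jetSpace_ext fun j ξ => ?_
    change Real.exp (R * ‖ξ‖) • iteratedFDeriv ℝ (j : ℕ)
        (c • (φ : EuclideanSpace ℝ (Fin n) → ℂ)) ξ =
      c • Real.exp (R * ‖ξ‖) • iteratedFDeriv ℝ (j : ℕ) (φ : EuclideanSpace ℝ (Fin n) → ℂ) ξ
    have hm : (((j : ℕ) : ℕ∞) : WithTop ℕ∞) ≤ ∞ := mod_cast le_top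
    rw [iteratedFDeriv_const_smul_apply (φ.2.1.of_le hm).contDiffAt, smul_comm]

theorem jetMap_apply {R : ℝ} {m : ℕ} (φ : weightedSpace n R m) (j : Fin (m + 1))
    (ξ : EuclideanSpace ℝ (Fin n)) :
    jetEval j ξ (jetMap n R m φ) =
      Real.exp (R * ‖ξ‖) • iteratedFDeriv ℝ (j : ℕ) (φ : EuclideanSpace ℝ (Fin n) → ℂ) ξ := rfl

theorem norm_jetMap_le {R : ℝ} {m : ℕ} (φ : weightedSpace n R m) {B : ℝ} (hB0 : 0 ≤ B)
    (hB : ∀ j ≤ m, ∀ ξ, Real.exp (R * ‖ξ‖) *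
      ‖iteratedFDeriv ℝ j (φ : EuclideanSpace ℝ (Fin n) → ℂ) ξ‖ ≤ B) :
    ‖jetMap n R m φ‖ ≤ B := by
  refine jetSpace_norm_le hB0 fun j ξ => ?_
  rw [jetMap_apply, norm_smul, Real.norm_of_nonneg (Real.exp_pos _).le]
  exact hB j (Nat.lt_succ_iff.1 j.2) ξ

theorem le_norm_jetMap {R : ℝ} {m : ℕ} (φ : weightedSpace n R m) {j : ℕ} (hj : j ≤ m)
    (ξ : EuclideanSpace ℝ (Fin n)) :
    Real.exp (R * ‖ξ‖) * ‖iteratedFDeriv ℝ j (φ : EuclideanSpace ℝ (Fin n) → ℂ) ξ‖ ≤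
      ‖jetMap n R m φ‖ := by
  have h2 := norm_jetEval_le ⟨j, Nat.lt_succ_iff.2 hj⟩ ξ (jetMap n R m φ)
  rwa [jetMap_apply, norm_smul, Real.norm_of_nonneg (Real.exp_pos _).le] at h2

/-- The entry of order zero determines the function. -/
theorem jetMap_injective (R : ℝ) (m : ℕ) : Function.Injective (jetMap n R m) := by
  refine (injective_iff_map_eq_zero _).2 fun φ hφ => ?_
  ext ξ
  have h := le_norm_jetMap φ (Nat.zero_le m) ξ
  rw [hφ, norm_zero, norm_iteratedFDeriv_zero] at h
  have h2 : ‖(φ : EuclideanSpace ℝ (Fin n) → ℂ) ξ‖ ≤ 0 := by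
    by_contra hc
    exact absurd h (not_le.2 (mul_pos (Real.exp_pos _) (not_le.1 hc)))
  exact norm_le_zero_iff.1 h2

theorem mem_weightedSpace_of_hasCompactSupport {φ : EuclideanSpace ℝ (Fin n) → ℂ}
    (h : ContDiff ℝ ∞ φ) (hc : HasCompactSupport φ) (R : ℝ) (m : ℕ) : φ ∈ weightedSpace n R m := by
  have hB : ∀ j : ℕ, ∃ B : ℝ, ∀ ξ, Real.exp (R * ‖ξ‖) * ‖iteratedFDeriv ℝ j φ ξ‖ ≤ B := fun j => by
    have h0 : Continuous (iteratedFDeriv ℝ j φ) := h.continuous_iteratedFDeriv (mod_cast le_top)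
    have h1 : Continuous (fun ξ => Real.exp (R * ‖ξ‖) * ‖iteratedFDeriv ℝ j φ ξ‖) := by fun_prop
    have h2 : HasCompactSupport (fun ξ => Real.exp (R * ‖ξ‖) * ‖iteratedFDeriv ℝ j φ ξ‖) :=
      (hc.iteratedFDeriv j).norm.mul_left
    obtain ⟨B, hB⟩ := h1.bounded_above_of_compact_support h2
    exact ⟨B, fun ξ => (le_abs_self _).trans (hB ξ)⟩
  choose B hB using hB
  refine ⟨h, ∑ j ∈ Finset.range (m + 1), |B j|, fun j hj ξ => (hB j ξ).trans ?_⟩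
  exact (le_abs_self _).trans (Finset.single_le_sum (f := fun j => |B j|)
    (fun _ _ => abs_nonneg _) (Finset.mem_range.2 (Nat.lt_succ_iff.2 hj)))

/-- The weighted jet of a function, defined to be `0` outside the weighted space. -/
def jet (R : ℝ) (m : ℕ) (φ : EuclideanSpace ℝ (Fin n) → ℂ) : JetSpace n m :=
  open Classical in if h : φ ∈ weightedSpace n R m then jetMap n R m ⟨φ, h⟩ else 0

theorem jet_of_mem {R : ℝ} {m : ℕ} {φ : EuclideanSpace ℝ (Fin n) → ℂ}
    (h : φ ∈ weightedSpace n R m) : jet R m φ = jetMap n R m ⟨φ, h⟩ := dif_pos h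

theorem jet_apply {R : ℝ} {m : ℕ} {φ : EuclideanSpace ℝ (Fin n) → ℂ}
    (h : φ ∈ weightedSpace n R m) (j : Fin (m + 1)) (ξ : EuclideanSpace ℝ (Fin n)) :
    jetEval j ξ (jet R m φ) = Real.exp (R * ‖ξ‖) • iteratedFDeriv ℝ (j : ℕ) φ ξ := by
  rw [jet_of_mem h, jetMap_apply]

theorem jet_add {R : ℝ} {m : ℕ} {φ ψ : EuclideanSpace ℝ (Fin n) → ℂ}
    (h : φ ∈ weightedSpace n R m) (h' : ψ ∈ weightedSpace n R m) :
    jet R m (φ + ψ) = jet R m φ + jet R m ψ := by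
  rw [jet_of_mem h, jet_of_mem h', jet_of_mem (Submodule.add_mem _ h h'), ← map_add]
  rfl

theorem jet_sub {R : ℝ} {m : ℕ} {φ ψ : EuclideanSpace ℝ (Fin n) → ℂ}
    (h : φ ∈ weightedSpace n R m) (h' : ψ ∈ weightedSpace n R m) :
    jet R m (φ - ψ) = jet R m φ - jet R m ψ := by
  rw [jet_of_mem h, jet_of_mem h', jet_of_mem (Submodule.sub_mem _ h h'), ← map_sub]
  rfl

theorem jet_smul {R : ℝ} {m : ℕ} {φ : EuclideanSpace ℝ (Fin n) → ℂ} (c : ℂ)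
    (h : φ ∈ weightedSpace n R m) : jet R m (c • φ) = c • jet R m φ := by
  rw [jet_of_mem h, jet_of_mem (Submodule.smul_mem _ c h), ← map_smul]
  rfl

theorem norm_jet_le {R : ℝ} {m : ℕ} {φ : EuclideanSpace ℝ (Fin n) → ℂ} (h : ContDiff ℝ ∞ φ)
    {B : ℝ} (hB0 : 0 ≤ B)
    (hB : ∀ j ≤ m, ∀ ξ, Real.exp (R * ‖ξ‖) * ‖iteratedFDeriv ℝ j φ ξ‖ ≤ B) :
    ‖jet R m φ‖ ≤ B := by
  have hm : φ ∈ weightedSpace n R m := ⟨h, B, hB⟩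
  rw [jet_of_mem hm]
  exact norm_jetMap_le _ hB0 hB

/-- The smooth functions with compact support. -/
def bumpSpace (n : ℕ) : Submodule ℂ (EuclideanSpace ℝ (Fin n) → ℂ) where
  carrier := {φ | ContDiff ℝ ∞ φ ∧ HasCompactSupport φ}
  zero_mem' := ⟨contDiff_const, HasCompactSupport.zero⟩
  add_mem' h h' := ⟨h.1.add h'.1, h.2.add h'.2⟩
  smul_mem' c _ h := ⟨h.1.const_smul c, h.2.smul_left (f := fun _ => c)⟩

theorem bumpSpace_le_weightedSpace (R : ℝ) (m : ℕ) : bumpSpace n ≤ weightedSpace n R m :=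
  fun _ h => mem_weightedSpace_of_hasCompactSupport h.1 h.2 R m

theorem bumpSpace_le_testSpace (O : Set (EuclideanSpace ℝ (Fin n))) :
    bumpSpace n ≤ testSpace O := fun _ h => mem_testSpace O h.1 h.2

/-- On smooth functions with compact support, an element of `H'(ℝⁿ; O)` is a continuous functional
of weighted jets. -/
theorem exists_jet_extension {O : Set (EuclideanSpace ℝ (Fin n))} {V : testSpace O →ₗ[ℂ] ℂ}
    (hV : V ∈ expDual O) : ∃ (R₀ : ℝ) (m₀ : ℕ), ∀ R ≥ R₀, ∀ m ≥ m₀,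
      ∃ Λ : JetSpace n m →L[ℂ] ℂ, ∀ φ (h : φ ∈ bumpSpace n),
        V ⟨φ, bumpSpace_le_testSpace O h⟩ = Λ (jet R m φ) := by
  obtain ⟨K, -, -, hK, m₀, M, hM0, hM⟩ := hV
  obtain ⟨R₀, hR₀, hKR⟩ := hK_le hK
  refine ⟨R₀, m₀, fun R hR m hm => ?_⟩
  let ι : bumpSpace n →ₗ[ℂ] JetSpace n m :=
    (jetMap n R m).comp (Submodule.inclusion (bumpSpace_le_weightedSpace R m))
  have hι : Function.Injective ι :=
    (jetMap_injective R m).comp (Submodule.inclusion_injective _)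
  let e := LinearEquiv.ofInjective ι hι
  let V₀ : bumpSpace n →ₗ[ℂ] ℂ := V.comp (Submodule.inclusion (bumpSpace_le_testSpace O))
  -- The weight `exp (h_K)` is at most `exp (R₀‖ξ‖)`, so every `R ≥ R₀` and `m ≥ m₀` works; this
  -- freedom lets two functionals share one jet space.
  have hV₀ : ∀ φ, ‖V₀ φ‖ ≤ M * ‖ι φ‖ := fun φ => by
    refine hM _ _ fun j hj ξ => le_trans ?_ (le_norm_jetMap _ (hj.trans hm) ξ)
    refine mul_le_mul_of_nonneg_right (Real.exp_le_exp.2 ((hKR ξ).trans ?_)) (norm_nonneg _)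
    rw [mul_comm]
    exact mul_le_mul_of_nonneg_right hR (norm_nonneg _)
  let g : StrongDual ℂ (LinearMap.range ι) := LinearMap.mkContinuous
    (V₀.comp e.symm.toLinearMap) M fun x => by
      obtain ⟨φ, rfl⟩ := e.surjective x
      have : (V₀.comp e.symm.toLinearMap) (e φ) = V₀ φ := by simp
      rw [this]
      exact hV₀ φ
  -- Hahn–Banach extends the functional from the jets of compactly supported functions to all
  -- weighted jets.
  obtain ⟨Λ, hΛ, -⟩ := exists_extension_norm_eq (LinearMap.range ι) g
  refine ⟨Λ, fun φ h => ?_⟩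
  have h1 := hΛ (e ⟨φ, h⟩)
  have h2 : g (e ⟨φ, h⟩) = V₀ ⟨φ, h⟩ := by simp [g]
  rw [h2] at h1
  rw [jet_of_mem (bumpSpace_le_weightedSpace R m h)]
  exact h1.symm

end WeightedJets

/-! ### Jets of localized exponentials -/

section LocalizedExp

variable {n : ℕ}

/-- Smooth functions all of whose derivatives are bounded. -/
def HasBoundedDerivs (g : EuclideanSpace ℝ (Fin n) → ℂ) : Prop :=
  ContDiff ℝ ∞ g ∧ ∀ j : ℕ, ∃ A : ℝ, ∀ ξ, ‖iteratedFDeriv ℝ j g ξ‖ ≤ A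

/-- `exp (-⟨ξ, y⟩)` is `O(exp (-R‖ξ‖))` on the support of `g`. -/
def DecaysOn (g : EuclideanSpace ℝ (Fin n) → ℂ) (R : ℝ) (y : EuclideanSpace ℝ (Fin n)) : Prop :=
  ∃ A : ℝ, ∀ ξ, g ξ ≠ 0 → Real.exp (-inner ℝ ξ y) ≤ A * Real.exp (-(R * ‖ξ‖))

theorem HasBoundedDerivs.exists_bound {g : EuclideanSpace ℝ (Fin n) → ℂ} (hg : HasBoundedDerivs g)
    (m : ℕ) : ∃ G : ℝ, 0 ≤ G ∧ ∀ j ≤ m, ∀ ξ, ‖iteratedFDeriv ℝ j g ξ‖ ≤ G := by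
  choose A hA using hg.2
  refine ⟨∑ j ∈ Finset.range (m + 1), |A j|, Finset.sum_nonneg fun _ _ => abs_nonneg _,
    fun j hj ξ => (hA j ξ).trans ?_⟩
  exact (le_abs_self _).trans (Finset.single_le_sum (f := fun j => |A j|)
    (fun _ _ => abs_nonneg _) (Finset.mem_range.2 (Nat.lt_succ_iff.2 hj)))

theorem contDiff_exp_phase (z : EuclideanSpace ℂ (Fin n)) :
    ContDiff ℝ ∞ fun ξ => Complex.exp (phase z ξ) := contDiff_exp_clm _

theorem contDiff_mul_exp_phase {g : EuclideanSpace ℝ (Fin n) → ℂ} (hg : ContDiff ℝ ∞ g)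
    (z : EuclideanSpace ℂ (Fin n)) : ContDiff ℝ ∞ fun ξ => g ξ * Complex.exp (phase z ξ) :=
  hg.mul (contDiff_exp_phase z)

theorem iteratedFDeriv_mul_eq_zero {g h : EuclideanSpace ℝ (Fin n) → ℂ}
    {ξ : EuclideanSpace ℝ (Fin n)} (hξ : ξ ∉ tsupport g) (j : ℕ) :
    iteratedFDeriv ℝ j (fun ξ => g ξ * h ξ) ξ = 0 := by
  by_contra hc
  exact hξ (tsupport_mul_subset_left (support_iteratedFDeriv_subset j hc))

/-- The inequality is a closed condition on `ξ`, so it passes to the closure of `{g ≠ 0}`, which is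
where derivatives of `g` may survive. -/
theorem le_of_mem_tsupport {g : EuclideanSpace ℝ (Fin n) → ℂ} {R A : ℝ}
    {y ξ : EuclideanSpace ℝ (Fin n)}
    (hA : ∀ ξ, g ξ ≠ 0 → Real.exp (-inner ℝ ξ y) ≤ A * Real.exp (-(R * ‖ξ‖)))
    (hξ : ξ ∈ tsupport g) : Real.exp (-inner ℝ ξ y) ≤ A * Real.exp (-(R * ‖ξ‖)) := by
  have hcl : IsClosed {ξ : EuclideanSpace ℝ (Fin n) |
      Real.exp (-inner ℝ ξ y) ≤ A * Real.exp (-(R * ‖ξ‖))} :=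
    isClosed_le (by fun_prop) (by fun_prop)
  exact hcl.closure_subset_iff.2 (fun ξ h => hA ξ h) hξ

/-- The basic estimate of the derivatives of a localized exponential. -/
theorem norm_iteratedFDeriv_mul_exp_phase_le {g : EuclideanSpace ℝ (Fin n) → ℂ}
    (hg : ContDiff ℝ ∞ g) {m : ℕ} {G R A : ℝ} {z : EuclideanSpace ℂ (Fin n)} (hA0 : 0 ≤ A)
    (hG : ∀ j ≤ m, ∀ ξ, ‖iteratedFDeriv ℝ j g ξ‖ ≤ G)
    (hA : ∀ ξ, g ξ ≠ 0 → Real.exp (-inner ℝ ξ (imPart z)) ≤ A * Real.exp (-(R * ‖ξ‖)))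
    {j : ℕ} (hj : j ≤ m) (ξ : EuclideanSpace ℝ (Fin n)) :
    ‖iteratedFDeriv ℝ j (fun ξ => g ξ * Complex.exp (phase z ξ)) ξ‖ ≤
      2 ^ m * (G * ((1 + ‖z‖) ^ m * A)) * Real.exp (-(R * ‖ξ‖)) := by
  have hG0 : 0 ≤ G := (norm_nonneg _).trans (hG 0 (Nat.zero_le _) ξ)
  have hz : 0 ≤ ‖z‖ := norm_nonneg z
  by_cases hξ : ξ ∈ tsupport g
  · refine (norm_iteratedFDeriv_mul_le_of_le hg (contDiff_exp_phase z)
      (B := (1 + ‖z‖) ^ m * (A * Real.exp (-(R * ‖ξ‖)))) (fun i hi => hG i (hi.trans hj) ξ)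
      fun i hi => ?_).trans ?_
    · refine (norm_iteratedFDeriv_exp_phase_le z i ξ).trans ?_
      gcongr
      · calc ‖z‖ ^ i ≤ (1 + ‖z‖) ^ i := by gcongr; linarith
          _ ≤ (1 + ‖z‖) ^ m := pow_le_pow_right₀ (by linarith) (hi.trans hj)
      · exact le_of_mem_tsupport hA hξ
    · calc _ ≤ 2 ^ m * (G * ((1 + ‖z‖) ^ m * (A * Real.exp (-(R * ‖ξ‖))))) := by
            gcongr
            norm_num
        _ = _ := by ring
  · rw [iteratedFDeriv_mul_eq_zero hξ, norm_zero]
    positivity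

theorem DecaysOn.exists_bound {g : EuclideanSpace ℝ (Fin n) → ℂ} (hg : HasBoundedDerivs g)
    {R : ℝ} {z : EuclideanSpace ℂ (Fin n)} (h : DecaysOn g R (imPart z)) (m : ℕ) :
    ∃ B : ℝ, 0 ≤ B ∧ ∀ j ≤ m, ∀ ξ,
      ‖iteratedFDeriv ℝ j (fun ξ => g ξ * Complex.exp (phase z ξ)) ξ‖ ≤
        B * Real.exp (-(R * ‖ξ‖)) := by
  obtain ⟨G, hG0, hG⟩ := hg.exists_bound m
  obtain ⟨A, hA⟩ := h
  refine ⟨2 ^ m * (G * ((1 + ‖z‖) ^ m * |A|)), by positivity, fun j hj ξ => ?_⟩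
  refine norm_iteratedFDeriv_mul_exp_phase_le hg.1 (abs_nonneg A) hG (fun ξ hξ => ?_) hj ξ
  exact (hA ξ hξ).trans (mul_le_mul_of_nonneg_right (le_abs_self A) (Real.exp_pos _).le)

theorem exp_mul_le_of_le {R R' B a t : ℝ} (h : a ≤ B * Real.exp (-(R' * t))) :
    Real.exp (R * t) * a ≤ B * Real.exp (-((R' - R) * t)) := by
  calc Real.exp (R * t) * a ≤ Real.exp (R * t) * (B * Real.exp (-(R' * t))) := by gcongr
    _ = B * Real.exp (-((R' - R) * t)) := by
      rw [mul_left_comm, ← Real.exp_add]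
      ring_nf

/-- Polynomials times decaying exponentials are bounded. -/
theorem exists_pow_mul_exp_le (k : ℕ) {δ : ℝ} (hδ : 0 < δ) :
    ∃ B : ℝ, 0 ≤ B ∧ ∀ t : ℝ, 0 ≤ t → (1 + t) ^ k * Real.exp (-(δ * t)) ≤ B := by
  refine ⟨k.factorial / δ ^ k * Real.exp δ, by positivity, fun t ht => ?_⟩
  -- A single term of the exponential series at `δ(1 + t)` dominates the power.
  have h1 := Real.pow_div_factorial_le_exp (δ * (1 + t)) (by positivity) k
  rw [mul_pow, div_le_iff₀ (by positivity)] at h1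
  have h2 : Real.exp (δ * (1 + t)) * Real.exp (-(δ * t)) = Real.exp δ := by
    rw [← Real.exp_add]
    ring_nf
  calc (1 + t) ^ k * Real.exp (-(δ * t))
      = (δ ^ k * (1 + t) ^ k) / δ ^ k * Real.exp (-(δ * t)) := by field_simp
    _ ≤ (Real.exp (δ * (1 + t)) * k.factorial) / δ ^ k * Real.exp (-(δ * t)) := by gcongr
    _ = k.factorial / δ ^ k * (Real.exp (δ * (1 + t)) * Real.exp (-(δ * t))) := by ring
    _ = _ := by rw [h2]

theorem mem_weightedSpace_of_bound {φ : EuclideanSpace ℝ (Fin n) → ℂ} (hφ : ContDiff ℝ ∞ φ)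
    {R R' B : ℝ} {m : ℕ} (hR : R ≤ R') (hB0 : 0 ≤ B)
    (hB : ∀ j ≤ m, ∀ ξ, ‖iteratedFDeriv ℝ j φ ξ‖ ≤ B * Real.exp (-(R' * ‖ξ‖))) :
    φ ∈ weightedSpace n R m := by
  refine ⟨hφ, B, fun j hj ξ => (exp_mul_le_of_le (hB j hj ξ)).trans ?_⟩
  refine mul_le_of_le_one_right hB0 (Real.exp_le_one_iff.2 ?_)
  exact neg_nonpos.2 (mul_nonneg (sub_nonneg.2 hR) (norm_nonneg ξ))

theorem mul_exp_phase_mem {g : EuclideanSpace ℝ (Fin n) → ℂ} (hg : HasBoundedDerivs g)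
    {R R' : ℝ} (hR : R ≤ R') {z : EuclideanSpace ℂ (Fin n)} (h : DecaysOn g R' (imPart z))
    (m : ℕ) : (fun ξ => g ξ * Complex.exp (phase z ξ)) ∈ weightedSpace n R m := by
  obtain ⟨B, hB0, hB⟩ := h.exists_bound hg m
  exact mem_weightedSpace_of_bound (contDiff_mul_exp_phase hg.1 z) hR hB0 hB

/-- Multiplication by functions of moderate growth. -/
theorem exists_weighted_mul_bound {φ : EuclideanSpace ℝ (Fin n) → ℂ} (hφ : ContDiff ℝ ∞ φ)
    {R δ B : ℝ} {m : ℕ} (hδ : 0 < δ) (hB0 : 0 ≤ B)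
    (hB : ∀ j ≤ m, ∀ ξ, ‖iteratedFDeriv ℝ j φ ξ‖ ≤ B * Real.exp (-((R + 2 * δ) * ‖ξ‖))) :
    ∃ M : ℝ, 0 ≤ M ∧ ∀ h : EuclideanSpace ℝ (Fin n) → ℂ, ContDiff ℝ ∞ h → ∀ H : ℝ, 0 ≤ H →
      (∀ j ≤ m, ∀ ξ, ‖iteratedFDeriv ℝ j h ξ‖ ≤
        H * ((1 + ‖ξ‖) ^ 2 * Real.exp (δ * ‖ξ‖))) →
      (fun ξ => φ ξ * h ξ) ∈ weightedSpace n R m ∧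
        ‖jet R m fun ξ => φ ξ * h ξ‖ ≤ M * H := by
  obtain ⟨B₂, hB₂0, hB₂⟩ := exists_pow_mul_exp_le 2 hδ
  refine ⟨2 ^ m * (B * B₂), by positivity, fun h hh H hH0 hH => ?_⟩
  have key : ∀ j ≤ m, ∀ ξ, Real.exp (R * ‖ξ‖) *
      ‖iteratedFDeriv ℝ j (fun ξ => φ ξ * h ξ) ξ‖ ≤ 2 ^ m * (B * B₂) * H := fun j hj ξ => by
    have h1 := norm_iteratedFDeriv_mul_le_of_le hφ hh (fun i hi => hB i (hi.trans hj) ξ)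
      (fun i hi => hH i (hi.trans hj) ξ)
    -- Of the surplus decay `2δ`, one `δ` absorbs the growth `exp (δ‖ξ‖)` of the multiplier and the
    -- other its quadratic factor.
    have h2 : Real.exp (R * ‖ξ‖) * (Real.exp (-((R + 2 * δ) * ‖ξ‖)) * Real.exp (δ * ‖ξ‖)) =
        Real.exp (-(δ * ‖ξ‖)) := by
      rw [← Real.exp_add, ← Real.exp_add]
      ring_nf
    calc _ ≤ Real.exp (R * ‖ξ‖) * (2 ^ j * (B * Real.exp (-((R + 2 * δ) * ‖ξ‖)) *
          (H * ((1 + ‖ξ‖) ^ 2 * Real.exp (δ * ‖ξ‖))))) := by gcongr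
      _ = 2 ^ j * (B * ((1 + ‖ξ‖) ^ 2 * (Real.exp (R * ‖ξ‖) *
          (Real.exp (-((R + 2 * δ) * ‖ξ‖)) * Real.exp (δ * ‖ξ‖))))) * H := by ring
      _ = 2 ^ j * (B * ((1 + ‖ξ‖) ^ 2 * Real.exp (-(δ * ‖ξ‖)))) * H := by rw [h2]
      _ ≤ 2 ^ m * (B * B₂) * H := by
        gcongr
        · norm_num
        · exact hB₂ _ (norm_nonneg ξ)
  exact ⟨⟨hφ.mul hh, _, key⟩, norm_jet_le (hφ.mul hh) (by positivity) key⟩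

theorem norm_iteratedFDeriv_phase_le (w : EuclideanSpace ℂ (Fin n)) (j : ℕ)
    (ξ : EuclideanSpace ℝ (Fin n)) :
    ‖iteratedFDeriv ℝ j (fun ξ => phase w ξ) ξ‖ ≤ ‖w‖ * (1 + ‖ξ‖) := by
  have hξ : 0 ≤ ‖ξ‖ := norm_nonneg ξ
  have hw := norm_phase_le w
  match j with
  | 0 =>
    rw [norm_iteratedFDeriv_zero]
    refine ((phase w).le_opNorm ξ).trans ?_
    gcongr
    linarith
  | j + 1 =>
    have hd : ∀ η, HasFDerivAt (fun ξ => phase w ξ) ((1 : ℂ) • phase w) η := fun η => by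
      rw [one_smul]
      exact (phase w).hasFDerivAt
    refine (norm_iteratedFDeriv_succ_le_of_hasFDerivAt_smul (h := fun _ => 1) contDiff_const
      hd j ξ).trans ?_
    have h1 : ‖iteratedFDeriv ℝ j (fun _ : EuclideanSpace ℝ (Fin n) => (1 : ℂ)) ξ‖ ≤ 1 := by
      rcases Nat.eq_zero_or_pos j with rfl | hj
      · simp
      · rw [iteratedFDeriv_const_of_ne hj.ne']
        simp
    calc ‖phase w‖ * _ ≤ ‖w‖ * 1 := by gcongr
      _ ≤ ‖w‖ * (1 + ‖ξ‖) := by gcongr; linarith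

/-- The jets of localized exponentials depend holomorphically on the parameter. -/
theorem differentiableAt_jet_mul_exp_phase {g : EuclideanSpace ℝ (Fin n) → ℂ}
    (hg : HasBoundedDerivs g) {R R' : ℝ} (hR : R < R') {z : EuclideanSpace ℂ (Fin n)}
    (h : DecaysOn g R' (imPart z)) (m : ℕ) :
    DifferentiableAt ℂ (fun z => jet R m fun ξ => g ξ * Complex.exp (phase z ξ)) z := by
  set φ : EuclideanSpace ℝ (Fin n) → ℂ := fun ξ => g ξ * Complex.exp (phase z ξ) with hφd
  have hφ : ContDiff ℝ ∞ φ := contDiff_mul_exp_phase hg.1 z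
  obtain ⟨B, hB0, hB⟩ := h.exists_bound hg m
  obtain ⟨δ, hδ, rfl⟩ : ∃ δ, 0 < δ ∧ R' = R + 2 * δ := ⟨(R' - R) / 2, by linarith, by ring⟩
  obtain ⟨M, hM0, hM⟩ := exists_weighted_mul_bound hφ hδ hB0 hB
  have hφm : φ ∈ weightedSpace n R m := mul_exp_phase_mem hg hR.le h m
  have hphase : ∀ w, (fun ξ => φ ξ * phase w ξ) ∈ weightedSpace n R m := fun w => by
    refine (hM _ (phase w).contDiff ‖w‖ (norm_nonneg w) fun j _ ξ => ?_).1
    refine (norm_iteratedFDeriv_phase_le w j ξ).trans ?_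
    have hξ : 0 ≤ ‖ξ‖ := norm_nonneg ξ
    gcongr
    calc 1 + ‖ξ‖ ≤ (1 + ‖ξ‖) ^ 2 := by nlinarith
      _ ≤ (1 + ‖ξ‖) ^ 2 * Real.exp (δ * ‖ξ‖) :=
        le_mul_of_one_le_right (by positivity) (Real.one_le_exp (by positivity))
  -- The candidate derivative is the jet of the first order term `φ · i⟨ξ, w⟩`. Its continuity in
  -- `w` is automatic in finite dimension.
  let D₀ : EuclideanSpace ℂ (Fin n) →ₗ[ℂ] JetSpace n m :=
    { toFun := fun w => jet R m fun ξ => φ ξ * phase w ξ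
      map_add' := fun w w' => by
        rw [← jet_add (hphase w) (hphase w')]
        congr 1
        funext ξ
        simp only [phase_add, add_apply, mul_add, Pi.add_apply]
      map_smul' := fun c w => by
        rw [RingHom.id_apply, ← jet_smul c (hphase w)]
        congr 1
        funext ξ
        simp only [phase_smul, smul_apply, smul_eq_mul, Pi.smul_apply]
        ring }
  let D : EuclideanSpace ℂ (Fin n) →L[ℂ] JetSpace n m := LinearMap.toContinuousLinearMap D₀
  -- The exponential at `z + w` is `φ` times `1 + i⟨ξ, w⟩` plus a second order remainder. Here `‖w‖
  -- ≤ 1` serves the Taylor estimate, and `‖w‖ ≤ δ` keeps the growth of the remainder within the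
  -- surplus decay.
  have hrem : ∀ w : EuclideanSpace ℂ (Fin n), ‖w‖ ≤ min 1 δ →
      ‖(jet R m fun ξ => g ξ * Complex.exp (phase (z + w) ξ)) - jet R m φ - D w‖ ≤
        M * ‖w‖ ^ 2 := fun w hw => by
    have hL : ‖phase w‖ ≤ ‖w‖ := norm_phase_le w
    have hr := hM (fun ξ => Complex.exp (phase w ξ) - 1 - phase w ξ)
      (((contDiff_exp_phase w).sub contDiff_const).sub (phase w).contDiff) (‖w‖ ^ 2)
      (by positivity) fun j _ ξ => by
        refine (norm_iteratedFDeriv_exp_clm_sub_le (phase w)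
          (hL.trans (hw.trans (min_le_left _ _))) j ξ).trans ?_
        gcongr
        exact hL.trans (hw.trans (min_le_right _ _))
    have hsum : (fun ξ => g ξ * Complex.exp (phase (z + w) ξ)) =
        (φ + fun ξ => φ ξ * phase w ξ) +
          fun ξ => φ ξ * (Complex.exp (phase w ξ) - 1 - phase w ξ) := by
      funext ξ
      simp only [hφd, phase_add, add_apply, Complex.exp_add, Pi.add_apply]
      ring
    have hD : D w = jet R m fun ξ => φ ξ * phase w ξ := rfl
    rw [hsum, jet_add (Submodule.add_mem _ hφm (hphase w)) hr.1, jet_add hφm (hphase w), hD,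
      add_sub_right_comm, add_sub_cancel_left, add_sub_cancel_left]
    exact hr.2
  refine HasFDerivAt.differentiableAt (f' := D) ?_
  rw [hasFDerivAt_iff_isLittleO_nhds_zero]
  refine Asymptotics.IsBigO.trans_isLittleO (g := fun w => ‖w‖ ^ 2) ?_
    (Asymptotics.isLittleO_norm_pow_id one_lt_two)
  refine Asymptotics.IsBigO.of_bound M ?_
  have hnhds : Metric.closedBall (0 : EuclideanSpace ℂ (Fin n)) (min 1 δ) ∈ 𝓝 0 :=
    Metric.closedBall_mem_nhds _ (lt_min one_pos hδ)
  filter_upwards [hnhds] with w hw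
  rw [norm_pow, norm_norm]
  exact hrem w (mem_closedBall_zero_iff.1 hw)

/-! ### Truncation -/

/-- The complements of the dilated cut-off functions are uniformly bounded multipliers, supported
far from the origin. -/
theorem IsCutoff.exists_bound {η : EuclideanSpace ℝ (Fin n) → ℂ} (hη : IsCutoff η) (m : ℕ) :
    ∃ H ρ : ℝ, 0 ≤ H ∧ 0 < ρ ∧ ∀ (k : ℕ) (φ : EuclideanSpace ℝ (Fin n) → ℂ), ContDiff ℝ ∞ φ →
      ∀ (ξ : EuclideanSpace ℝ (Fin n)) (a : ℝ), (∀ j ≤ m, ‖iteratedFDeriv ℝ j φ ξ‖ ≤ a) →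
      ∀ j ≤ m, ‖iteratedFDeriv ℝ j (fun ξ => (1 - η (((k : ℝ) + 1)⁻¹ • ξ)) * φ ξ) ξ‖ ≤ H * a ∧
        (‖ξ‖ < ρ * (k + 1) →
          iteratedFDeriv ℝ j (fun ξ => (1 - η (((k : ℝ) + 1)⁻¹ • ξ)) * φ ξ) ξ = 0) := by
  have h1η : ContDiff ℝ ∞ fun ξ => 1 - η ξ := contDiff_const.sub hη.1
  have hbd : HasBoundedDerivs fun ξ => 1 - η ξ := by
    refine ⟨h1η, fun j => ?_⟩
    have hc : Continuous (iteratedFDeriv ℝ j η) := hη.1.continuous_iteratedFDeriv (mod_cast le_top)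
    obtain ⟨A, hA⟩ := hc.bounded_above_of_compact_support (hη.2.1.iteratedFDeriv j)
    refine ⟨‖iteratedFDeriv ℝ j (fun _ : EuclideanSpace ℝ (Fin n) => (1 : ℂ)) 0‖ + A,
      fun ξ => ?_⟩
    have hm : ((j : ℕ∞) : WithTop ℕ∞) ≤ ∞ := mod_cast le_top
    have hsub : iteratedFDeriv ℝ j (fun ξ => 1 - η ξ) ξ =
        iteratedFDeriv ℝ j (fun _ => (1 : ℂ)) ξ - iteratedFDeriv ℝ j η ξ :=
      iteratedFDeriv_sub_apply (f := fun _ => (1 : ℂ)) contDiffAt_const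
        (hη.1.of_le hm).contDiffAt
    rw [hsub]
    refine (norm_sub_le _ _).trans (add_le_add (le_of_eq ?_) (hA ξ))
    rcases Nat.eq_zero_or_pos j with rfl | hj
    · simp
    · rw [iteratedFDeriv_const_of_ne hj.ne']
      rfl
  obtain ⟨G, hG0, hG⟩ := hbd.exists_bound m
  obtain ⟨ρ, hρ, hρη⟩ := Metric.eventually_nhds_iff.1 hη.2.2
  refine ⟨2 ^ m * G, ρ, by positivity, hρ, fun k φ hφ ξ a ha j hj => ⟨?_, fun hξ => ?_⟩⟩
  · have ha0 : 0 ≤ a := (norm_nonneg _).trans (ha 0 (Nat.zero_le _))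
    have hk : ((k : ℝ) + 1)⁻¹ ≤ 1 := inv_le_one_of_one_le₀ (by linarith [k.cast_nonneg (α := ℝ)])
    have hk0 : 0 ≤ ((k : ℝ) + 1)⁻¹ := by positivity
    have hs : ContDiff ℝ ∞ fun ξ : EuclideanSpace ℝ (Fin n) => 1 - η (((k : ℝ) + 1)⁻¹ • ξ) :=
      h1η.comp (contDiff_const_smul _)
    refine (norm_iteratedFDeriv_mul_le_of_le hs hφ (A := G) (fun i hi => ?_)
      (fun i hi => ha i (hi.trans hj))).trans ?_
    · have hi' : ((i : ℕ∞) : WithTop ℕ∞) ≤ ∞ := mod_cast le_top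
      -- Dilating by `(k + 1)⁻¹ ≤ 1` only shrinks derivatives, so the bound is uniform in `k`.
      have h2 := congrFun (iteratedFDeriv_comp_const_smul (((k : ℝ) + 1)⁻¹)
        (h1η.of_le hi')) ξ
      rw [h2, norm_smul, norm_pow, Real.norm_of_nonneg hk0]
      calc _ ≤ 1 * G := by
            gcongr
            · exact pow_le_one₀ hk0 hk
            · exact hG i (hi.trans hj) _
        _ = G := one_mul G
    · calc _ ≤ (2 : ℝ) ^ m * (G * a) := by gcongr; norm_num
        _ = _ := by ring
  · have hev : (fun ξ => (1 - η (((k : ℝ) + 1)⁻¹ • ξ)) * φ ξ) =ᶠ[𝓝 ξ] fun _ => 0 := by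
      have hk : (0 : ℝ) < k + 1 := by positivity
      filter_upwards [(isOpen_lt continuous_norm continuous_const).mem_nhds hξ] with ζ hζ
      have : η (((k : ℝ) + 1)⁻¹ • ζ) = 1 := by
        refine hρη ?_
        rw [dist_zero_right, norm_smul, norm_inv, Real.norm_of_nonneg hk.le,
          inv_mul_lt_iff₀ hk, mul_comm]
        exact hζ
      rw [this, sub_self, zero_mul]
    rw [(hev.iteratedFDeriv ℝ j).eq_of_nhds]
    exact congrFun iteratedFDeriv_fun_zero ξ

end LocalizedExp

/-! ### The Fourier-Laplace pairing of a functional supported by the dual cone -/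

section FourierLaplace

variable {n : ℕ}

theorem exists_isCutoff (n : ℕ) : ∃ η : EuclideanSpace ℝ (Fin n) → ℂ, IsCutoff η := by
  let ρ : ContDiffBump (0 : EuclideanSpace ℝ (Fin n)) := ⟨1, 2, by norm_num, by norm_num⟩
  refine ⟨fun ξ => (ρ ξ : ℂ), Complex.ofRealCLM.contDiff.comp ρ.contDiff, ?_, ?_⟩
  · exact ρ.hasCompactSupport.comp_left (g := fun x : ℝ => (x : ℂ)) Complex.ofReal_zero
  · filter_upwards [ρ.eventuallyEq_one] with ξ hξ
    rw [hξ]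
    simp

theorem IsCutoff.contDiff_dilate {η : EuclideanSpace ℝ (Fin n) → ℂ} (hη : IsCutoff η) (k : ℕ) :
    ContDiff ℝ ∞ fun ξ => η (((k : ℝ) + 1)⁻¹ • ξ) :=
  hη.1.comp (contDiff_const_smul _)

theorem IsCutoff.hasCompactSupport_dilate {η : EuclideanSpace ℝ (Fin n) → ℂ} (hη : IsCutoff η)
    (k : ℕ) : HasCompactSupport fun ξ => η (((k : ℝ) + 1)⁻¹ • ξ) :=
  hη.2.1.comp_smul (by positivity)

theorem mul_mem_bumpSpace {g φ : EuclideanSpace ℝ (Fin n) → ℂ} (hg : ContDiff ℝ ∞ g)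
    (hφ : φ ∈ bumpSpace n) : (fun ξ => g ξ * φ ξ) ∈ bumpSpace n :=
  ⟨hg.mul hφ.1, hφ.2.mul_left⟩

theorem tendsto_exp_neg_mul_nat {δ : ℝ} (hδ : 0 < δ) (B : ℝ) :
    Tendsto (fun k : ℕ => B * Real.exp (-(δ * (k + 1)))) atTop (𝓝 0) := by
  have h1 : Tendsto (fun k : ℕ => δ * ((k : ℝ) + 1)) atTop atTop :=
    (tendsto_atTop_add_const_right _ 1 tendsto_natCast_atTop_atTop).const_mul_atTop hδ
  simpa using (Real.tendsto_exp_neg_atTop_nhds_zero.comp h1).const_mul B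

/-- The error `(1 - η(ξ/(k+1))) φ` lives where `‖ξ‖ ≥ ρ(k+1)`, and there the surplus decay makes it
`O(exp (-(R' - R)ρ(k+1)))`. -/
theorem tendsto_jet_cutoff {φ : EuclideanSpace ℝ (Fin n) → ℂ} (hφ : ContDiff ℝ ∞ φ)
    {R R' B : ℝ} {m : ℕ} (hR : R < R') (hB0 : 0 ≤ B)
    (hB : ∀ j ≤ m, ∀ ξ, ‖iteratedFDeriv ℝ j φ ξ‖ ≤ B * Real.exp (-(R' * ‖ξ‖)))
    {η : EuclideanSpace ℝ (Fin n) → ℂ} (hη : IsCutoff η) :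
    Tendsto (fun k : ℕ => jet R m fun ξ => η (((k : ℝ) + 1)⁻¹ • ξ) * φ ξ) atTop
      (𝓝 (jet R m φ)) := by
  obtain ⟨H, ρ, hH0, hρ, hHk⟩ := hη.exists_bound m
  have hφm : φ ∈ weightedSpace n R m := mem_weightedSpace_of_bound hφ hR.le hB0 hB
  have hδ : 0 < R' - R := sub_pos.2 hR
  rw [tendsto_iff_norm_sub_tendsto_zero]
  refine squeeze_zero (fun _ => norm_nonneg _) (fun k => ?_)
    (tendsto_exp_neg_mul_nat (mul_pos hδ hρ) (H * B))
  have hs : ContDiff ℝ ∞ fun ξ => (1 - η (((k : ℝ) + 1)⁻¹ • ξ)) * φ ξ :=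
    (contDiff_const.sub (hη.contDiff_dilate k)).mul hφ
  have key : ∀ j ≤ m, ∀ ξ, Real.exp (R * ‖ξ‖) *
      ‖iteratedFDeriv ℝ j (fun ξ => (1 - η (((k : ℝ) + 1)⁻¹ • ξ)) * φ ξ) ξ‖ ≤
        H * B * Real.exp (-((R' - R) * ρ * (k + 1))) := fun j hj ξ => by
    obtain ⟨h1, h2⟩ := hHk k φ hφ ξ _ (fun j hj => hB j hj ξ) j hj
    by_cases hξ : ‖ξ‖ < ρ * (k + 1)
    · rw [h2 hξ, norm_zero, mul_zero]
      positivity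
    · rw [← mul_assoc] at h1
      refine (exp_mul_le_of_le h1).trans ?_
      rw [mul_assoc (R' - R)]
      have := not_lt.1 hξ
      gcongr
  have hmem : (fun ξ => (1 - η (((k : ℝ) + 1)⁻¹ • ξ)) * φ ξ) ∈ weightedSpace n R m :=
    ⟨hs, _, key⟩
  have heq : (fun ξ => η (((k : ℝ) + 1)⁻¹ • ξ) * φ ξ) =
      φ - fun ξ => (1 - η (((k : ℝ) + 1)⁻¹ • ξ)) * φ ξ := by
    funext ξ
    simp only [Pi.sub_apply]
    ring
  rw [heq, jet_sub hφm hmem, sub_sub_cancel_left, norm_neg]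
  exact norm_jet_le hs (by positivity) key

/-- A functional with support in `S` only depends on the values of a test function near `S`. -/
theorem apply_mul_eq_of_eq_one {O S : Set (EuclideanSpace ℝ (Fin n))} {V : testSpace O →ₗ[ℂ] ℂ}
    (hV : V ∈ expDualSupp O S) {χ : EuclideanSpace ℝ (Fin n) → ℂ} (hχ : ContDiff ℝ ∞ χ) {ε : ℝ}
    (hε : 0 < ε) (h1 : ∀ ξ ∈ Metric.thickening ε S, χ ξ = 1)
    {φ : EuclideanSpace ℝ (Fin n) → ℂ} (hφ : φ ∈ bumpSpace n) :
    V ⟨fun ξ => χ ξ * φ ξ, bumpSpace_le_testSpace O (mul_mem_bumpSpace hχ hφ)⟩ =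
      V ⟨φ, bumpSpace_le_testSpace O hφ⟩ := by
  rw [eq_comm, ← sub_eq_zero, ← map_sub]
  have heq : (φ - fun ξ => χ ξ * φ ξ) = fun ξ => (1 - χ ξ) * φ ξ := by
    funext ξ
    simp only [Pi.sub_apply]
    ring
  have hc : (φ - fun ξ => χ ξ * φ ξ) ∈ bumpSpace n :=
    Submodule.sub_mem _ hφ (mul_mem_bumpSpace hχ hφ)
  refine hV.2 _ hc.2 ?_
  change Disjoint (tsupport (φ - fun ξ => χ ξ * φ ξ)) S
  have hsub : tsupport (φ - fun ξ => χ ξ * φ ξ) ⊆ (Metric.thickening ε S)ᶜ := by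
    refine closure_minimal (fun ξ hξ hξS => hξ ?_) Metric.isOpen_thickening.isClosed_compl
    rw [heq]
    simp [h1 ξ hξS]
  exact (disjoint_compl_left_iff_subset.2 (Metric.self_subset_thickening hε S)).mono_left hsub

theorem cutExp_eq (η : EuclideanSpace ℝ (Fin n) → ℂ) (z : EuclideanSpace ℂ (Fin n)) (k : ℕ) :
    cutExp η z k = fun ξ => η (((k : ℝ) + 1)⁻¹ • ξ) * Complex.exp (phase z ξ) := by
  funext ξ
  rw [cutExp, phase_apply]

theorem cutExp_mem_bumpSpace {η : EuclideanSpace ℝ (Fin n) → ℂ} (hη : IsCutoff η)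
    (z : EuclideanSpace ℂ (Fin n)) (k : ℕ) : cutExp η z k ∈ bumpSpace n := by
  rw [cutExp_eq]
  exact ⟨(hη.contDiff_dilate k).mul (contDiff_exp_phase z),
    (hη.hasCompactSupport_dilate k).mul_right⟩

/-- The pairing with the exponential, expressed by a continuous functional of jets. -/
theorem hasInvFourierLaplace_jet {O S : Set (EuclideanSpace ℝ (Fin n))}
    {V : testSpace O →ₗ[ℂ] ℂ} (hV : V ∈ expDualSupp O S) {R R' : ℝ} {m : ℕ}
    {Λ : JetSpace n m →L[ℂ] ℂ}
    (hΛ : ∀ φ (h : φ ∈ bumpSpace n), V ⟨φ, bumpSpace_le_testSpace O h⟩ = Λ (jet R m φ))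
    {χ : EuclideanSpace ℝ (Fin n) → ℂ} (hχ : HasBoundedDerivs χ) {ε : ℝ}
    (hε : 0 < ε) (h1 : ∀ ξ ∈ Metric.thickening ε S, χ ξ = 1) (hR : R < R')
    {z : EuclideanSpace ℂ (Fin n)} (hz : DecaysOn χ R' (imPart z)) :
    HasInvFourierLaplace V z ((((2 * Real.pi : ℝ) : ℂ) ^ n)⁻¹ *
      Λ (jet R m fun ξ => χ ξ * Complex.exp (phase z ξ))) := by
  intro η hη
  obtain ⟨B, hB0, hB⟩ := hz.exists_bound hχ m
  have h2 := (Λ.continuous.tendsto _).comp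
    (tendsto_jet_cutoff (contDiff_mul_exp_phase hχ.1 z) hR hB0 hB hη)
  refine (h2.congr fun k => ?_).const_mul _
  have hc := cutExp_mem_bumpSpace hη z k
  -- On a truncated exponential, inserting `χ` does not change `V`, but it gives the limit the decay
  -- needed to have a weighted jet.
  have h3 := apply_mul_eq_of_eq_one hV hχ.1 hε h1 hc
  rw [hΛ _ (mul_mem_bumpSpace hχ.1 hc)] at h3
  refine Eq.trans ?_ h3
  rw [Function.comp_apply]
  congr 2
  funext ξ
  rw [cutExp_eq]
  ring

/-- The defining condition ranges over all cut-offs, so the existence of one is what gives it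
content. Uniqueness also serves to compare formulas obtained from different `χ`. -/
theorem HasInvFourierLaplace.unique {O : Set (EuclideanSpace ℝ (Fin n))}
    {V : testSpace O →ₗ[ℂ] ℂ} {z : EuclideanSpace ℂ (Fin n)} {w w' : ℂ}
    (h : HasInvFourierLaplace V z w) (h' : HasInvFourierLaplace V z w') : w = w' := by
  obtain ⟨η, hη⟩ := exists_isCutoff n
  exact tendsto_nhds_unique (h η hη) (h' η hη)

/-- Decay of the exponential near the dual cone. -/
theorem exp_neg_inner_le_of_mem_thickening {S : Set (EuclideanSpace ℝ (Fin n))} {c ε : ℝ}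
    {y ξ : EuclideanSpace ℝ (Fin n)} (hc0 : 0 ≤ c) (hc1 : c ≤ 1)
    (hy : ∀ ξ ∈ S, c * ‖y‖ * ‖ξ‖ ≤ inner ℝ ξ y) (hξ : ξ ∈ Metric.thickening ε S) :
    Real.exp (-inner ℝ ξ y) ≤ Real.exp (2 * ε * ‖y‖) * Real.exp (-(c * ‖y‖ * ‖ξ‖)) := by
  obtain ⟨ζ, hζ, hd⟩ := Metric.mem_thickening_iff.1 hξ
  rw [← Real.exp_add, Real.exp_le_exp]
  rw [dist_eq_norm] at hd
  have h1 := hy ζ hζ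
  have h2 : inner ℝ ξ y = inner ℝ ζ y + inner ℝ (ξ - ζ) y := by
    rw [inner_sub_left]
    ring
  have h3 := neg_le_of_abs_le (abs_real_inner_le_norm (ξ - ζ) y)
  have hy0 : 0 ≤ ‖y‖ := norm_nonneg y
  have h4 : ‖ξ - ζ‖ * ‖y‖ ≤ ε * ‖y‖ := by gcongr
  have h5 : ‖ξ‖ ≤ ‖ζ‖ + ε := by
    have := norm_add_le ζ (ξ - ζ)
    rw [add_sub_cancel] at this
    linarith
  have h6 : c * ‖y‖ * ‖ξ‖ ≤ c * ‖y‖ * (‖ζ‖ + ε) := by gcongr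
  -- Replacing `ξ` by a point of `S` at distance less than `ε` costs `ε‖y‖` in the pairing and at
  -- most another `ε‖y‖`, as `c ≤ 1`, in the norm term: hence `2ε‖y‖`.
  have h7 : c * ‖y‖ * ε ≤ 1 * ‖y‖ * ε := by
    have : 0 ≤ ε := (norm_nonneg _).trans hd.le
    gcongr
  linarith

/-- In a truncated tube over a subcone, the exponential weight in the growth condition is `1`. -/
theorem exp_indicatorFn_eq_one {C C' : Set (EuclideanSpace ℝ (Fin n))} (hC : IsOpenCone C)
    (h : IsSubcone C C') {y : EuclideanSpace ℝ (Fin n)} (hy : y ∈ C') (h0 : y ≠ 0) :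
    EReal.exp (indicatorFn (dualCone C) y) = 1 := by
  rw [indicatorFn_dualCone (h.mem hC hy h0), EReal.exp_zero]

theorem mem_truncTube {C' : Set (EuclideanSpace ℝ (Fin n))} {r : ℝ}
    {z : EuclideanSpace ℂ (Fin n)} :
    z ∈ truncTube C' r ↔ imPart z ∈ C' ∧ r < ‖imPart z‖ := by
  simp only [truncTube, mem_ofPred_eq, Set.mem_sdiff, mem_inter_iff, mem_closedBall_zero_iff, not_and,
    not_le]
  exact ⟨fun h => ⟨h.1, h.2 h.1⟩, fun h => ⟨h.1, fun _ => h.2⟩⟩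

/-- The inverse Fourier-Laplace transform of a functional supported by the dual cone. -/
theorem exists_holGrowth_of_expDualSupp {C O : Set (EuclideanSpace ℝ (Fin n))}
    (hC : IsOpenCone C) {V : testSpace O →ₗ[ℂ] ℂ} (hV : V ∈ expDualSupp O (dualCone C)) :
    ∃ r : Set (EuclideanSpace ℝ (Fin n)) → ℝ, (∀ C', 0 < r C') ∧
      ∃ f : EuclideanSpace ℂ (Fin n) → ℂ, HolGrowth C r f ∧
        ∀ C', IsSubcone C C' → ∀ z ∈ truncTube C' (r C'),
          ∀ w : ℂ, HasInvFourierLaplace V z w ↔ w = f z := by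
  obtain ⟨R₀, m, hext⟩ := exists_jet_extension hV.1
  obtain ⟨R, hRR, hR0⟩ : ∃ R, R₀ ≤ R ∧ 0 ≤ R := ⟨max R₀ 0, le_max_left _ _, le_max_right _ _⟩
  obtain ⟨Λ, hΛ⟩ := hext R hRR m le_rfl
  obtain ⟨χ, hχs, hχb, hχ1, hχ0⟩ := exists_smooth_indicator (dualCone C)
  have hχ : HasBoundedDerivs χ := ⟨hχs, hχb⟩
  choose c hc0 hc1 hc using fun (C' : Set (EuclideanSpace ℝ (Fin n))) (h : IsSubcone C C') =>
    h.exists_le_inner hC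
  classical
  -- Beyond this radius `c‖y‖ > R + 1`, so the exponential beats the weight of the jets; since `c ≤
  -- 1` also `‖y‖ > 1`.
  let r : Set (EuclideanSpace ℝ (Fin n)) → ℝ := fun C' =>
    if h : IsSubcone C C' then (R + 1) / c C' h else 1
  let f : EuclideanSpace ℂ (Fin n) → ℂ := fun z => (((2 * Real.pi : ℝ) : ℂ) ^ n)⁻¹ *
    Λ (jet R m fun ξ => χ ξ * Complex.exp (phase z ξ))
  have hr : ∀ C' (h : IsSubcone C C'), ∀ z ∈ truncTube C' (r C'),
      imPart z ∈ C' ∧ 1 < ‖imPart z‖ ∧ R < c C' h * ‖imPart z‖ := fun C' h z hz => by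
    obtain ⟨h1, h2⟩ := mem_truncTube.1 hz
    simp only [r, dif_pos h] at h2
    rw [div_lt_iff₀ (hc0 C' h), mul_comm] at h2
    refine ⟨h1, ?_, by linarith⟩
    have : c C' h * ‖imPart z‖ ≤ 1 * ‖imPart z‖ := by
      gcongr
      exact hc1 C' h
    linarith
  have hf : ∀ C' (h : IsSubcone C C'), ∀ z ∈ truncTube C' (r C'),
      DecaysOn χ (c C' h * ‖imPart z‖) (imPart z) := fun C' h z hz =>
    ⟨_, fun ξ hξ => exp_neg_inner_le_of_mem_thickening (hc0 C' h).le (hc1 C' h)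
      (hc C' h _ (hr C' h z hz).1) (hχ0 ξ hξ)⟩
  have hfV : ∀ C' (_ : IsSubcone C C'), ∀ z ∈ truncTube C' (r C'),
      HasInvFourierLaplace V z (f z) := fun C' h z hz =>
    hasInvFourierLaplace_jet hV hΛ hχ (by norm_num) hχ1 (hr C' h z hz).2.2 (hf C' h z hz)
  obtain ⟨G, hG0, hG⟩ := hχ.exists_bound m
  -- The exponent `2m` does not depend on `C'`: one `m` comes from differentiating the exponential,
  -- the other from differentiating the dilated cut-off below.
  refine ⟨r, fun C' => ?_, f, ⟨(2 * m : ℕ), by positivity, fun C' h => ⟨fun z hz => ?_,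
    ‖(((2 * Real.pi : ℝ) : ℂ) ^ n)⁻¹‖ * (‖Λ‖ * (2 ^ m * (G * Real.exp 2))), by positivity,
    fun z hz => ?_⟩⟩, fun C' h z hz w => ⟨fun hw => hw.unique (hfV C' h z hz), ?_⟩⟩
  · by_cases h : IsSubcone C C'
    · simp only [r, dif_pos h]
      have := hc0 C' h
      positivity
    · simp only [r, dif_neg h, zero_lt_one]
  · have h1 := differentiableAt_jet_mul_exp_phase hχ (hr C' h z hz).2.2 (hf C' h z hz) m
    exact ((Λ.differentiableAt.comp z h1).const_mul _).differentiableWithinAt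
  · obtain ⟨hy, hy1, hyR⟩ := hr C' h z hz
    set t := ‖imPart z‖ with ht
    have ht0 : 0 < t := one_pos.trans hy1
    have htz : t ≤ 1 + ‖z‖ := (norm_imPart_le z).trans (by linarith)
    have hz0 : 0 ≤ ‖z‖ := norm_nonneg z
    rw [exp_indicatorFn_eq_one hC h hy (norm_pos_iff.1 ht0), mul_one, ← ofReal_norm,
      Real.rpow_natCast]
    refine ENNReal.ofReal_le_ofReal ?_
    -- With the fixed `χ` the bound would contain `exp (2‖y‖)`. Dilating by `t = ‖y‖` narrows the
    -- neighbourhood of the cone `C*` to width `1/t`, which leaves the constant `exp 2` at the price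
    -- of `t ^ j` in the derivatives.
    let χt : EuclideanSpace ℝ (Fin n) → ℂ := fun ξ => χ (t • ξ)
    have hχts : ContDiff ℝ ∞ χt := hχs.comp (contDiff_const_smul t)
    have hχtd : ∀ j ξ, ‖iteratedFDeriv ℝ j χt ξ‖ = t ^ j * ‖iteratedFDeriv ℝ j χ (t • ξ)‖ :=
      fun j ξ => by
        have hj : ((j : ℕ∞) : WithTop ℕ∞) ≤ ∞ := mod_cast le_top
        rw [congrFun (iteratedFDeriv_comp_const_smul t (hχs.of_le hj)) ξ, norm_smul, norm_pow,
          Real.norm_of_nonneg ht0.le]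
    have hχt : HasBoundedDerivs χt := ⟨hχts, fun j => by
      obtain ⟨A, hA⟩ := hχb j
      refine ⟨t ^ j * A, fun ξ => ?_⟩
      rw [hχtd]
      gcongr
      exact hA _⟩
    have hscale : ∀ ξ s, s ∈ dualCone C → ‖ξ - t⁻¹ • s‖ = t⁻¹ * ‖t • ξ - s‖ := fun ξ s _ => by
      rw [← Real.norm_of_nonneg (inv_nonneg.2 ht0.le), ← norm_smul, smul_sub, smul_smul,
        Real.norm_of_nonneg (inv_nonneg.2 ht0.le), inv_mul_cancel₀ ht0.ne', one_smul]
    have hχt1 : ∀ ξ ∈ Metric.thickening (t⁻¹ * (1 / 4)) (dualCone C), χt ξ = 1 := fun ξ hξ => by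
      obtain ⟨s, hs, hd⟩ := Metric.mem_thickening_iff.1 hξ
      refine hχ1 _ (Metric.mem_thickening_iff.2 ⟨t • s, smul_mem_dualCone hs ht0.le, ?_⟩)
      have h3 := hscale ξ (t • s) (smul_mem_dualCone hs ht0.le)
      rw [smul_smul, inv_mul_cancel₀ ht0.ne', one_smul] at h3
      rw [dist_eq_norm, h3] at hd
      rw [dist_eq_norm]
      exact lt_of_mul_lt_mul_left hd (inv_nonneg.2 ht0.le)
    have hχt0 : ∀ ξ, χt ξ ≠ 0 → ξ ∈ Metric.thickening t⁻¹ (dualCone C) := fun ξ hξ => by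
      obtain ⟨s, hs, hd⟩ := Metric.mem_thickening_iff.1 (hχ0 _ hξ)
      refine Metric.mem_thickening_iff.2
        ⟨t⁻¹ • s, smul_mem_dualCone hs (inv_nonneg.2 ht0.le), ?_⟩
      rw [dist_eq_norm] at hd
      rw [dist_eq_norm, hscale ξ s hs]
      exact mul_lt_of_lt_one_right (inv_pos.2 ht0) hd
    have hdec : ∀ ξ, χt ξ ≠ 0 → Real.exp (-inner ℝ ξ (imPart z)) ≤
        Real.exp 2 * Real.exp (-(c C' h * t * ‖ξ‖)) := fun ξ hξ => by
      have h3 := exp_neg_inner_le_of_mem_thickening (hc0 C' h).le (hc1 C' h) (hc C' h _ hy)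
        (hχt0 ξ hξ)
      rwa [mul_assoc 2, ← ht, inv_mul_cancel₀ ht0.ne', mul_one] at h3
    -- Both cut-offs give the same limit, so `f z` may be estimated with the dilated one.
    have hft := (hfV C' h z hz).unique
      (hasInvFourierLaplace_jet hV hΛ hχt (by positivity) hχt1 hyR ⟨_, hdec⟩)
    rw [hft, norm_mul, mul_assoc]
    gcongr
    refine (Λ.le_opNorm _).trans ?_
    rw [mul_assoc]
    gcongr
    have hbound := fun j (hj : j ≤ m) ξ => norm_iteratedFDeriv_mul_exp_phase_le hχts
      (G := G * (1 + ‖z‖) ^ m) (Real.exp_pos 2).le (fun j hj ξ => by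
        rw [hχtd, mul_comm]
        refine mul_le_mul (hG j hj _) ?_ (by positivity) hG0
        exact (pow_le_pow_left₀ ht0.le htz j).trans
          (pow_le_pow_right₀ (by linarith) hj)) hdec hj ξ
    refine norm_jet_le (contDiff_mul_exp_phase hχts z) (by positivity) fun j hj ξ => ?_
    refine (exp_mul_le_of_le (hbound j hj ξ)).trans ?_
    calc _ ≤ 2 ^ m * (G * (1 + ‖z‖) ^ m * ((1 + ‖z‖) ^ m * Real.exp 2)) * 1 := by
          gcongr
          refine Real.exp_le_one_iff.2 (neg_nonpos.2 (mul_nonneg ?_ (norm_nonneg ξ)))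
          linarith
      _ = _ := by ring
  · rintro rfl
    exact hfV C' h z hz

end FourierLaplace

/-! ### Points of tubes -/

section Tube

variable {n : ℕ}

/-- The point `x + iy` of `ℂⁿ`. -/
def tubePt (x y : EuclideanSpace ℝ (Fin n)) : EuclideanSpace ℂ (Fin n) :=
  WithLp.toLp 2 fun j => (x j : ℂ) + y j * Complex.I

/-- The real part of a point of `ℂⁿ`. -/
def rePart (z : EuclideanSpace ℂ (Fin n)) : EuclideanSpace ℝ (Fin n) :=
  WithLp.toLp 2 fun j => (z j).re

theorem tubePt_apply (x y : EuclideanSpace ℝ (Fin n)) (j : Fin n) :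
    tubePt x y j = (x j : ℂ) + y j * Complex.I := rfl

theorem imPart_tubePt (x y : EuclideanSpace ℝ (Fin n)) : imPart (tubePt x y) = y := by
  ext j
  simp [imPart, tubePt]

theorem tubePt_rePart_imPart (z : EuclideanSpace ℂ (Fin n)) : tubePt (rePart z) (imPart z) = z := by
  ext j
  simp [imPart, rePart, tubePt, Complex.re_add_im]

theorem continuous_tubePt (y : EuclideanSpace ℝ (Fin n)) : Continuous fun x => tubePt x y := by
  refine (PiLp.continuous_toLp 2 _).comp (continuous_pi fun j => ?_)
  fun_prop

theorem tubePt_add (x x' y y' : EuclideanSpace ℝ (Fin n)) :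
    tubePt (x + x') (y + y') = tubePt x y + tubePt x' y' := by
  ext j
  simp only [tubePt_apply, PiLp.add_apply, Complex.ofReal_add]
  ring

theorem norm_tubePt_le (x y : EuclideanSpace ℝ (Fin n)) : ‖tubePt x y‖ ≤ ‖x‖ + ‖y‖ := by
  have h1 : tubePt x y = tubePt x 0 + tubePt 0 y := by rw [← tubePt_add, add_zero, zero_add]
  have h2 : ‖tubePt x 0‖ = ‖x‖ := by
    rw [EuclideanSpace.norm_eq, EuclideanSpace.norm_eq]
    simp [tubePt]
  have h3 : ‖tubePt 0 y‖ = ‖y‖ := by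
    rw [EuclideanSpace.norm_eq, EuclideanSpace.norm_eq]
    simp [tubePt]
  rw [h1, ← h2, ← h3]
  exact norm_add_le _ _

theorem phase_tubePt (x y ξ : EuclideanSpace ℝ (Fin n)) :
    phase (tubePt x y) ξ = Complex.I * (inner ℝ ξ x : ℝ) - (inner ℝ ξ y : ℝ) := by
  rw [phase_apply, pairing, PiLp.inner_apply, PiLp.inner_apply, Complex.ofReal_sum,
    Complex.ofReal_sum, Finset.mul_sum, Finset.mul_sum, ← Finset.sum_sub_distrib]
  refine Finset.sum_congr rfl fun j _ => ?_
  simp only [tubePt_apply, RCLike.inner_apply, conj_trivial, Complex.ofReal_mul]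
  linear_combination (ξ j * y j : ℂ) * Complex.I_sq

end Tube

/-! ### Fourier transforms of exponentially twisted test functions -/

section Twist

open MeasureTheory

variable {n : ℕ}

/-- The function `φ(ξ) exp ⟨ξ, y⟩`. -/
def twist (y : EuclideanSpace ℝ (Fin n)) (φ : EuclideanSpace ℝ (Fin n) → ℂ) :
    EuclideanSpace ℝ (Fin n) → ℂ :=
  fun ξ => φ ξ * Complex.exp (phase (tubePt 0 (-y)) ξ)

theorem twist_apply (y : EuclideanSpace ℝ (Fin n)) (φ : EuclideanSpace ℝ (Fin n) → ℂ)
    (ξ : EuclideanSpace ℝ (Fin n)) : twist y φ ξ = φ ξ * Complex.exp (inner ℝ ξ y : ℝ) := by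
  rw [twist, phase_tubePt]
  simp

/-- `φ(ξ) exp ⟨ξ, y⟩` is smooth and decays exponentially, with its derivatives. -/
def TwistDecay (δ : ℝ) (y : EuclideanSpace ℝ (Fin n)) (φ : EuclideanSpace ℝ (Fin n) → ℂ) : Prop :=
  ContDiff ℝ ∞ φ ∧ ∀ m : ℕ, ∃ B : ℝ, 0 ≤ B ∧ ∀ j ≤ m, ∀ ξ,
    ‖iteratedFDeriv ℝ j φ ξ‖ * Real.exp (inner ℝ ξ y) ≤ B * Real.exp (-(δ * ‖ξ‖))

/-- The estimate is pointwise in `ξ`, so that `b` may carry the decay. -/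
theorem norm_iteratedFDeriv_twist_le {y : EuclideanSpace ℝ (Fin n)}
    {φ : EuclideanSpace ℝ (Fin n) → ℂ} (hφ : ContDiff ℝ ∞ φ) {m : ℕ}
    {ξ : EuclideanSpace ℝ (Fin n)} {b : ℝ}
    (hB : ∀ j ≤ m, ‖iteratedFDeriv ℝ j φ ξ‖ * Real.exp (inner ℝ ξ y) ≤ b) :
    ‖iteratedFDeriv ℝ m (twist y φ) ξ‖ ≤ 2 ^ m * ((1 + ‖y‖) ^ m * b) := by
  have he : 0 < Real.exp (inner ℝ ξ y) := Real.exp_pos _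
  have hy0 : 0 ≤ ‖y‖ := norm_nonneg y
  refine (norm_iteratedFDeriv_mul_le_of_le hφ (contDiff_exp_phase _)
    (A := b * (Real.exp (inner ℝ ξ y))⁻¹) (B := (1 + ‖y‖) ^ m * Real.exp (inner ℝ ξ y))
    (fun i hi => ?_) fun i hi => ?_).trans (le_of_eq ?_)
  · rw [← div_eq_mul_inv, le_div_iff₀ he]
    exact hB i hi
  · refine (norm_iteratedFDeriv_exp_phase_le _ i ξ).trans ?_
    rw [imPart_tubePt, inner_neg_right, neg_neg]
    gcongr
    have h1 : ‖tubePt 0 (-y)‖ ≤ 1 + ‖y‖ := by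
      refine (norm_tubePt_le _ _).trans ?_
      rw [norm_zero, norm_neg]
      linarith
    exact (pow_le_pow_left₀ (norm_nonneg _) h1 i).trans (pow_le_pow_right₀ (by linarith) hi)
  · field_simp

theorem contDiff_twist {φ : EuclideanSpace ℝ (Fin n) → ℂ} (hφ : ContDiff ℝ ∞ φ)
    (y : EuclideanSpace ℝ (Fin n)) : ContDiff ℝ ∞ (twist y φ) := contDiff_mul_exp_phase hφ _

/-- The constant is independent of `y` and `φ`, and only a power of `1 + ‖y‖` appears. This
uniformity is essential when `y` is sent to infinity. -/
theorem exists_pow_mul_twist_le (k l : ℕ) {δ : ℝ} (hδ : 0 < δ) :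
    ∃ C : ℝ, 0 ≤ C ∧ ∀ (y : EuclideanSpace ℝ (Fin n)) (φ : EuclideanSpace ℝ (Fin n) → ℂ) (B : ℝ),
      0 ≤ B → ContDiff ℝ ∞ φ →
      (∀ j ≤ l, ∀ ξ, ‖iteratedFDeriv ℝ j φ ξ‖ * Real.exp (inner ℝ ξ y) ≤
        B * Real.exp (-(δ * ‖ξ‖))) →
      ∀ ξ, ‖ξ‖ ^ k * ‖iteratedFDeriv ℝ l (twist y φ) ξ‖ ≤ C * ((1 + ‖y‖) ^ l * B) := by
  obtain ⟨M, hM0, hM⟩ := exists_pow_mul_exp_le k hδ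
  refine ⟨2 ^ l * M, by positivity, fun y φ B hB0 hφ hB ξ => ?_⟩
  have h1 := norm_iteratedFDeriv_twist_le hφ (fun j hj => hB j hj ξ)
  calc _ ≤ (1 + ‖ξ‖) ^ k * (2 ^ l * ((1 + ‖y‖) ^ l * (B * Real.exp (-(δ * ‖ξ‖))))) := by
        gcongr
        linarith
    _ = 2 ^ l * ((1 + ‖ξ‖) ^ k * Real.exp (-(δ * ‖ξ‖))) * ((1 + ‖y‖) ^ l * B) := by ring
    _ ≤ _ := by
        gcongr
        exact hM _ (norm_nonneg ξ)

/-- The twisted function as a Schwartz function. -/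
def twistSchwartz {δ : ℝ} (hδ : 0 < δ) {y : EuclideanSpace ℝ (Fin n)}
    {φ : EuclideanSpace ℝ (Fin n) → ℂ} (h : TwistDecay δ y φ) : 𝓢(EuclideanSpace ℝ (Fin n), ℂ) where
  toFun := twist y φ
  smooth' := contDiff_twist h.1 y
  decay' k l := by
    obtain ⟨C, -, hC⟩ := exists_pow_mul_twist_le (n := n) k l hδ
    obtain ⟨B, hB0, hB⟩ := h.2 l
    exact ⟨_, hC y φ B hB0 h.1 hB⟩

theorem coe_twistSchwartz {δ : ℝ} (hδ : 0 < δ) {y : EuclideanSpace ℝ (Fin n)}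
    {φ : EuclideanSpace ℝ (Fin n) → ℂ} (h : TwistDecay δ y φ) :
    (twistSchwartz hδ h : EuclideanSpace ℝ (Fin n) → ℂ) = twist y φ := rfl

/-- Decay of Fourier transforms of Schwartz functions, in terms of seminorms. -/
theorem exists_pow_mul_fourier_le (n L : ℕ) : ∃ (s : Finset (ℕ × ℕ)) (C : ℝ), 0 ≤ C ∧
    ∀ (g : 𝓢(EuclideanSpace ℝ (Fin n), ℂ)) (u : EuclideanSpace ℝ (Fin n)),
      (1 + ‖u‖) ^ L * ‖𝓕 (g : EuclideanSpace ℝ (Fin n) → ℂ) u‖ ≤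
        C * s.sup (schwartzSeminormFamily ℂ (EuclideanSpace ℝ (Fin n)) ℂ) g := by
  let q : Seminorm ℂ 𝓢(EuclideanSpace ℝ (Fin n), ℂ) :=
    ((Finset.Iic (L, 0)).sup (schwartzSeminormFamily ℂ (EuclideanSpace ℝ (Fin n)) ℂ)).comp
      (SchwartzMap.fourierTransformCLM ℂ).toLinearMap
  have hq : Continuous q := by
    have h1 : Continuous (((Finset.Iic (L, 0)).sup
        (schwartzSeminormFamily ℂ (EuclideanSpace ℝ (Fin n)) ℂ) :
          Seminorm ℂ 𝓢(EuclideanSpace ℝ (Fin n), ℂ)) : 𝓢(EuclideanSpace ℝ (Fin n), ℂ) → ℝ) :=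
      Seminorm.continuous_finsetSup fun i _ =>
        (schwartz_withSeminorms ℂ (EuclideanSpace ℝ (Fin n)) ℂ).continuous_seminorm i
    exact h1.comp (SchwartzMap.fourierTransformCLM ℂ).continuous
  -- The Fourier transform is continuous on Schwartz space, so the pulled back seminorm is dominated
  -- by finitely many of the standard ones.
  obtain ⟨s, C, -, hC⟩ := Seminorm.bound_of_continuous
    (schwartz_withSeminorms ℂ (EuclideanSpace ℝ (Fin n)) ℂ) q hq
  refine ⟨s, 2 ^ L * C, by positivity, fun g u => ?_⟩
  have h1 := SchwartzMap.one_add_le_sup_seminorm_apply (𝕜 := ℂ) (m := (L, 0)) (k := L) (n := 0)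
    le_rfl le_rfl (𝓕 g) u
  rw [norm_iteratedFDeriv_zero, SchwartzMap.fourier_coe] at h1
  refine h1.trans ?_
  rw [mul_assoc]
  refine mul_le_mul_of_nonneg_left ?_ (by positivity)
  exact hC g

/-- Finitely many Schwartz seminorms control the decay of the transform; `l` is the highest
derivative among them, and each is bounded uniformly in `y` and `φ` by the preceding estimates. -/
theorem exists_fourier_twist_le (n L : ℕ) {δ : ℝ} (hδ : 0 < δ) :
    ∃ (l : ℕ) (C : ℝ), 0 ≤ C ∧
      ∀ (y : EuclideanSpace ℝ (Fin n)) (φ : EuclideanSpace ℝ (Fin n) → ℂ), TwistDecay δ y φ →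
      ∀ B : ℝ, 0 ≤ B → (∀ j ≤ l, ∀ ξ, ‖iteratedFDeriv ℝ j φ ξ‖ * Real.exp (inner ℝ ξ y) ≤
        B * Real.exp (-(δ * ‖ξ‖))) →
      ∀ u, (1 + ‖u‖) ^ L * ‖𝓕 (twist y φ) u‖ ≤ C * ((1 + ‖y‖) ^ l * B) := by
  obtain ⟨s, C, hC0, hC⟩ := exists_pow_mul_fourier_le n L
  choose M hM0 hM using fun k l => exists_pow_mul_twist_le (n := n) k l hδ
  let l := s.sup Prod.snd
  refine ⟨l, C * ∑ i ∈ s, M i.1 i.2, mul_nonneg hC0 (Finset.sum_nonneg fun _ _ => hM0 _ _),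
    fun y φ hφ B hB0 hB u => ?_⟩
  have hy0 : 0 ≤ ‖y‖ := norm_nonneg y
  refine (hC (twistSchwartz hδ hφ) u).trans ?_
  rw [mul_assoc]
  refine mul_le_mul_of_nonneg_left ?_ hC0
  refine Seminorm.finset_sup_apply_le
    (mul_nonneg (Finset.sum_nonneg fun _ _ => hM0 _ _) (by positivity)) fun i hi => ?_
  have hil : i.2 ≤ l := Finset.le_sup (f := Prod.snd) hi
  refine SchwartzMap.seminorm_le_bound ℂ _ _ _
    (mul_nonneg (Finset.sum_nonneg fun _ _ => hM0 _ _) (by positivity)) fun ξ => ?_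
  refine (hM i.1 i.2 y φ B hB0 hφ.1 (fun j hj => hB j (hj.trans hil)) ξ).trans ?_
  have h1 : M i.1 i.2 ≤ ∑ i ∈ s, M i.1 i.2 :=
    Finset.single_le_sum (f := fun i : ℕ × ℕ => M i.1 i.2) (fun _ _ => hM0 _ _) hi
  have h2 : (1 + ‖y‖) ^ i.2 ≤ (1 + ‖y‖) ^ l := pow_le_pow_right₀ (by linarith) hil
  have h3 : 0 ≤ ∑ i ∈ s, M i.1 i.2 := Finset.sum_nonneg fun _ _ => hM0 _ _
  gcongr

/-- Compact support affords any weight; `δ + ‖y‖` pays for both the twist and the required decay. -/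
theorem bumpSpace_twistDecay {φ : EuclideanSpace ℝ (Fin n) → ℂ} (hφ : φ ∈ bumpSpace n) (δ : ℝ)
    (y : EuclideanSpace ℝ (Fin n)) : TwistDecay δ y φ := by
  refine ⟨hφ.1, fun m => ?_⟩
  obtain ⟨-, B, hB⟩ := bumpSpace_le_weightedSpace (δ + ‖y‖) m hφ
  refine ⟨B, le_trans (by positivity) (hB 0 (Nat.zero_le _) 0), fun j hj ξ => ?_⟩
  have h1 : Real.exp (inner ℝ ξ y) ≤ Real.exp ((δ + ‖y‖) * ‖ξ‖) * Real.exp (-(δ * ‖ξ‖)) := by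
    rw [← Real.exp_add, Real.exp_le_exp]
    have := real_inner_le_norm ξ y
    linarith
  calc _ ≤ ‖iteratedFDeriv ℝ j φ ξ‖ *
        (Real.exp ((δ + ‖y‖) * ‖ξ‖) * Real.exp (-(δ * ‖ξ‖))) := by gcongr
    _ = Real.exp ((δ + ‖y‖) * ‖ξ‖) * ‖iteratedFDeriv ℝ j φ ξ‖ * Real.exp (-(δ * ‖ξ‖)) := by ring
    _ ≤ _ := by
        gcongr
        exact hB j hj ξ

/-- In the normalization with kernel `exp (-2πi⟨ξ, u⟩)`, the transform of the twist at `u` is the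
Fourier–Laplace transform of `φ` at `2πu + iy`. This is the source of the points `2πu + iy`
throughout. -/
theorem fourier_twist (y : EuclideanSpace ℝ (Fin n)) (φ : EuclideanSpace ℝ (Fin n) → ℂ)
    (u : EuclideanSpace ℝ (Fin n)) :
    𝓕 (twist y φ) u = ∫ ξ, φ ξ * Complex.exp (phase (-tubePt ((2 * Real.pi) • u) y) ξ) := by
  rw [Real.fourier_eq']
  refine integral_congr_ae (Eventually.of_forall fun ξ => ?_)
  have h1 : -tubePt ((2 * Real.pi) • u) y = (-1 : ℂ) • tubePt ((2 * Real.pi) • u) y := by simp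
  simp only [twist_apply, smul_eq_mul, h1, phase_smul, smul_apply, phase_tubePt]
  rw [mul_left_comm, ← Complex.exp_add, real_inner_smul_right]
  congr 2
  push_cast
  ring

/-- Fourier inversion for twisted functions. -/
theorem integral_fourier_twist {δ : ℝ} (hδ : 0 < δ) {y : EuclideanSpace ℝ (Fin n)}
    {φ : EuclideanSpace ℝ (Fin n) → ℂ} (h : TwistDecay δ y φ) (ξ : EuclideanSpace ℝ (Fin n)) :
    ∫ u, 𝓕 (twist y φ) u * Complex.exp (phase (tubePt ((2 * Real.pi) • u) y) ξ) = φ ξ := by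
  have h1 : 𝓕⁻ (𝓕 (twistSchwartz hδ h)) = twistSchwartz hδ h :=
    FourierTransform.fourierInv_fourier_eq _
  have h2 := congrArg (fun g : 𝓢(EuclideanSpace ℝ (Fin n), ℂ) => g ξ) h1
  simp only [SchwartzMap.fourierInv_coe, SchwartzMap.fourier_coe, coe_twistSchwartz] at h2
  rw [Real.fourierInv_eq', twist_apply] at h2
  have h3 : φ ξ = Complex.exp (-(inner ℝ ξ y : ℝ)) * (φ ξ * Complex.exp (inner ℝ ξ y : ℝ)) := by
    rw [mul_left_comm, ← Complex.exp_add, neg_add_cancel, Complex.exp_zero, mul_one]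
  rw [h3, ← h2, ← integral_const_mul]
  refine integral_congr_ae (Eventually.of_forall fun u => ?_)
  simp only [smul_eq_mul, phase_tubePt]
  rw [← mul_assoc, ← Complex.exp_add, mul_comm, real_inner_smul_right, real_inner_comm ξ u]
  congr 2
  push_cast
  ring

theorem continuous_fourier_twist {δ : ℝ} (hδ : 0 < δ) {y : EuclideanSpace ℝ (Fin n)}
    {φ : EuclideanSpace ℝ (Fin n) → ℂ} (h : TwistDecay δ y φ) : Continuous (𝓕 (twist y φ)) :=
  (𝓕 (twistSchwartz hδ h)).continuous

end Twist

/-! ### Uniqueness -/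

section Uniqueness

open MeasureTheory

theorem integral_linearIsometryEquiv_clm_comp {α A B E : Type*} [MeasurableSpace α]
    {μ : Measure α} [NormedAddCommGroup A] [NormedSpace ℝ A] [NormedAddCommGroup B]
    [NormedSpace ℝ B] [NormedAddCommGroup E] [NormedSpace ℝ E] (e : A ≃ₗᵢ[ℝ] (E →L[ℝ] B))
    (G : α → A) : ∫ a, e (G a) ∂μ = e (∫ a, G a ∂μ) :=
  e.toContinuousLinearEquiv.integral_comp_comm G

/-- Differentiation of arbitrary order under the integral sign. -/
theorem iteratedFDeriv_integral {α E : Type*} [MeasurableSpace α] {μ : Measure α}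
    [NormedAddCommGroup E] [NormedSpace ℝ E] {F : α → E → ℂ} (hF : ∀ a, ContDiff ℝ ∞ (F a))
    (hm : ∀ j ξ, AEStronglyMeasurable (fun a => iteratedFDeriv ℝ j (F a) ξ) μ) {b : ℕ → α → ℝ}
    (hb : ∀ j, Integrable (b j) μ) (hbd : ∀ j a ξ, ‖iteratedFDeriv ℝ j (F a) ξ‖ ≤ b j a)
    (j : ℕ) (ξ : E) :
    iteratedFDeriv ℝ j (fun ξ => ∫ a, F a ξ ∂μ) ξ = ∫ a, iteratedFDeriv ℝ j (F a) ξ ∂μ := by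
  have hint : ∀ j ξ, Integrable (fun a => iteratedFDeriv ℝ j (F a) ξ) μ := fun j ξ =>
    (hb j).mono' (hm j ξ) (Eventually.of_forall fun a => hbd j a ξ)
  have hfd : ∀ j ξ, HasFDerivAt (fun ξ => ∫ a, iteratedFDeriv ℝ j (F a) ξ ∂μ)
      (∫ a, iteratedFDeriv ℝ (j + 1) (F a) ξ ∂μ).curryLeft ξ := fun j ξ => by
    let e : ContinuousMultilinearMap ℝ (fun _ : Fin (j + 1) => E) ℂ ≃ₗᵢ[ℝ]
        (E →L[ℝ] ContinuousMultilinearMap ℝ (fun _ : Fin j => E) ℂ) :=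
      continuousMultilinearCurryLeftEquiv ℝ (fun _ : Fin (j + 1) => E) ℂ
    have h1 : HasFDerivAt (fun ξ => ∫ a, iteratedFDeriv ℝ j (F a) ξ ∂μ)
        (∫ a, e (iteratedFDeriv ℝ (j + 1) (F a) ξ) ∂μ) ξ := by
      refine hasFDerivAt_integral_of_dominated_of_fderiv_le (bound := b (j + 1))
        (F' := fun ξ a => e (iteratedFDeriv ℝ (j + 1) (F a) ξ)) univ_mem
        (Eventually.of_forall fun ξ => hm j ξ) (hint j ξ)
        (e.continuous.comp_aestronglyMeasurable (hm (j + 1) ξ))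
        (Eventually.of_forall fun a ξ _ => ?_) (hb (j + 1))
        (Eventually.of_forall fun a ξ _ => ?_)
      · exact (e.norm_map _).le.trans (hbd (j + 1) a ξ)
      · have hj : ((j : ℕ∞) : WithTop ℕ∞) < ∞ := by exact_mod_cast ENat.natCast_lt_top j
        exact ((hF a).differentiable_iteratedFDeriv hj ξ).hasFDerivAt
    have h2 : ∫ a, e (iteratedFDeriv ℝ (j + 1) (F a) ξ) ∂μ =
        e (∫ a, iteratedFDeriv ℝ (j + 1) (F a) ξ ∂μ) :=
      integral_linearIsometryEquiv_clm_comp e _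
    rw [h2] at h1
    exact h1
  -- The integrated derivatives form a Taylor series of the integral, and such a series is unique.
  have hT : HasFTaylorSeriesUpTo ∞ (fun ξ => ∫ a, F a ξ ∂μ)
      (fun ξ j => ∫ a, iteratedFDeriv ℝ j (F a) ξ ∂μ) := by
    refine ⟨fun ξ => ?_, fun j _ ξ => hfd j ξ, fun j _ => ?_⟩
    · have h1 := (continuousMultilinearCurryFin0 ℝ E ℂ).toContinuousLinearEquiv.integral_comp_comm
        (μ := μ) (fun a => iteratedFDeriv ℝ 0 (F a) ξ)
      refine Eq.trans h1.symm ?_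
      refine integral_congr_ae (Eventually.of_forall fun a => ?_)
      simp [iteratedFDeriv_zero_eq_comp]
    · exact continuous_iff_continuousAt.2 fun ξ => (hfd j ξ).continuousAt
  exact (hT.eq_iteratedFDeriv (mod_cast le_top) ξ).symm

variable {n : ℕ}

theorem integrable_one_add_norm_pow_neg (n : ℕ) :
    Integrable fun u : EuclideanSpace ℝ (Fin n) => (1 + ‖u‖) ^ (-((n + 1 : ℕ) : ℝ)) := by
  refine integrable_one_add_norm ?_
  simp

theorem le_mul_rpow_neg_of_pow_mul_le {a t B : ℝ} {k : ℕ} (ht : 0 ≤ t)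
    (h : (1 + t) ^ k * a ≤ B) : a ≤ B * (1 + t) ^ (-(k : ℝ)) := by
  rw [Real.rpow_neg (by positivity), Real.rpow_natCast, ← div_eq_mul_inv,
    le_div_iff₀ (by positivity), mul_comm]
  exact h

/-- Integrability of continuous functions with polynomial decay. -/
theorem integrable_of_pow_mul_le {E : Type*} [NormedAddCommGroup E] [NormedSpace ℝ E]
    {G : EuclideanSpace ℝ (Fin n) → E} (hG : AEStronglyMeasurable G) {B : ℝ}
    (h : ∀ u, (1 + ‖u‖) ^ (n + 1) * ‖G u‖ ≤ B) : Integrable G :=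
  ((integrable_one_add_norm_pow_neg n).const_mul B).mono' hG
    (Eventually.of_forall fun u => le_mul_rpow_neg_of_pow_mul_le (norm_nonneg u) (h u))

theorem TwistDecay.fourier_le {δ : ℝ} (hδ : 0 < δ) {y : EuclideanSpace ℝ (Fin n)}
    {φ : EuclideanSpace ℝ (Fin n) → ℂ} (h : TwistDecay δ y φ) (L : ℕ) :
    ∃ B : ℝ, 0 ≤ B ∧ ∀ u, (1 + ‖u‖) ^ L * ‖𝓕 (twist y φ) u‖ ≤ B := by
  obtain ⟨l, C, hC0, hC⟩ := exists_fourier_twist_le n L hδ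
  obtain ⟨B, hB0, hB⟩ := h.2 l
  exact ⟨_, by positivity, hC y φ h B hB0 hB⟩

theorem one_add_norm_tubePt_le (u y : EuclideanSpace ℝ (Fin n)) :
    1 + ‖tubePt ((2 * Real.pi) • u) y‖ ≤ (1 + 2 * Real.pi + ‖y‖) * (1 + ‖u‖) := by
  have h1 := norm_tubePt_le ((2 * Real.pi) • u) y
  rw [norm_smul, Real.norm_of_nonneg (by positivity)] at h1
  nlinarith [norm_nonneg u, norm_nonneg y, Real.pi_pos,
    mul_nonneg (norm_nonneg y) (norm_nonneg u)]

/-- The jet of a localized Fourier integral is the Bochner integral of the jets. -/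
theorem jet_mul_eq_integral {χ : EuclideanSpace ℝ (Fin n) → ℂ} (hχ : HasBoundedDerivs χ)
    {R R' : ℝ} (hR' : 0 ≤ R') (hR : R < R') {y : EuclideanSpace ℝ (Fin n)}
    (hy : DecaysOn χ R' y) (m : ℕ) {φ : EuclideanSpace ℝ (Fin n) → ℂ} (hφ : φ ∈ bumpSpace n) :
    Integrable (fun u => 𝓕 (twist y φ) u •
        jet R m fun ξ => χ ξ * Complex.exp (phase (tubePt ((2 * Real.pi) • u) y) ξ)) ∧
      jet R m (fun ξ => χ ξ * φ ξ) = ∫ u, 𝓕 (twist y φ) u •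
        jet R m fun ξ => χ ξ * Complex.exp (phase (tubePt ((2 * Real.pi) • u) y) ξ) := by
  have htw : TwistDecay 1 y φ := bumpSpace_twistDecay hφ 1 y
  let z : EuclideanSpace ℝ (Fin n) → EuclideanSpace ℂ (Fin n) := fun u =>
    tubePt ((2 * Real.pi) • u) y
  have hzc : Continuous z := (continuous_tubePt y).comp (continuous_const_smul _)
  have hz : ∀ u, DecaysOn χ R' (imPart (z u)) := fun u => by
    rw [imPart_tubePt]
    exact hy
  have hfc : Continuous (𝓕 (twist y φ)) := continuous_fourier_twist one_pos htw
  have hjc : ∀ m, Continuous fun u => jet R m fun ξ => χ ξ * Complex.exp (phase (z u) ξ) :=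
    fun m => continuous_iff_continuousAt.2 fun u =>
      (differentiableAt_jet_mul_exp_phase hχ hR (hz u) m).continuousAt.comp hzc.continuousAt
  obtain ⟨A, hA⟩ := hy
  have hA0 : ∀ ξ, χ ξ ≠ 0 → Real.exp (-inner ℝ ξ y) ≤ |A| * Real.exp (-(R' * ‖ξ‖)) :=
    fun ξ hξ => (hA ξ hξ).trans (mul_le_mul_of_nonneg_right (le_abs_self A) (Real.exp_pos _).le)
  choose G hG0 hG using hχ.exists_bound
  let c : ℕ → ℝ := fun m => 2 ^ m * (G m * |A|)
  have hbd : ∀ m j, j ≤ m → ∀ u ξ,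
      ‖iteratedFDeriv ℝ j (fun ξ => χ ξ * Complex.exp (phase (z u) ξ)) ξ‖ ≤
        c m * (1 + ‖z u‖) ^ m * Real.exp (-(R' * ‖ξ‖)) := fun m j hj u ξ => by
    refine (norm_iteratedFDeriv_mul_exp_phase_le hχ.1 (abs_nonneg A) (hG m)
      (by rw [imPart_tubePt]; exact hA0) hj ξ).trans (le_of_eq ?_)
    simp only [c]
    ring
  have hc0 : ∀ m, 0 ≤ c m := fun m => mul_nonneg (by positivity)
    (mul_nonneg (hG0 m) (abs_nonneg A))
  -- Jets of order `m` grow like `(1 + ‖u‖)^m`, so decay of the transform of order `n + 1 + m`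
  -- suffices for integrability.
  have hbint : ∀ m, Integrable fun u => ‖𝓕 (twist y φ) u‖ * (c m * (1 + ‖z u‖) ^ m) := fun m => by
    obtain ⟨B, hB0, hB⟩ := htw.fourier_le one_pos (n + 1 + m)
    refine integrable_of_pow_mul_le (B := c m * (1 + 2 * Real.pi + ‖y‖) ^ m * B)
      (by fun_prop) fun u => ?_
    have h1 : (1 + ‖z u‖) ^ m ≤ (1 + 2 * Real.pi + ‖y‖) ^ m * (1 + ‖u‖) ^ m := by
      rw [← mul_pow]
      exact pow_le_pow_left₀ (by positivity) (one_add_norm_tubePt_le u y) m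
    have h2 := hc0 m
    rw [Real.norm_of_nonneg (by positivity)]
    calc (1 + ‖u‖) ^ (n + 1) * (‖𝓕 (twist y φ) u‖ * (c m * (1 + ‖z u‖) ^ m))
        ≤ (1 + ‖u‖) ^ (n + 1) * (‖𝓕 (twist y φ) u‖ *
          (c m * ((1 + 2 * Real.pi + ‖y‖) ^ m * (1 + ‖u‖) ^ m))) := by gcongr
      _ = c m * (1 + 2 * Real.pi + ‖y‖) ^ m *
          ((1 + ‖u‖) ^ (n + 1 + m) * ‖𝓕 (twist y φ) u‖) := by ring
      _ ≤ _ := by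
        gcongr
        exact hB u
  have hint : Integrable fun u => 𝓕 (twist y φ) u •
      jet R m fun ξ => χ ξ * Complex.exp (phase (z u) ξ) := by
    refine (hbint m).mono' (hfc.smul (hjc m)).aestronglyMeasurable
      (Eventually.of_forall fun u => ?_)
    rw [norm_smul]
    refine mul_le_mul_of_nonneg_left ?_ (norm_nonneg _)
    have h1 : 0 ≤ c m * (1 + ‖z u‖) ^ m := mul_nonneg (hc0 m) (by positivity)
    refine norm_jet_le (contDiff_mul_exp_phase hχ.1 _) h1 fun j hj ξ => ?_
    refine (exp_mul_le_of_le (hbd m j hj u ξ)).trans (mul_le_of_le_one_right h1 ?_)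
    exact Real.exp_le_one_iff.2 (neg_nonpos.2
      (mul_nonneg (sub_nonneg.2 hR.le) (norm_nonneg ξ)))
  refine ⟨hint, jetSpace_ext fun j ξ => ?_⟩
  have hF : ∀ u, ContDiff ℝ ∞ fun ξ => χ ξ * Complex.exp (phase (z u) ξ) := fun u =>
    contDiff_mul_exp_phase hχ.1 _
  have hFd : ∀ j u ξ, iteratedFDeriv ℝ j
      (fun ξ => 𝓕 (twist y φ) u • (χ ξ * Complex.exp (phase (z u) ξ))) ξ =
      𝓕 (twist y φ) u • iteratedFDeriv ℝ j (fun ξ => χ ξ * Complex.exp (phase (z u) ξ)) ξ :=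
    fun j u ξ => iteratedFDeriv_const_smul_apply'
      ((hF u).of_le (mod_cast le_top : ((j : ℕ∞) : WithTop ℕ∞) ≤ ∞)).contDiffAt
  have hmem : ∀ m u, (fun ξ => χ ξ * Complex.exp (phase (z u) ξ)) ∈ weightedSpace n R m :=
    fun m u => mul_exp_phase_mem hχ hR.le (hz u) m
  have hrep : (fun ξ => χ ξ * φ ξ) = fun ξ => ∫ u, 𝓕 (twist y φ) u •
      (χ ξ * Complex.exp (phase (z u) ξ)) := by
    funext ξ
    rw [← integral_fourier_twist one_pos htw ξ, ← integral_const_mul]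
    refine integral_congr_ae (Eventually.of_forall fun u => ?_)
    simp only [smul_eq_mul, z]
    ring
  -- Continuity in `u` of a derivative at a point is read off from the continuous jet of order `j`,
  -- after removing the weight.
  have hcont : ∀ j ξ, Continuous fun u =>
      iteratedFDeriv ℝ j (fun ξ => χ ξ * Complex.exp (phase (z u) ξ)) ξ := fun j ξ => by
    have h1 := ((jetEval ⟨j, Nat.lt_succ_self j⟩ ξ).continuous.comp (hjc j)).const_smul
      (Real.exp (R * ‖ξ‖))⁻¹
    refine h1.congr fun u => ?_
    change (Real.exp (R * ‖ξ‖))⁻¹ • jetEval ⟨j, Nat.lt_succ_self j⟩ ξ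
      (jet R j fun ξ => χ ξ * Complex.exp (phase (z u) ξ)) = _
    rw [jet_apply (hmem j u), smul_smul, inv_mul_cancel₀ (Real.exp_pos _).ne', one_smul]
  have hD := iteratedFDeriv_integral (μ := volume)
    (F := fun u ξ => 𝓕 (twist y φ) u • (χ ξ * Complex.exp (phase (z u) ξ)))
    (b := fun j u => ‖𝓕 (twist y φ) u‖ * (c j * (1 + ‖z u‖) ^ j)) (fun u => (hF u).const_smul _)
    (fun j ξ => ?_) hbint (fun j u ξ => ?_) j ξ
  · rw [jet_apply (bumpSpace_le_weightedSpace R m (mul_mem_bumpSpace hχ.1 hφ)), hrep, hD,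
      ← ContinuousLinearMap.integral_comp_comm _ hint, ← integral_smul]
    refine integral_congr_ae (Eventually.of_forall fun u => ?_)
    simp only [hFd, map_smul, jet_apply (hmem m u)]
    rw [smul_comm]
  · simp only [hFd]
    exact (hfc.smul (hcont j ξ)).aestronglyMeasurable
  · rw [hFd, norm_smul]
    gcongr
    refine (hbd j j le_rfl u ξ).trans (mul_le_of_le_one_right
      (mul_nonneg (hc0 j) (by positivity)) ?_)
    exact Real.exp_le_one_iff.2 (neg_nonpos.2 (mul_nonneg hR' (norm_nonneg ξ)))

/-- On smooth functions with compact support, a functional is determined by its inverse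
Fourier-Laplace transform on one horizontal plane. -/
theorem apply_eq_integral {O S : Set (EuclideanSpace ℝ (Fin n))}
    {V : testSpace O →ₗ[ℂ] ℂ} (hV : V ∈ expDualSupp O S) {R R' : ℝ} {m : ℕ}
    {Λ : JetSpace n m →L[ℂ] ℂ}
    (hΛ : ∀ φ (h : φ ∈ bumpSpace n), V ⟨φ, bumpSpace_le_testSpace O h⟩ = Λ (jet R m φ))
    {χ : EuclideanSpace ℝ (Fin n) → ℂ} (hχ : HasBoundedDerivs χ) {ε : ℝ}
    (hε : 0 < ε) (h1 : ∀ ξ ∈ Metric.thickening ε S, χ ξ = 1) (hR' : 0 ≤ R') (hR : R < R')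
    {y : EuclideanSpace ℝ (Fin n)} (hy : DecaysOn χ R' y)
    {f : EuclideanSpace ℂ (Fin n) → ℂ}
    (hf : ∀ x, HasInvFourierLaplace V (tubePt x y) (f (tubePt x y)))
    {φ : EuclideanSpace ℝ (Fin n) → ℂ} (hφ : φ ∈ bumpSpace n) :
    V ⟨φ, bumpSpace_le_testSpace O hφ⟩ = ((2 * Real.pi : ℝ) : ℂ) ^ n *
      ∫ u, 𝓕 (twist y φ) u * f (tubePt ((2 * Real.pi) • u) y) := by
  obtain ⟨hint, hjet⟩ := jet_mul_eq_integral hχ hR' hR hy m hφ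
  rw [← apply_mul_eq_of_eq_one hV hχ.1 hε h1 hφ, hΛ _ (mul_mem_bumpSpace hχ.1 hφ), hjet,
    ← ContinuousLinearMap.integral_comp_comm _ hint, ← integral_const_mul]
  refine integral_congr_ae (Eventually.of_forall fun u => ?_)
  have hy' : DecaysOn χ R' (imPart (tubePt ((2 * Real.pi) • u) y)) := by
    rw [imPart_tubePt]
    exact hy
  -- The value of `Λ` on the jet of each localized exponential is, up to the power of `2π`, the
  -- prescribed value of `f`.
  have h2 := (hf ((2 * Real.pi) • u)).unique (hasInvFourierLaplace_jet hV hΛ hχ hε h1 hR hy')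
  have hpi : ((2 * Real.pi : ℝ) : ℂ) ^ n ≠ 0 :=
    pow_ne_zero _ (Complex.ofReal_ne_zero.2 (by positivity))
  simp only [map_smul, smul_eq_mul, h2]
  field_simp

/-- Smooth functions with compact support are dense in `H(ℝⁿ; O)`. -/
theorem tendsto_apply_cutoff {O : Set (EuclideanSpace ℝ (Fin n))} (hO : IsOpen O)
    (hOne : O.Nonempty) {V : testSpace O →ₗ[ℂ] ℂ} (hV : V ∈ expDual O)
    {η : EuclideanSpace ℝ (Fin n) → ℂ} (hη : IsCutoff η) (φ : testSpace O)
    (hmem : ∀ k : ℕ, (fun ξ => η (((k : ℝ) + 1)⁻¹ • ξ) * (φ : EuclideanSpace ℝ (Fin n) → ℂ) ξ) ∈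
      bumpSpace n) :
    Tendsto (fun k : ℕ => V ⟨_, bumpSpace_le_testSpace O (hmem k)⟩) atTop (𝓝 (V φ)) := by
  obtain ⟨K, hKO, hKconv, hKc, m, M, hM0, hM⟩ := hV
  -- For empty `K` the function `hK K` is `0` and every thickening is empty, so `K` is first
  -- enlarged to a singleton.
  obtain ⟨K₁, hKK₁, hK₁ne, hK₁O, hK₁conv, hK₁⟩ : ∃ K₁, K ⊆ K₁ ∧ K₁.Nonempty ∧ K₁ ⊆ O ∧
      Convex ℝ K₁ ∧ IsCompact K₁ := by
    rcases K.eq_empty_or_nonempty with rfl | hne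
    · obtain ⟨x, hx⟩ := hOne
      exact ⟨{x}, empty_subset _, singleton_nonempty x, singleton_subset_iff.2 hx,
        convex_singleton x, isCompact_singleton⟩
    · exact ⟨K, Subset.rfl, hne, hKO, hKconv, hKc⟩
  obtain ⟨δ, hδ, hδO⟩ := hK₁.exists_cthickening_subset_open hO hK₁O
  have hK₂ : IsCompact (Metric.cthickening δ K₁) := hK₁.cthickening
  have hbdd : ∀ ξ, BddAbove (range fun x : Metric.cthickening δ K₁ =>
      |inner ℝ ξ (x : EuclideanSpace ℝ (Fin n))|) := fun ξ => by
    obtain ⟨r, hr⟩ := hK₂.isBounded.exists_norm_le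
    refine ⟨‖ξ‖ * r, ?_⟩
    rintro _ ⟨x, rfl⟩
    exact (abs_real_inner_le_norm _ _).trans
      (mul_le_mul_of_nonneg_left (hr _ x.2) (norm_nonneg _))
  have hkey : ∀ ξ, ∀ x ∈ K₁, |inner ℝ ξ x| + δ * ‖ξ‖ ≤ hK (Metric.cthickening δ K₁) ξ := by
    intro ξ x hx
    -- Moving `x` by `δ` in the direction `±ξ`, with the sign of `⟨ξ, x⟩`, raises `|⟨ξ, x⟩|` by
    -- `δ‖ξ‖`. Thus a slightly larger compact subset of `O` yields extra decay `exp (-δ‖ξ‖)` of `φ`,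
    -- which makes the truncation error tend to zero.
    obtain ⟨s, hs1, hs2⟩ : ∃ s : ℝ, |s| = 1 ∧ s * inner ℝ ξ x = |inner ℝ ξ x| := by
      rcases le_total 0 (inner ℝ ξ x) with h | h
      · exact ⟨1, abs_one, by rw [abs_of_nonneg h, one_mul]⟩
      · exact ⟨-1, by simp, by rw [abs_of_nonpos h]; ring⟩
    have hmem : x + (s * δ * ‖ξ‖⁻¹) • ξ ∈ Metric.cthickening δ K₁ := by
      refine Metric.mem_cthickening_of_dist_le _ x _ _ hx ?_
      rw [dist_eq_norm, add_sub_cancel_left, norm_smul, norm_mul, norm_mul, norm_inv, norm_norm,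
        Real.norm_eq_abs, hs1, one_mul, Real.norm_of_nonneg hδ.le, mul_assoc]
      exact mul_le_of_le_one_right hδ.le inv_mul_le_one
    refine le_trans ?_ (le_ciSup (hbdd ξ) ⟨_, hmem⟩)
    refine le_trans (le_of_eq ?_) ((le_abs_self _).trans
      (le_of_eq (a := |s * inner ℝ ξ (x + (s * δ * ‖ξ‖⁻¹) • ξ)|) ?_))
    · have hss : s * s = 1 := by rw [← abs_mul_abs_self s, hs1, one_mul]
      rw [inner_add_right, real_inner_smul_right, real_inner_self_eq_norm_sq, mul_add, hs2]
      rcases eq_or_ne ξ 0 with rfl | hξ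
      · simp
      · have : ‖ξ‖ ≠ 0 := norm_ne_zero_iff.2 hξ
        have h2 : s * (s * δ * ‖ξ‖⁻¹ * ‖ξ‖ ^ 2) = s * s * (δ * ‖ξ‖) := by
          field_simp
        rw [h2, hss, one_mul]
    · rw [abs_mul, hs1, one_mul]
  have hle : ∀ ξ, hK K ξ + δ * ‖ξ‖ ≤ hK (Metric.cthickening δ K₁) ξ := fun ξ => by
    rw [← le_sub_iff_add_le]
    have h0 : 0 ≤ hK (Metric.cthickening δ K₁) ξ - δ * ‖ξ‖ := by
      obtain ⟨x, hx⟩ := hK₁ne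
      have h1 := hkey ξ x hx
      have h2 := abs_nonneg (inner ℝ ξ x)
      linarith
    exact Real.iSup_le (fun x => le_sub_iff_add_le.2 (hkey ξ x (hKK₁ x.2))) h0
  choose B hB using φ.2.2 (Metric.cthickening δ K₁) hδO (hK₁conv.cthickening δ) hK₂
  obtain ⟨H, ρ, hH0, hρ, hHk⟩ := hη.exists_bound m
  let A : ℝ := ∑ j ∈ Finset.range (m + 1), |B j|
  have hA0 : 0 ≤ A := Finset.sum_nonneg fun _ _ => abs_nonneg _
  have hφb : ∀ j ≤ m, ∀ ξ, ‖iteratedFDeriv ℝ j (φ : EuclideanSpace ℝ (Fin n) → ℂ) ξ‖ ≤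
      A * Real.exp (-(hK K ξ + δ * ‖ξ‖)) := fun j hj ξ => by
    have h1 : Real.exp (hK K ξ + δ * ‖ξ‖) *
        ‖iteratedFDeriv ℝ j (φ : EuclideanSpace ℝ (Fin n) → ℂ) ξ‖ ≤ A := by
      refine le_trans ?_ ((hB j ξ).trans ((le_abs_self _).trans
        (Finset.single_le_sum (f := fun j => |B j|) (fun _ _ => abs_nonneg _)
          (Finset.mem_range.2 (Nat.lt_succ_iff.2 hj)))))
      exact mul_le_mul_of_nonneg_right (Real.exp_le_exp.2 (hle ξ)) (norm_nonneg _)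
    rwa [Real.exp_neg, ← div_eq_mul_inv, le_div_iff₀ (Real.exp_pos _), mul_comm]
  rw [tendsto_iff_norm_sub_tendsto_zero]
  refine squeeze_zero (fun _ => norm_nonneg _) (fun k => ?_)
    (tendsto_exp_neg_mul_nat (mul_pos hδ hρ) (M * (H * A)))
  rw [norm_sub_rev, ← map_sub, mul_assoc M]
  refine hM _ _ fun j hj ξ => ?_
  have heq : ((φ - ⟨_, bumpSpace_le_testSpace O (hmem k)⟩ : testSpace O) :
      EuclideanSpace ℝ (Fin n) → ℂ) = fun ξ => (1 - η (((k : ℝ) + 1)⁻¹ • ξ)) *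
        (φ : EuclideanSpace ℝ (Fin n) → ℂ) ξ := by
    funext ξ
    change (φ : EuclideanSpace ℝ (Fin n) → ℂ) ξ - η (((k : ℝ) + 1)⁻¹ • ξ) *
      (φ : EuclideanSpace ℝ (Fin n) → ℂ) ξ = _
    ring
  rw [heq]
  obtain ⟨h1, h2⟩ := hHk k φ φ.2.1 ξ _ (fun j hj => hφb j hj ξ) j hj
  by_cases hξ : ‖ξ‖ < ρ * (k + 1)
  · rw [h2 hξ, norm_zero, mul_zero]
    positivity
  · calc _ ≤ Real.exp (hK K ξ) * (H * (A * Real.exp (-(hK K ξ + δ * ‖ξ‖)))) := by gcongr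
      _ = H * A * (Real.exp (hK K ξ) * Real.exp (-(hK K ξ + δ * ‖ξ‖))) := by ring
      _ = H * A * Real.exp (-(δ * ‖ξ‖)) := by
        rw [← Real.exp_add]
        ring_nf
      _ ≤ _ := by
        rw [mul_assoc δ]
        have := not_lt.1 hξ
        gcongr

/-- Uniqueness of the functional with a given inverse Fourier-Laplace transform. -/
theorem eq_of_hasInvFourierLaplace (hn : 1 ≤ n) {C O : Set (EuclideanSpace ℝ (Fin n))}
    (hC : IsOpenCone C) (hCne : C.Nonempty) (hO : IsOpen O) (hOne : O.Nonempty)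
    {r : Set (EuclideanSpace ℝ (Fin n)) → ℝ} {f : EuclideanSpace ℂ (Fin n) → ℂ}
    {V W : testSpace O →ₗ[ℂ] ℂ} (hV : V ∈ expDualSupp O (dualCone C))
    (hW : W ∈ expDualSupp O (dualCone C))
    (hVf : ∀ C', IsSubcone C C' → ∀ z ∈ truncTube C' (r C'), HasInvFourierLaplace V z (f z))
    (hWf : ∀ C', IsSubcone C C' → ∀ z ∈ truncTube C' (r C'), HasInvFourierLaplace W z (f z)) :
    V = W := by
  obtain ⟨R₁, m₁, hV₁⟩ := exists_jet_extension hV.1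
  obtain ⟨R₂, m₂, hW₂⟩ := exists_jet_extension hW.1
  obtain ⟨R, hR0, hR₁, hR₂⟩ : ∃ R : ℝ, 0 ≤ R ∧ R₁ ≤ R ∧ R₂ ≤ R :=
    ⟨max 0 (max R₁ R₂), le_max_left _ _, (le_max_left _ _).trans (le_max_right _ _),
      (le_max_right _ _).trans (le_max_right _ _)⟩
  obtain ⟨Λ, hΛ⟩ := hV₁ R hR₁ (max m₁ m₂) (le_max_left _ _)
  obtain ⟨Λ', hΛ'⟩ := hW₂ R hR₂ (max m₁ m₂) (le_max_right _ _)
  obtain ⟨χ, hχs, hχb, hχ1, hχ0⟩ := exists_smooth_indicator (dualCone C)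
  have hχ : HasBoundedDerivs χ := ⟨hχs, hχb⟩
  -- In positive dimension `{0}` is not open, so `C` contains a nonzero vector; the plane is then
  -- taken through a large multiple of it, where both functionals have the same integral formula.
  obtain ⟨e, heC, he0⟩ : ∃ e ∈ C, e ≠ 0 := by
    have : Nonempty (Fin n) := ⟨⟨0, hn⟩⟩
    by_contra! hcon
    obtain ⟨x, hx⟩ := hCne
    have h1 : C = {0} := Subset.antisymm (fun e he => hcon e he) (by
      rw [singleton_subset_iff, ← hcon x hx]
      exact hx)
    exact not_isOpen_singleton (0 : EuclideanSpace ℝ (Fin n)) (h1 ▸ hC.1)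
  obtain ⟨C', hC', heC'⟩ := exists_isSubcone_of_isCompact hC isCompact_singleton
    (singleton_subset_iff.2 heC) (fun h => he0 (mem_singleton_iff.1 h).symm)
  obtain ⟨c, hc0, hc1, hc⟩ := hC'.exists_le_inner hC
  have hepos : 0 < ‖e‖ := norm_pos_iff.2 he0
  obtain ⟨t, ht0, htr, htR⟩ : ∃ t : ℝ, 0 < t ∧ r C' < t * ‖e‖ ∧ R < c * (t * ‖e‖) := by
    refine ⟨(|r C'| + (R + 1) / c) / ‖e‖, by positivity, ?_, ?_⟩
    · rw [div_mul_cancel₀ _ hepos.ne']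
      have h1 : 0 < (R + 1) / c := by positivity
      linarith [le_abs_self (r C')]
    · rw [div_mul_cancel₀ _ hepos.ne', mul_add, mul_div_cancel₀ _ hc0.ne']
      have := mul_nonneg hc0.le (abs_nonneg (r C'))
      linarith
  let y := t • e
  have hyn : ‖y‖ = t * ‖e‖ := by rw [norm_smul, Real.norm_of_nonneg ht0.le]
  have hyC' : y ∈ C' := hC'.1.2 e (heC' rfl) t ht0
  have hy : DecaysOn χ (c * ‖y‖) y := ⟨_, fun ξ hξ =>
    exp_neg_inner_le_of_mem_thickening hc0.le hc1 (hc y hyC') (hχ0 ξ hξ)⟩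
  have hz : ∀ x, tubePt x y ∈ truncTube C' (r C') := fun x => by
    rw [mem_truncTube, imPart_tubePt, hyn]
    exact ⟨hyC', htr⟩
  have hRy : R < c * ‖y‖ := by rwa [hyn]
  have hbump : ∀ φ (hφ : φ ∈ bumpSpace n),
      V ⟨φ, bumpSpace_le_testSpace O hφ⟩ = W ⟨φ, bumpSpace_le_testSpace O hφ⟩ := fun φ hφ => by
    rw [apply_eq_integral hV hΛ hχ (by norm_num) hχ1 (by positivity) hRy hy
      (fun x => hVf C' hC' _ (hz x)) hφ,
      apply_eq_integral hW hΛ' hχ (by norm_num) hχ1 (by positivity) hRy hy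
      (fun x => hWf C' hC' _ (hz x)) hφ]
  refine LinearMap.ext fun φ => ?_
  obtain ⟨η, hη⟩ := exists_isCutoff n
  have hmem : ∀ k : ℕ, (fun ξ => η (((k : ℝ) + 1)⁻¹ • ξ) *
      (φ : EuclideanSpace ℝ (Fin n) → ℂ) ξ) ∈ bumpSpace n := fun k =>
    ⟨(hη.contDiff_dilate k).mul φ.2.1, (hη.hasCompactSupport_dilate k).mul_right⟩
  have h1 := tendsto_apply_cutoff hO hOne hV.1 hη φ hmem
  have h2 := tendsto_apply_cutoff hO hOne hW.1 hη φ hmem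
  exact tendsto_nhds_unique (h1.congr fun k => hbump _ (hmem k)) h2

end Uniqueness

/-! ### Shift of the plane of integration -/

section Shift

open MeasureTheory

/-- Integrals of dominated families of holomorphic functions are holomorphic. -/
theorem differentiableAt_integral_of_dominated {α : Type*} [MeasurableSpace α] {μ : Measure α}
    {F : α → ℂ → ℂ} {c : ℂ} {ε : ℝ} (hε : 0 < ε)
    (hF : ∀ a, DifferentiableOn ℂ (F a) (Metric.ball c (2 * ε))) {b : α → ℝ}
    (hb : Integrable b μ) (hFb : ∀ a, ∀ ζ ∈ Metric.ball c (2 * ε), ‖F a ζ‖ ≤ b a)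
    (hm : ∀ ζ ∈ Metric.ball c (2 * ε), AEStronglyMeasurable (fun a => F a ζ) μ) :
    DifferentiableAt ℂ (fun ζ => ∫ a, F a ζ ∂μ) c := by
  have hsub : Metric.ball c ε ⊆ Metric.ball c (2 * ε) := Metric.ball_subset_ball (by linarith)
  have hc : c ∈ Metric.ball c (2 * ε) := Metric.mem_ball_self (by linarith)
  have hd : ∀ a, ∀ ζ ∈ Metric.ball c (2 * ε), HasDerivAt (F a) (deriv (F a) ζ) ζ :=
    fun a ζ hζ => ((hF a).differentiableAt (Metric.isOpen_ball.mem_nhds hζ)).hasDerivAt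
  -- The derivative is a limit of difference quotients along a sequence, hence measurable in the
  -- parameter.
  have hmeas : AEStronglyMeasurable (fun a => deriv (F a) c) μ := by
    let h : ℕ → ℂ := fun k => ((ε / (k + 1) : ℝ) : ℂ)
    have hh0 : Tendsto h atTop (𝓝 0) := by
      have h1 : Tendsto (fun k : ℕ => ε * (1 / ((k : ℝ) + 1))) atTop (𝓝 0) := by
        simpa using (tendsto_one_div_add_atTop_nhds_zero_nat (𝕜 := ℝ)).const_mul ε
      have h2 := (Complex.continuous_ofReal.tendsto 0).comp h1
      rw [Complex.ofReal_zero] at h2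
      refine h2.congr fun k => ?_
      simp only [h, Function.comp_apply, mul_one_div]
    have hhne : ∀ k, h k ≠ 0 := fun k => Complex.ofReal_ne_zero.2 (by positivity)
    have hhmem : ∀ k, c + h k ∈ Metric.ball c (2 * ε) := fun k => by
      rw [Metric.mem_ball, dist_eq_norm, add_sub_cancel_left, Complex.norm_real,
        Real.norm_of_nonneg (by positivity)]
      have : ε / ((k : ℝ) + 1) ≤ ε := div_le_self hε.le (by linarith [k.cast_nonneg (α := ℝ)])
      linarith
    refine aestronglyMeasurable_of_tendsto_ae atTop
      (f := fun k a => (h k)⁻¹ • (F a (c + h k) - F a c)) (fun k => ?_)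
      (Eventually.of_forall fun a => ?_)
    · exact AEStronglyMeasurable.const_smul ((hm _ (hhmem k)).sub (hm c hc)) (h k)⁻¹
    · exact (hd a c hc).tendsto_slope_zero.comp
        (tendsto_nhdsWithin_iff.2 ⟨hh0, Eventually.of_forall hhne⟩)
  refine (hasDerivAt_integral_of_dominated_loc_of_deriv_le (F' := fun ζ a => deriv (F a) ζ)
    (bound := fun a => b a / ε) (Metric.ball_mem_nhds c hε)
    (eventually_of_mem (Metric.ball_mem_nhds c hε) fun ζ hζ => hm ζ (hsub hζ))
    (hb.mono' (hm c hc) (Eventually.of_forall fun a => hFb a c hc)) hmeas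
    (Eventually.of_forall fun a ζ hζ => ?_) (hb.div_const ε)
    (Eventually.of_forall fun a ζ hζ => hd a ζ (hsub hζ))).2.differentiableAt
  -- Discs of radius `ε` around points of the smaller ball stay in the larger one, so Cauchy's
  -- estimate bounds the derivative by `b a / ε`.
  have hcl : Metric.closedBall ζ ε ⊆ Metric.ball c (2 * ε) := fun w hw => by
    rw [Metric.mem_ball] at hζ ⊢
    rw [Metric.mem_closedBall] at hw
    linarith [dist_triangle w ζ c]
  refine Complex.norm_deriv_le_of_forall_mem_sphere_norm_le hε ?_ fun w hw =>
    hFb a w (hcl (Metric.sphere_subset_closedBall hw))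
  refine DifferentiableOn.diffContOnCl ?_
  rw [closure_ball _ hε.ne']
  exact (hF a).mono hcl

variable {n : ℕ}

/-- The Fourier-Laplace transform of a function with compact support. -/
def laplace (φ : EuclideanSpace ℝ (Fin n) → ℂ) (z : EuclideanSpace ℂ (Fin n)) : ℂ :=
  ∫ ξ, φ ξ * Complex.exp (phase (-z) ξ)

theorem laplace_tubePt (φ : EuclideanSpace ℝ (Fin n) → ℂ) (u y : EuclideanSpace ℝ (Fin n)) :
    laplace φ (tubePt ((2 * Real.pi) • u) y) = 𝓕 (twist y φ) u := (fourier_twist y φ u).symm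

/-- The integrand is entire in `ζ` and, on the compact support of `φ`, bounded locally uniformly in
`ζ`. -/
theorem differentiable_laplace_line {φ : EuclideanSpace ℝ (Fin n) → ℂ} (hφ : φ ∈ bumpSpace n)
    (z w : EuclideanSpace ℂ (Fin n)) : Differentiable ℂ fun ζ : ℂ => laplace φ (z + ζ • w) := by
  intro c
  have hφc : Continuous φ := hφ.1.continuous
  let A : ℝ := ‖z‖ + (‖c‖ + 2) * ‖w‖
  refine differentiableAt_integral_of_dominated (ε := 1) one_pos
    (b := fun ξ => ‖φ ξ‖ * Real.exp (A * ‖ξ‖)) (fun ξ => ?_) ?_ (fun ξ ζ hζ => ?_) fun ζ _ => ?_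
  · have h1 : ∀ ζ : ℂ, phase (-(z + ζ • w)) ξ = -phase z ξ - ζ * phase w ξ := fun ζ => by
      have h2 : -(z + ζ • w) = (-1 : ℂ) • z + (-ζ) • w := by
        rw [neg_smul, neg_smul, one_smul, neg_add]
      rw [h2, phase_add, phase_smul, phase_smul, add_apply, smul_apply, smul_apply, smul_eq_mul,
        smul_eq_mul]
      ring
    simp only [h1]
    fun_prop
  · refine Continuous.integrable_of_hasCompactSupport (by fun_prop) ?_
    exact (hφ.2.norm).mul_right
  · rw [norm_mul]
    gcongr
    refine (norm_exp_clm_le _ _).trans (Real.exp_le_exp.2 ?_)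
    gcongr
    refine (norm_phase_le _).trans ?_
    rw [norm_neg]
    refine (norm_add_le _ _).trans ?_
    rw [norm_smul]
    have h1 : ‖ζ‖ ≤ ‖c‖ + 2 := by
      have h2 := norm_add_le c (ζ - c)
      rw [add_sub_cancel] at h2
      have h3 := mem_ball_iff_norm.1 hζ
      linarith
    simp only [A]
    gcongr
  · exact (hφc.mul (Complex.continuous_exp.comp (phase _).continuous)).aestronglyMeasurable

/-- The integral that defines the functional with a given inverse Fourier-Laplace transform. -/
def planeIntegral (f : EuclideanSpace ℂ (Fin n) → ℂ) (y : EuclideanSpace ℝ (Fin n))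
    (φ : EuclideanSpace ℝ (Fin n) → ℂ) : ℂ :=
  ∫ u, 𝓕 (twist y φ) u * f (tubePt ((2 * Real.pi) • u) y)

/-- The single weight `1 + |Y|` majorizes all twists with `‖y‖ ≤ Y`, which gives the uniform
domination needed for shifting the plane. -/
theorem bumpSpace_fourier_le {φ : EuclideanSpace ℝ (Fin n) → ℂ} (hφ : φ ∈ bumpSpace n) (Y : ℝ)
    (L : ℕ) : ∃ D : ℝ, 0 ≤ D ∧ ∀ y : EuclideanSpace ℝ (Fin n), ‖y‖ ≤ Y → ∀ u,
      (1 + ‖u‖) ^ L * ‖𝓕 (twist y φ) u‖ ≤ D := by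
  obtain ⟨l, C, hC0, hC⟩ := exists_fourier_twist_le n L one_pos
  obtain ⟨-, B, hB⟩ := bumpSpace_le_weightedSpace (1 + |Y|) l hφ
  have hB0 : 0 ≤ B := le_trans (by positivity) (hB 0 (Nat.zero_le _) 0)
  refine ⟨C * ((1 + |Y|) ^ l * B), by positivity, fun y hy u => ?_⟩
  refine (hC y φ (bumpSpace_twistDecay hφ 1 y) B hB0 (fun j hj ξ => ?_) u).trans ?_
  · have hY : ‖y‖ ≤ |Y| := hy.trans (le_abs_self Y)
    have h1 : Real.exp (inner ℝ ξ y) ≤ Real.exp ((1 + |Y|) * ‖ξ‖) * Real.exp (-(1 * ‖ξ‖)) := by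
      rw [← Real.exp_add, Real.exp_le_exp]
      have h2 := real_inner_le_norm ξ y
      have h3 := mul_le_mul_of_nonneg_left hY (norm_nonneg ξ)
      linarith
    calc _ ≤ ‖iteratedFDeriv ℝ j φ ξ‖ *
          (Real.exp ((1 + |Y|) * ‖ξ‖) * Real.exp (-(1 * ‖ξ‖))) := by gcongr
      _ = Real.exp ((1 + |Y|) * ‖ξ‖) * ‖iteratedFDeriv ℝ j φ ξ‖ * Real.exp (-(1 * ‖ξ‖)) := by ring
      _ ≤ _ := by
        gcongr
        exact hB j hj ξ
  · gcongr
    exact hy.trans (le_abs_self Y)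

/-- Cauchy's theorem: within a tube, the plane of integration can be shifted. -/
theorem planeIntegral_add_eq {C' : Set (EuclideanSpace ℝ (Fin n))} (hC' : IsOpen C') {ρ K : ℝ}
    {N : ℕ} {f : EuclideanSpace ℂ (Fin n) → ℂ} (hf : DifferentiableOn ℂ f (truncTube C' ρ))
    (hK0 : 0 ≤ K) (hfK : ∀ z ∈ truncTube C' ρ, ‖f z‖ ≤ K * (1 + ‖z‖) ^ N)
    {a v : EuclideanSpace ℝ (Fin n)}
    (hav : ∀ t ∈ Icc (0 : ℝ) 1, a + t • v ∈ C' ∧ ρ < ‖a + t • v‖)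
    {φ : EuclideanSpace ℝ (Fin n) → ℂ} (hφ : φ ∈ bumpSpace n) :
    planeIntegral f (a + v) φ = planeIntegral f a φ := by
  -- On this complex line the imaginary part of `ζ` moves the plane from `a` towards `a + v`,
  -- whereas its real part only translates `u` along `v`.
  let Z : EuclideanSpace ℝ (Fin n) → ℂ → EuclideanSpace ℂ (Fin n) := fun u ζ =>
    tubePt ((2 * Real.pi) • u) a + ζ • tubePt v 0
  let p : EuclideanSpace ℝ (Fin n) → ℂ → EuclideanSpace ℝ (Fin n) := fun u ζ =>
    u + (ζ.re * (2 * Real.pi)⁻¹) • v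
  have hZ : ∀ u ζ, Z u ζ = tubePt ((2 * Real.pi) • p u ζ) (a + ζ.im • v) := fun u ζ => by
    ext j
    have hpi : (Real.pi : ℂ) ≠ 0 := Complex.ofReal_ne_zero.2 Real.pi_ne_zero
    simp only [Z, p, PiLp.add_apply, PiLp.smul_apply, tubePt_apply, smul_eq_mul,
      Complex.ofReal_add, Complex.ofReal_mul, Complex.ofReal_inv, Complex.ofReal_ofNat,
      PiLp.zero_apply, Complex.ofReal_zero]
    nth_rewrite 1 [← Complex.re_add_im ζ]
    field_simp
    ring
  let U : Set ℂ := {ζ | a + ζ.im • v ∈ C' ∧ ρ < ‖a + ζ.im • v‖}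
  have hU : IsOpen U := by
    have h1 : Continuous fun ζ : ℂ => a + ζ.im • v := by fun_prop
    exact (hC'.preimage h1).inter (isOpen_lt continuous_const h1.norm)
  have hZU : ∀ u, ∀ ζ ∈ U, Z u ζ ∈ truncTube C' ρ := fun u ζ hζ => by
    rw [mem_truncTube, hZ, imPart_tubePt]
    exact hζ
  let F : EuclideanSpace ℝ (Fin n) → ℂ → ℂ := fun u ζ => laplace φ (Z u ζ) * f (Z u ζ)
  let H : ℂ → ℂ := fun ζ => ∫ u, F u ζ
  have hHplane : ∀ t : ℝ, H (t * Complex.I) = planeIntegral f (a + t • v) φ := fun t => by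
    refine integral_congr_ae (Eventually.of_forall fun u => ?_)
    have h1 : Z u (t * Complex.I) = tubePt ((2 * Real.pi) • u) (a + t • v) := by
      rw [hZ]
      simp [p]
    simp only [F, h1, laplace_tubePt]
  -- Translation invariance of Lebesgue measure.
  have hHshift : ∀ (ζ : ℂ) (s : ℝ), H (ζ + s) = H ζ := fun ζ s => by
    have h1 : ∀ u, F u (ζ + s) = F (u + (s * (2 * Real.pi)⁻¹) • v) ζ := fun u => by
      have h2 : Z u (ζ + s) = Z (u + (s * (2 * Real.pi)⁻¹) • v) ζ := by
        rw [hZ, hZ]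
        have h3 : p u (ζ + s) = p (u + (s * (2 * Real.pi)⁻¹) • v) ζ := by
          simp only [p, Complex.add_re, Complex.ofReal_re]
          module
        rw [h3]
        simp
      simp only [F, h2]
    simp only [H, h1]
    exact integral_add_right_eq_self (fun u => F u ζ) _
  have hHd : ∀ t ∈ Icc (0 : ℝ) 1, DifferentiableAt ℂ H (t * Complex.I) := fun t ht => by
    have htU : (t * Complex.I : ℂ) ∈ U := by
      have h1 := hav t ht
      simpa [U] using h1
    obtain ⟨ε₀, hε₀, hεU⟩ := Metric.isOpen_iff.1 hU _ htU
    let ε := min ε₀ 1 / 2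
    have hε : 0 < ε := by positivity
    have h2ε : 2 * ε = min ε₀ 1 := by simp only [ε]; ring
    have hball : Metric.ball (t * Complex.I : ℂ) (2 * ε) ⊆ U := by
      rw [h2ε]
      exact (Metric.ball_subset_ball (min_le_left _ _)).trans hεU
    have hζ1 : ∀ ζ ∈ Metric.ball (t * Complex.I : ℂ) (2 * ε), |ζ.re| ≤ 1 ∧ |ζ.im| ≤ 2 := by
      intro ζ hζ
      rw [h2ε] at hζ
      have h1 : ‖ζ - t * Complex.I‖ < 1 := lt_of_lt_of_le (mem_ball_iff_norm.1 hζ) (min_le_right _ _)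
      have h2 := Complex.abs_re_le_norm (ζ - t * Complex.I)
      have h3 := Complex.abs_im_le_norm (ζ - t * Complex.I)
      simp only [Complex.sub_re, Complex.sub_im, Complex.mul_re, Complex.mul_im, Complex.ofReal_re,
        Complex.ofReal_im, Complex.I_re, Complex.I_im, mul_zero, mul_one, sub_zero,
        add_zero] at h2 h3
      refine ⟨by linarith, ?_⟩
      have h4 := abs_sub_abs_le_abs_sub ζ.im t
      have h5 : |t| ≤ 1 := abs_le.2 ⟨by linarith [ht.1], ht.2⟩
      linarith
    let Y := ‖a‖ + 2 * ‖v‖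
    obtain ⟨D, hD0, hD⟩ := bumpSpace_fourier_le hφ Y (n + 1 + N)
    have hbound : ∀ u, ∀ ζ ∈ Metric.ball (t * Complex.I : ℂ) (2 * ε),
        ‖F u ζ‖ ≤ ((1 + ‖v‖) ^ (n + 1) * (K * (1 + 2 * Real.pi + Y) ^ N * D)) *
          (1 + ‖u‖) ^ (-((n + 1 : ℕ) : ℝ)) := fun u ζ hζ => by
      refine le_mul_rpow_neg_of_pow_mul_le (norm_nonneg u) ?_
      have hy : ‖a + ζ.im • v‖ ≤ Y := by
        refine (norm_add_le _ _).trans ?_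
        rw [norm_smul, Real.norm_eq_abs]
        simp only [Y]
        gcongr
        exact (hζ1 ζ hζ).2
      have hu : 1 + ‖u‖ ≤ (1 + ‖v‖) * (1 + ‖p u ζ‖) := by
        have h1 : ‖u‖ ≤ ‖p u ζ‖ + ‖v‖ := by
          have h2 : u = p u ζ - (ζ.re * (2 * Real.pi)⁻¹) • v := by simp [p]
          have h3 : |ζ.re * (2 * Real.pi)⁻¹| ≤ 1 := by
            rw [abs_mul, abs_of_pos (by positivity : 0 < (2 * Real.pi)⁻¹)]
            refine mul_le_one₀ (hζ1 ζ hζ).1 (by positivity) (inv_le_one_of_one_le₀ ?_)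
            linarith [Real.pi_gt_three]
          calc ‖u‖ = ‖p u ζ - (ζ.re * (2 * Real.pi)⁻¹) • v‖ := by rw [← h2]
            _ ≤ ‖p u ζ‖ + |ζ.re * (2 * Real.pi)⁻¹| * ‖v‖ := by
              rw [← Real.norm_eq_abs, ← norm_smul]
              exact norm_sub_le _ _
            _ ≤ ‖p u ζ‖ + 1 * ‖v‖ := by gcongr
            _ = _ := by rw [one_mul]
        nlinarith [norm_nonneg v, norm_nonneg (p u ζ)]
      have hfz : ‖f (Z u ζ)‖ ≤ K * ((1 + 2 * Real.pi + Y) ^ N * (1 + ‖p u ζ‖) ^ N) := by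
        refine (hfK _ (hZU u ζ (hball hζ))).trans ?_
        rw [← mul_pow]
        gcongr
        rw [hZ]
        refine (one_add_norm_tubePt_le _ _).trans ?_
        gcongr
      have hl := hD _ hy (p u ζ)
      rw [← laplace_tubePt, ← hZ] at hl
      simp only [F]
      rw [norm_mul]
      have hY0 : 0 ≤ Y := by positivity
      calc (1 + ‖u‖) ^ (n + 1) * (‖laplace φ (Z u ζ)‖ * ‖f (Z u ζ)‖)
          ≤ ((1 + ‖v‖) * (1 + ‖p u ζ‖)) ^ (n + 1) * (‖laplace φ (Z u ζ)‖ *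
            (K * ((1 + 2 * Real.pi + Y) ^ N * (1 + ‖p u ζ‖) ^ N))) := by gcongr
        _ = (1 + ‖v‖) ^ (n + 1) * (K * (1 + 2 * Real.pi + Y) ^ N *
            ((1 + ‖p u ζ‖) ^ (n + 1 + N) * ‖laplace φ (Z u ζ)‖)) := by
          rw [mul_pow, pow_add]
          ring
        _ ≤ _ := by gcongr
    refine differentiableAt_integral_of_dominated hε (fun u => ?_)
      ((integrable_one_add_norm_pow_neg n).const_mul _) hbound fun ζ hζ => ?_
    · refine (differentiable_laplace_line hφ _ _).differentiableOn.mul ?_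
      refine hf.comp (Differentiable.differentiableOn ?_) fun ζ hζ => hZU u ζ (hball hζ)
      exact (differentiable_id.smul_const _).const_add _
    · have hp : Continuous fun u => p u ζ := by fun_prop
      have h1 : Continuous fun u => laplace φ (Z u ζ) := by
        simp only [hZ, laplace_tubePt]
        exact (continuous_fourier_twist one_pos (bumpSpace_twistDecay hφ 1 _)).comp hp
      have h2 : Continuous fun u => f (Z u ζ) := by
        refine hf.continuousOn.comp_continuous ?_ fun u => hZU u ζ (hball hζ)
        simp only [hZ]
        exact (continuous_tubePt _).comp ((continuous_const_smul _).comp hp)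
      exact (h1.mul h2).aestronglyMeasurable
  -- A complex derivative can be computed along the real direction, where `H` is constant; so it
  -- vanishes on the whole segment.
  have hHd0 : ∀ t ∈ Icc (0 : ℝ) 1, HasDerivAt H 0 (t * Complex.I) := fun t ht => by
    have h1 := (hHd t ht).hasDerivAt
    have h2 : HasDerivAt (fun s : ℝ => H (t * Complex.I + s)) (deriv H (t * Complex.I)) 0 := by
      have h3 : HasDerivAt (fun s : ℝ => (t * Complex.I + s : ℂ)) 1 0 :=
        (Complex.ofRealCLM.hasDerivAt (x := 0)).const_add _
      have h4 : HasDerivAt H (deriv H (t * Complex.I)) (t * Complex.I + ((0 : ℝ) : ℂ)) := by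
        rw [Complex.ofReal_zero, add_zero]
        exact h1
      have h6 := h4.comp (0 : ℝ) h3
      rw [mul_one] at h6
      exact h6
    simp only [hHshift] at h2
    have h5 := h2.unique (hasDerivAt_const (0 : ℝ) (H (t * Complex.I)))
    rwa [h5] at h1
  have hg : ∀ t ∈ Icc (0 : ℝ) 1, HasDerivAt (fun t : ℝ => H (t * Complex.I)) 0 t := fun t ht => by
    have h3 : HasDerivAt (fun s : ℝ => (s * Complex.I : ℂ)) (1 * Complex.I) t :=
      (Complex.ofRealCLM.hasDerivAt (x := t)).mul_const _
    have h6 := (hHd0 t ht).comp t h3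
    rw [zero_mul] at h6
    exact h6
  have hconst := constant_of_has_deriv_right_zero (a := 0) (b := 1)
    (fun t ht => (hg t ht).continuousAt.continuousWithinAt)
    (fun t ht => (hg t (Ico_subset_Icc_self ht)).hasDerivWithinAt) 1 (by simp)
  rw [hHplane, hHplane, one_smul, zero_smul, add_zero] at hconst
  exact hconst

end Shift

/-! ### The functional with a given inverse Fourier-Laplace transform -/

section Existence

open MeasureTheory

variable {n : ℕ}

/-- Holomorphic functions of polynomial growth in a truncated tube. -/
def PolyGrowth (f : EuclideanSpace ℂ (Fin n) → ℂ) (N : ℕ) (C' : Set (EuclideanSpace ℝ (Fin n)))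
    (ρ : ℝ) : Prop :=
  DifferentiableOn ℂ f (truncTube C' ρ) ∧
    ∃ K : ℝ, 0 ≤ K ∧ ∀ z ∈ truncTube C' ρ, ‖f z‖ ≤ K * (1 + ‖z‖) ^ N

/-- Positive radii keep `Im z` away from `0`, hence inside `C`, where the weight is `1`. The
exponent is rounded up to a natural number and remains common to all subcones. -/
theorem HolGrowth.exists_polyGrowth {C : Set (EuclideanSpace ℝ (Fin n))} (hC : IsOpenCone C)
    {r : Set (EuclideanSpace ℝ (Fin n)) → ℝ} (hr : ∀ C', 0 < r C')
    {f : EuclideanSpace ℂ (Fin n) → ℂ} (hf : HolGrowth C r f) :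
    ∃ N : ℕ, ∀ C', IsSubcone C C' → PolyGrowth f N C' (r C') := by
  obtain ⟨N, -, hf⟩ := hf
  refine ⟨⌈N⌉₊, fun C' hC' => ⟨(hf C' hC').1, ?_⟩⟩
  obtain ⟨-, K, hK0, hK⟩ := hf C' hC'
  refine ⟨K, hK0, fun z hz => ?_⟩
  have h := hK z hz
  rw [mem_truncTube] at hz
  have h0 : imPart z ≠ 0 := norm_pos_iff.1 ((hr C').trans hz.2)
  rw [exp_indicatorFn_eq_one hC hC' hz.1 h0, mul_one, ← ofReal_norm,
    ENNReal.ofReal_le_ofReal_iff (by positivity)] at h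
  refine h.trans ?_
  rw [← Real.rpow_natCast]
  gcongr
  · linarith [norm_nonneg z]
  · exact Nat.le_ceil N

theorem continuous_comp_tubePt {f : EuclideanSpace ℂ (Fin n) → ℂ}
    {C' : Set (EuclideanSpace ℝ (Fin n))} {ρ : ℝ} (hf : DifferentiableOn ℂ f (truncTube C' ρ))
    {y : EuclideanSpace ℝ (Fin n)} (hy : y ∈ C') (hρ : ρ < ‖y‖) :
    Continuous fun x => f (tubePt x y) :=
  hf.continuousOn.comp_continuous (continuous_tubePt y) fun x => by
    rw [mem_truncTube, imPart_tubePt]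
    exact ⟨hy, hρ⟩

/-- Of the decay of order `n + 1 + N`, the part `N` pays for the growth of `f` and `n + 1` remains
for integrability. -/
theorem pow_mul_fourier_mul_le {f : EuclideanSpace ℂ (Fin n) → ℂ} {N : ℕ}
    {C' : Set (EuclideanSpace ℝ (Fin n))} {ρ K : ℝ} (hK0 : 0 ≤ K)
    (hK : ∀ z ∈ truncTube C' ρ, ‖f z‖ ≤ K * (1 + ‖z‖) ^ N) {y : EuclideanSpace ℝ (Fin n)}
    (hy : y ∈ C') (hρ : ρ < ‖y‖) {φ : EuclideanSpace ℝ (Fin n) → ℂ} {D : ℝ}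
    {u : EuclideanSpace ℝ (Fin n)} (hD : (1 + ‖u‖) ^ (n + 1 + N) * ‖𝓕 (twist y φ) u‖ ≤ D) :
    (1 + ‖u‖) ^ (n + 1) * ‖𝓕 (twist y φ) u * f (tubePt ((2 * Real.pi) • u) y)‖ ≤
      K * (1 + 2 * Real.pi + ‖y‖) ^ N * D := by
  have hf : ‖f (tubePt ((2 * Real.pi) • u) y)‖ ≤
      K * ((1 + 2 * Real.pi + ‖y‖) ^ N * (1 + ‖u‖) ^ N) := by
    refine (hK _ ?_).trans ?_
    · rw [mem_truncTube, imPart_tubePt]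
      exact ⟨hy, hρ⟩
    · rw [← mul_pow]
      gcongr
      exact one_add_norm_tubePt_le u y
  rw [norm_mul]
  calc _ ≤ (1 + ‖u‖) ^ (n + 1) * (‖𝓕 (twist y φ) u‖ *
        (K * ((1 + 2 * Real.pi + ‖y‖) ^ N * (1 + ‖u‖) ^ N))) := by gcongr
    _ = K * (1 + 2 * Real.pi + ‖y‖) ^ N * ((1 + ‖u‖) ^ (n + 1 + N) * ‖𝓕 (twist y φ) u‖) := by
      rw [pow_add (1 + ‖u‖) (n + 1) N]
      ring
    _ ≤ _ := by gcongr

theorem norm_planeIntegral_le {f : EuclideanSpace ℂ (Fin n) → ℂ} {N : ℕ}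
    {C' : Set (EuclideanSpace ℝ (Fin n))} {ρ K : ℝ} (hK0 : 0 ≤ K)
    (hK : ∀ z ∈ truncTube C' ρ, ‖f z‖ ≤ K * (1 + ‖z‖) ^ N) {y : EuclideanSpace ℝ (Fin n)}
    (hy : y ∈ C') (hρ : ρ < ‖y‖) {φ : EuclideanSpace ℝ (Fin n) → ℂ} {D : ℝ}
    (hD : ∀ u, (1 + ‖u‖) ^ (n + 1 + N) * ‖𝓕 (twist y φ) u‖ ≤ D) :
    ‖planeIntegral f y φ‖ ≤ K * (1 + 2 * Real.pi + ‖y‖) ^ N * D *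
      ∫ u : EuclideanSpace ℝ (Fin n), (1 + ‖u‖) ^ (-((n + 1 : ℕ) : ℝ)) := by
  rw [← integral_const_mul]
  refine norm_integral_le_of_norm_le ((integrable_one_add_norm_pow_neg n).const_mul _)
    (Eventually.of_forall fun u => ?_)
  exact le_mul_rpow_neg_of_pow_mul_le (norm_nonneg u) (pow_mul_fourier_mul_le hK0 hK hy hρ (hD u))

theorem integrable_planeIntegral {f : EuclideanSpace ℂ (Fin n) → ℂ} {N : ℕ}
    {C' : Set (EuclideanSpace ℝ (Fin n))} {ρ : ℝ} (hf : PolyGrowth f N C' ρ)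
    {y : EuclideanSpace ℝ (Fin n)} (hy : y ∈ C') (hρ : ρ < ‖y‖) {δ : ℝ} (hδ : 0 < δ)
    {φ : EuclideanSpace ℝ (Fin n) → ℂ} (hφ : TwistDecay δ y φ) :
    Integrable fun u => 𝓕 (twist y φ) u * f (tubePt ((2 * Real.pi) • u) y) := by
  obtain ⟨hd, K, hK0, hK⟩ := hf
  obtain ⟨D, -, hD⟩ := hφ.fourier_le hδ (n + 1 + N)
  refine integrable_of_pow_mul_le (Continuous.aestronglyMeasurable ?_)
    fun u => pow_mul_fourier_mul_le hK0 hK hy hρ (hD u)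
  exact (continuous_fourier_twist hδ hφ).mul
    ((continuous_comp_tubePt hd hy hρ).comp (continuous_const_smul _))

theorem fourier_twist_add {δ : ℝ} (hδ : 0 < δ) {y : EuclideanSpace ℝ (Fin n)}
    {φ ψ : EuclideanSpace ℝ (Fin n) → ℂ} (hφ : TwistDecay δ y φ) (hψ : TwistDecay δ y ψ) :
    𝓕 (twist y (φ + ψ)) = 𝓕 (twist y φ) + 𝓕 (twist y ψ) := by
  have h1 : twist y (φ + ψ) = twist y φ + twist y ψ := by
    ext ξ
    simp only [twist_apply, Pi.add_apply, add_mul]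
  have h2 := FourierTransform.fourier_add (twistSchwartz hδ hφ) (twistSchwartz hδ hψ)
  ext u
  have h3 := congrArg (fun g : 𝓢(EuclideanSpace ℝ (Fin n), ℂ) => g u) h2
  simp only [SchwartzMap.fourier_coe, add_apply] at h3
  rw [h1]
  exact h3

theorem fourier_twist_smul (c : ℂ) (y : EuclideanSpace ℝ (Fin n))
    (φ : EuclideanSpace ℝ (Fin n) → ℂ) (u : EuclideanSpace ℝ (Fin n)) :
    𝓕 (twist y (c • φ)) u = c * 𝓕 (twist y φ) u := by
  rw [fourier_twist, fourier_twist, ← integral_const_mul]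
  simp only [Pi.smul_apply, smul_eq_mul, mul_assoc]

theorem le_hK {K : Set (EuclideanSpace ℝ (Fin n))} (hK' : IsCompact K)
    {x : EuclideanSpace ℝ (Fin n)} (hx : x ∈ K) (ξ : EuclideanSpace ℝ (Fin n)) :
    |inner ℝ ξ x| ≤ hK K ξ := by
  obtain ⟨R, -, hR⟩ := hK'.isBounded.exists_pos_norm_le
  refine le_ciSup (f := fun x : K => |inner ℝ ξ (x : EuclideanSpace ℝ (Fin n))|)
    ⟨‖ξ‖ * R, ?_⟩ ⟨x, hx⟩
  rintro _ ⟨x, rfl⟩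
  exact (abs_real_inner_le_norm _ _).trans (mul_le_mul_of_nonneg_left (hR _ x.2) (norm_nonneg _))

/-- The supremum is tested at the point of the ball farthest in the direction `ξ`. A ball around `y`
inside `O` thus makes `φ exp ⟨·, y⟩` decay exponentially for every test function. -/
theorem inner_add_le_hK_closedBall (y ξ : EuclideanSpace ℝ (Fin n)) {δ : ℝ} (hδ : 0 ≤ δ) :
    inner ℝ ξ y + δ * ‖ξ‖ ≤ hK (Metric.closedBall y δ) ξ := by
  have hx : y + (δ * ‖ξ‖⁻¹) • ξ ∈ Metric.closedBall y δ := by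
    rw [mem_closedBall_iff_norm, add_sub_cancel_left, norm_smul, norm_mul, norm_inv, norm_norm,
      Real.norm_of_nonneg hδ, mul_assoc]
    exact mul_le_of_le_one_right hδ inv_mul_le_one
  refine le_trans (le_of_eq ?_) ((le_abs_self _).trans (le_hK (isCompact_closedBall y δ) hx ξ))
  rw [inner_add_right, real_inner_smul_right, real_inner_self_eq_norm_mul_norm]
  rcases eq_or_ne ‖ξ‖ 0 with h | h
  · simp [h]
  · field_simp

theorem mul_exp_inner_le_of_hK {y ξ : EuclideanSpace ℝ (Fin n)} {δ a B : ℝ} (hδ : 0 ≤ δ)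
    (ha : 0 ≤ a) (h : Real.exp (hK (Metric.closedBall y δ) ξ) * a ≤ B) :
    a * Real.exp (inner ℝ ξ y) ≤ B * Real.exp (-(δ * ‖ξ‖)) := by
  rw [Real.exp_neg, ← div_eq_mul_inv, le_div_iff₀ (Real.exp_pos _), mul_assoc, ← Real.exp_add,
    mul_comm]
  refine le_trans ?_ h
  gcongr
  exact inner_add_le_hK_closedBall y ξ hδ

theorem testSpace_twistDecay {O : Set (EuclideanSpace ℝ (Fin n))} {y : EuclideanSpace ℝ (Fin n)}
    {δ : ℝ} (hδ : 0 ≤ δ) (hO : Metric.closedBall y δ ⊆ O) (φ : testSpace O) :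
    TwistDecay δ y φ := by
  refine ⟨φ.2.1, fun m => ?_⟩
  choose B hB using fun j : ℕ =>
    φ.2.2 _ hO (convex_closedBall y δ) (isCompact_closedBall y δ) j
  have hB0 : ∀ j, 0 ≤ B j := fun j => le_trans (by positivity) (hB j 0)
  refine ⟨∑ j ∈ Finset.range (m + 1), B j, Finset.sum_nonneg fun j _ => hB0 j, fun j hj ξ => ?_⟩
  refine mul_exp_inner_le_of_hK hδ (norm_nonneg _) ((hB j ξ).trans ?_)
  exact Finset.single_le_sum (fun i _ => hB0 i) (Finset.mem_range.2 (by omega))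

/-- The functional `φ ↦ (2π)ⁿ ∫ 𝓕 (φ exp ⟨·, y⟩)(u) f(2πu + iy) du`. -/
def planeFunctional {O C' : Set (EuclideanSpace ℝ (Fin n))} {f : EuclideanSpace ℂ (Fin n) → ℂ}
    {N : ℕ} {ρ : ℝ} (hf : PolyGrowth f N C' ρ) {y : EuclideanSpace ℝ (Fin n)} (hy : y ∈ C')
    (hρ : ρ < ‖y‖) {δ : ℝ} (hδ : 0 < δ) (hO : Metric.closedBall y δ ⊆ O) :
    testSpace O →ₗ[ℂ] ℂ where
  toFun φ := ((2 * Real.pi : ℝ) : ℂ) ^ n * planeIntegral f y φ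
  map_add' φ ψ := by
    have hφ := testSpace_twistDecay hδ.le hO φ
    have hψ := testSpace_twistDecay hδ.le hO ψ
    rw [← mul_add, planeIntegral, planeIntegral, planeIntegral,
      ← integral_add (integrable_planeIntegral hf hy hρ hδ hφ)
        (integrable_planeIntegral hf hy hρ hδ hψ), Submodule.coe_add, fourier_twist_add hδ hφ hψ]
    simp only [Pi.add_apply, add_mul]
  map_smul' c φ := by
    simp only [planeIntegral, Submodule.coe_smul, fourier_twist_smul, mul_assoc,
      integral_const_mul, RingHom.id_apply, smul_eq_mul]
    ring

theorem planeFunctional_apply {O C' : Set (EuclideanSpace ℝ (Fin n))}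
    {f : EuclideanSpace ℂ (Fin n) → ℂ} {N : ℕ} {ρ : ℝ} (hf : PolyGrowth f N C' ρ)
    {y : EuclideanSpace ℝ (Fin n)} (hy : y ∈ C') (hρ : ρ < ‖y‖) {δ : ℝ} (hδ : 0 < δ)
    (hO : Metric.closedBall y δ ⊆ O) (φ : testSpace O) :
    planeFunctional hf hy hρ hδ hO φ = ((2 * Real.pi : ℝ) : ℂ) ^ n * planeIntegral f y φ := rfl

/-- The continuity seminorm comes from the closed ball around `y` and from the number of derivatives
that control the decay of the Fourier transform. -/
theorem planeFunctional_mem_expDual {O C' : Set (EuclideanSpace ℝ (Fin n))}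
    {f : EuclideanSpace ℂ (Fin n) → ℂ} {N : ℕ} {ρ : ℝ} (hf : PolyGrowth f N C' ρ)
    {y : EuclideanSpace ℝ (Fin n)} (hy : y ∈ C') (hρ : ρ < ‖y‖) {δ : ℝ} (hδ : 0 < δ)
    (hO : Metric.closedBall y δ ⊆ O) : planeFunctional hf hy hρ hδ hO ∈ expDual O := by
  obtain ⟨-, K, hK0, hK⟩ := id hf
  obtain ⟨l, c, hc0, hc⟩ := exists_fourier_twist_le n (n + 1 + N) hδ
  obtain ⟨I, hI⟩ : ∃ I, I = ∫ u : EuclideanSpace ℝ (Fin n), (1 + ‖u‖) ^ (-((n + 1 : ℕ) : ℝ)) :=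
    ⟨_, rfl⟩
  have hI0 : 0 ≤ I := by
    rw [hI]
    exact integral_nonneg fun u => by positivity
  refine ⟨_, hO, convex_closedBall y δ, isCompact_closedBall y δ, l, (2 * Real.pi) ^ n *
    (K * (1 + 2 * Real.pi + ‖y‖) ^ N * (c * (1 + ‖y‖) ^ l) * I), by positivity, fun φ B hB => ?_⟩
  have hB0 : 0 ≤ B := le_trans (by positivity) (hB 0 (Nat.zero_le _) 0)
  have hD := hc y φ (testSpace_twistDecay hδ.le hO φ) B hB0
    fun j hj ξ => mul_exp_inner_le_of_hK hδ.le (norm_nonneg _) (hB j hj ξ)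
  have h := norm_planeIntegral_le hK0 hK hy hρ hD
  rw [← hI] at h
  rw [planeFunctional_apply, norm_mul, norm_pow, Complex.norm_real,
    Real.norm_of_nonneg (by positivity)]
  calc _ ≤ (2 * Real.pi) ^ n *
        (K * (1 + 2 * Real.pi + ‖y‖) ^ N * (c * ((1 + ‖y‖) ^ l * B)) * I) := by gcongr
    _ = _ := by ring

end Existence

/-! ### Independence of the plane, support and inverse transform of the functional -/

section Plane

open MeasureTheory

variable {n : ℕ} {C : Set (EuclideanSpace ℝ (Fin n))} {r : Set (EuclideanSpace ℝ (Fin n)) → ℝ}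
  {f : EuclideanSpace ℂ (Fin n) → ℂ} {N : ℕ} {φ : EuclideanSpace ℝ (Fin n) → ℂ}

theorem PolyGrowth.planeIntegral_add_eq {C' : Set (EuclideanSpace ℝ (Fin n))} {ρ : ℝ}
    (hf : PolyGrowth f N C' ρ) (hC' : IsOpen C') {a v : EuclideanSpace ℝ (Fin n)}
    (hav : ∀ t ∈ Icc (0 : ℝ) 1, a + t • v ∈ C' ∧ ρ < ‖a + t • v‖) (hφ : φ ∈ bumpSpace n) :
    planeIntegral f (a + v) φ = planeIntegral f a φ := by
  obtain ⟨hd, K, hK0, hK⟩ := hf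
  exact PWS.planeIntegral_add_eq hC' hd hK0 hK hav hφ

/-- Going outward along a ray stays in the cone and increases the norm, so the plane can be shifted
within one truncated tube. -/
theorem planeIntegral_smul_eq (hf : ∀ C', IsSubcone C C' → PolyGrowth f N C' (r C'))
    {C' : Set (EuclideanSpace ℝ (Fin n))} (hC' : IsSubcone C C') {y : EuclideanSpace ℝ (Fin n)}
    (hy : y ∈ C') (hr : r C' < ‖y‖) {s : ℝ} (hs : 1 ≤ s) (hφ : φ ∈ bumpSpace n) :
    planeIntegral f (s • y) φ = planeIntegral f y φ := by
  have h := (hf C' hC').planeIntegral_add_eq hC'.1.1 (a := y) (v := (s - 1) • y)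
    (fun t ht => ?_) hφ
  · rwa [sub_smul, one_smul, add_sub_cancel] at h
  · have h1 : 1 ≤ 1 + t * (s - 1) := by nlinarith [ht.1]
    have h2 : y + t • (s - 1) • y = (1 + t * (s - 1)) • y := by module
    rw [h2]
    refine ⟨hC'.1.2 y hy _ (by linarith), hr.trans_le ?_⟩
    rw [norm_smul, Real.norm_of_nonneg (by linarith)]
    exact le_mul_of_one_le_left (norm_nonneg y) h1

/-- The segment is compact in `C \ {0}` and fits into one subcone `C₂`, but may enter the excluded
ball of `C₂`. Both endpoints are therefore first pushed outward along their rays by a common factor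
`s`, and then joined within the tube over `C₂`. -/
theorem planeIntegral_eq_of_zero_notMem_segment (hC : IsOpenCone C) (hCconv : Convex ℝ C)
    (hr0 : ∀ C', 0 < r C') (hf : ∀ C', IsSubcone C C' → PolyGrowth f N C' (r C'))
    {C₀ C₁ : Set (EuclideanSpace ℝ (Fin n))} (hC₀ : IsSubcone C C₀) (hC₁ : IsSubcone C C₁)
    {y₀ y₁ : EuclideanSpace ℝ (Fin n)} (hy₀ : y₀ ∈ C₀) (hr₀ : r C₀ < ‖y₀‖) (hy₁ : y₁ ∈ C₁)
    (hr₁ : r C₁ < ‖y₁‖) (h0 : (0 : EuclideanSpace ℝ (Fin n)) ∉ segment ℝ y₀ y₁)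
    (hφ : φ ∈ bumpSpace n) : planeIntegral f y₁ φ = planeIntegral f y₀ φ := by
  have hne₀ : y₀ ≠ 0 := norm_pos_iff.1 ((hr0 _).trans hr₀)
  have hne₁ : y₁ ≠ 0 := norm_pos_iff.1 ((hr0 _).trans hr₁)
  have hcomp : IsCompact (segment ℝ y₀ y₁) := by
    rw [segment_eq_image_lineMap]
    exact isCompact_Icc.image (by fun_prop)
  obtain ⟨C₂, hC₂, hseg⟩ := exists_isSubcone_of_isCompact hC hcomp
    (hCconv.segment_subset (hC₀.mem hC hy₀ hne₀) (hC₁.mem hC hy₁ hne₁)) h0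
  obtain ⟨x, hx, hmin⟩ := hcomp.exists_isMinOn ⟨y₀, left_mem_segment ℝ y₀ y₁⟩
    continuous_norm.continuousOn
  have hx0 : 0 < ‖x‖ := norm_pos_iff.2 fun h => h0 (h ▸ hx)
  let s : ℝ := 1 + r C₂ / ‖x‖
  have hs : 1 ≤ s := le_add_of_nonneg_right (div_nonneg (hr0 _).le hx0.le)
  have hsx : r C₂ < s * ‖x‖ := by
    simp only [s, add_mul, div_mul_cancel₀ _ hx0.ne']
    linarith
  rw [← planeIntegral_smul_eq hf hC₀ hy₀ hr₀ hs hφ, ← planeIntegral_smul_eq hf hC₁ hy₁ hr₁ hs hφ]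
  have h := (hf C₂ hC₂).planeIntegral_add_eq hC₂.1.1 (a := s • y₀) (v := s • (y₁ - y₀))
    (fun t ht => ?_) hφ
  · rwa [smul_sub, add_sub_cancel] at h
  · have h1 : s • y₀ + t • s • (y₁ - y₀) = s • AffineMap.lineMap y₀ y₁ t := by
      rw [AffineMap.lineMap_apply_module]
      module
    have h2 : AffineMap.lineMap y₀ y₁ t ∈ segment ℝ y₀ y₁ := by
      rw [segment_eq_image_lineMap]
      exact mem_image_of_mem _ ht
    rw [h1]
    refine ⟨hC₂.1.2 _ (hseg h2) _ (by linarith), hsx.trans_le ?_⟩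
    rw [norm_smul, Real.norm_of_nonneg (by linarith)]
    exact mul_le_mul_of_nonneg_left (hmin h2) (by linarith)

/-- An open cone that contains its vertex is the whole space. -/
theorem eq_univ_of_zero_mem (hC : IsOpenCone C) (h0 : (0 : EuclideanSpace ℝ (Fin n)) ∈ C) :
    C = univ := by
  refine eq_univ_of_forall fun x => ?_
  have h1 : Tendsto (fun t : ℝ => t • x) (𝓝[>] 0) (𝓝 0) := by
    have h2 : Tendsto (fun t : ℝ => t • x) (𝓝 0) (𝓝 ((0 : ℝ) • x)) :=
      Continuous.tendsto (by fun_prop) 0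
    rw [zero_smul] at h2
    exact h2.mono_left nhdsWithin_le_nhds
  obtain ⟨t, ht, ht0⟩ := ((h1.eventually (hC.1.mem_nhds h0)).and self_mem_nhdsWithin).exists
  have h3 := hC.2 _ ht t⁻¹ (inv_pos.2 ht0)
  rwa [smul_smul, inv_mul_cancel₀ (ne_of_gt ht0), one_smul] at h3

/-- If the segment meets the origin, then `C` is the whole space and `n ≥ 2` by the exclusion of `C
= ℝ`. A detour through a point off the line `ℝ y₀` then avoids the origin. -/
theorem planeIntegral_eq (hn : 1 ≤ n) (hC : IsOpenCone C) (hCconv : Convex ℝ C)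
    (hC1 : n = 1 → C ≠ univ) (hr0 : ∀ C', 0 < r C')
    (hf : ∀ C', IsSubcone C C' → PolyGrowth f N C' (r C'))
    {C₀ C₁ : Set (EuclideanSpace ℝ (Fin n))} (hC₀ : IsSubcone C C₀) (hC₁ : IsSubcone C C₁)
    {y₀ y₁ : EuclideanSpace ℝ (Fin n)} (hy₀ : y₀ ∈ C₀) (hr₀ : r C₀ < ‖y₀‖) (hy₁ : y₁ ∈ C₁)
    (hr₁ : r C₁ < ‖y₁‖) (hφ : φ ∈ bumpSpace n) : planeIntegral f y₁ φ = planeIntegral f y₀ φ := by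
  by_cases h0 : (0 : EuclideanSpace ℝ (Fin n)) ∈ segment ℝ y₀ y₁
  swap
  · exact planeIntegral_eq_of_zero_notMem_segment hC hCconv hr0 hf hC₀ hC₁ hy₀ hr₀ hy₁ hr₁ h0 hφ
  have hne₀ : y₀ ≠ 0 := norm_pos_iff.1 ((hr0 _).trans hr₀)
  have hne₁ : y₁ ≠ 0 := norm_pos_iff.1 ((hr0 _).trans hr₁)
  have huniv : C = univ := eq_univ_of_zero_mem hC
    (hCconv.segment_subset (hC₀.mem hC hy₀ hne₀) (hC₁.mem hC hy₁ hne₁) h0)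
  have hn2 : 2 ≤ n := by
    by_contra h
    exact hC1 (by omega) huniv
  obtain ⟨c, hc⟩ : ∃ c : ℝ, y₁ = c • y₀ := by
    obtain ⟨a, b, ha, hb, hab, h⟩ := h0
    have hb0 : b ≠ 0 := fun h1 => by
      rw [h1, add_zero] at hab
      rw [hab, h1, one_smul, zero_smul, add_zero] at h
      exact hne₀ h
    refine ⟨-(b⁻¹ * a), ?_⟩
    have h1 : b⁻¹ • (a • y₀ + b • y₁) = 0 := by rw [h, smul_zero]
    rw [smul_add, smul_smul, smul_smul, inv_mul_cancel₀ hb0, one_smul] at h1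
    rw [neg_smul]
    exact eq_neg_of_add_eq_zero_right h1
  have hspan : (Submodule.span ℝ {y₀} : Submodule ℝ (EuclideanSpace ℝ (Fin n))) ≠ ⊤ := fun h => by
    have h1 := finrank_span_singleton (K := ℝ) hne₀
    rw [h, finrank_top, finrank_euclideanSpace_fin] at h1
    omega
  obtain ⟨x, -, hx⟩ := SetLike.exists_of_lt (lt_top_iff_ne_top.2 hspan)
  have hx0 : x ≠ 0 := fun h => hx (h ▸ zero_mem _)
  obtain ⟨C₂, hC₂, hxC₂⟩ := exists_isSubcone_of_isCompact hC (isCompact_singleton (x := x))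
    (huniv ▸ subset_univ _) (fun h => hx0 (mem_singleton_iff.1 h).symm)
  have hxpos : 0 < ‖x‖ := norm_pos_iff.2 hx0
  let s : ℝ := 1 + r C₂ / ‖x‖
  have hs : 0 < s := add_pos_of_pos_of_nonneg one_pos (div_nonneg (hr0 _).le hxpos.le)
  have hsx : r C₂ < ‖s • x‖ := by
    rw [norm_smul, Real.norm_of_nonneg hs.le]
    simp only [s, add_mul, div_mul_cancel₀ _ hxpos.ne']
    linarith
  have hsC₂ : s • x ∈ C₂ := hC₂.1.2 x (hxC₂ rfl) s hs
  have hkey : ∀ d : ℝ, d ≠ 0 → (0 : EuclideanSpace ℝ (Fin n)) ∉ segment ℝ (s • x) (d • y₀) := by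
    rintro d hd ⟨a, b, ha, hb, hab, h⟩
    have ha0 : a ≠ 0 := fun h1 => by
      rw [h1, zero_add] at hab
      rw [hab, h1, one_smul, zero_smul, zero_add] at h
      exact smul_ne_zero hd hne₀ h
    refine hx (Submodule.mem_span_singleton.2 ⟨-((a * s)⁻¹ * (b * d)), ?_⟩)
    have h1 : (a * s)⁻¹ • (a • s • x + b • d • y₀) = 0 := by rw [h, smul_zero]
    rw [smul_add, smul_smul a, smul_smul b, smul_smul, smul_smul,
      inv_mul_cancel₀ (mul_ne_zero ha0 hs.ne'), one_smul] at h1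
    rw [neg_smul]
    exact (eq_neg_of_add_eq_zero_left h1).symm
  have hc0 : c ≠ 0 := fun h => hne₁ (by rw [hc, h, zero_smul])
  rw [planeIntegral_eq_of_zero_notMem_segment hC hCconv hr0 hf hC₂ hC₁ hsC₂ hsx hy₁ hr₁
      (hc ▸ hkey c hc0) hφ,
    planeIntegral_eq_of_zero_notMem_segment hC hCconv hr0 hf hC₂ hC₀ hsC₂ hsx hy₀ hr₀
      (by simpa using hkey 1 one_ne_zero) hφ]

end Plane

/-! ### Vanishing off the dual cone, and recovery of `f` from its plane integral -/

section Properties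

open MeasureTheory

variable {n : ℕ} {C : Set (EuclideanSpace ℝ (Fin n))} {r : Set (EuclideanSpace ℝ (Fin n)) → ℝ}
  {f : EuclideanSpace ℂ (Fin n) → ℂ} {N : ℕ} {φ : EuclideanSpace ℝ (Fin n) → ℂ}

/-- The integral vanishes for functions supported in a half space `⟨ξ, e⟩ < 0` with `e ∈ C`. -/
theorem exists_planeIntegral_eq_zero (hC : IsOpenCone C) (hr0 : ∀ C', 0 < r C')
    (hf : ∀ C', IsSubcone C C' → PolyGrowth f N C' (r C')) {e : EuclideanSpace ℝ (Fin n)}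
    (he : e ∈ C) (he0 : e ≠ 0) (hφ : φ ∈ bumpSpace n)
    (hsupp : ∀ ξ ∈ tsupport φ, inner ℝ ξ e < 0) :
    ∃ C', IsSubcone C C' ∧ ∃ y ∈ C', r C' < ‖y‖ ∧ planeIntegral f y φ = 0 := by
  obtain ⟨C', hC', heC'⟩ := exists_isSubcone_of_isCompact hC (isCompact_singleton (x := e))
    (singleton_subset_iff.2 he) (fun h => he0 (mem_singleton_iff.1 h).symm)
  rw [singleton_subset_iff] at heC'
  have hepos : 0 < ‖e‖ := norm_pos_iff.2 he0
  let t₀ : ℝ := 1 + r C' / ‖e‖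
  have ht₀ : 0 < t₀ := add_pos_of_pos_of_nonneg one_pos (div_nonneg (hr0 _).le hepos.le)
  have htr : r C' < ‖t₀ • e‖ := by
    rw [norm_smul, Real.norm_of_nonneg ht₀.le]
    simp only [t₀, add_mul, div_mul_cancel₀ _ hepos.ne']
    linarith
  have ht₀C' : t₀ • e ∈ C' := hC'.1.2 e heC' t₀ ht₀
  refine ⟨C', hC', t₀ • e, ht₀C', htr, ?_⟩
  -- By compactness of the support, `⟨ξ, e⟩ ≤ -σ` there, so the twist by `t • e` contributes `exp
  -- (-σt)`.
  obtain ⟨σ, hσ, hσφ⟩ := hφ.2.isCompact.exists_forall_le' (f := fun ξ => -inner ℝ ξ e) (a := 0)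
    (by fun_prop) fun ξ hξ => by linarith [hsupp ξ hξ]
  obtain ⟨-, K, hK0, hK⟩ := hf C' hC'
  obtain ⟨l, c, hc0, hc⟩ := exists_fourier_twist_le n (n + 1 + N) one_pos
  obtain ⟨-, B, hB⟩ := bumpSpace_le_weightedSpace 1 l hφ
  have hB0 : 0 ≤ B := le_trans (by positivity) (hB 0 (Nat.zero_le _) 0)
  obtain ⟨I, hI⟩ : ∃ I, I = ∫ u : EuclideanSpace ℝ (Fin n), (1 + ‖u‖) ^ (-((n + 1 : ℕ) : ℝ)) :=
    ⟨_, rfl⟩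
  have hI0 : 0 ≤ I := by
    rw [hI]
    exact integral_nonneg fun u => by positivity
  -- The power is `N` for the growth of `f`, `l` for the derivatives of the twist, and one more for
  -- the factor `s` in the next claim.
  obtain ⟨E, hE0, hE⟩ := exists_pow_mul_exp_le (N + l + 1) hσ
  let A : ℝ := 1 + 2 * Real.pi + ‖e‖
  -- The integral does not change along the ray; a bound on `s` times its norm, uniform in `s`,
  -- forces it to vanish.
  have hA : ∀ s : ℝ, 1 ≤ s → ‖planeIntegral f (t₀ • e) φ‖ * s ≤
      K * A ^ N * (c * (A ^ l * B)) * I * E := fun s hs => by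
    let t : ℝ := s * t₀
    have ht0 : 0 ≤ t := by positivity
    have hst : s ≤ 1 + t := by
      have h1 : 1 ≤ t₀ := le_add_of_nonneg_right (div_nonneg (hr0 _).le hepos.le)
      have : s ≤ s * t₀ := le_mul_of_one_le_right (by linarith) h1
      simp only [t]
      linarith
    have hte : s • t₀ • e = t • e := by rw [smul_smul]
    rw [← planeIntegral_smul_eq hf hC' ht₀C' htr hs hφ, hte]
    have hnorm : ‖t • e‖ = t * ‖e‖ := by rw [norm_smul, Real.norm_of_nonneg ht0]
    have hrt : r C' < ‖t • e‖ := by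
      refine htr.trans_le ?_
      rw [← hte, norm_smul s, Real.norm_of_nonneg (by linarith : 0 ≤ s)]
      exact le_mul_of_one_le_left (norm_nonneg _) hs
    have htC' : t • e ∈ C' := hte ▸ hC'.1.2 _ ht₀C' s (by linarith)
    have hD := hc (t • e) φ (bumpSpace_twistDecay hφ 1 _) (B * Real.exp (-(σ * t)))
      (by positivity) fun j hj ξ => ?_
    · have h := norm_planeIntegral_le hK0 hK htC' hrt hD
      rw [← hI, hnorm] at h
      have h1 : 1 + 2 * Real.pi + t * ‖e‖ ≤ A * (1 + t) := by
        simp only [A]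
        nlinarith [Real.pi_pos, mul_nonneg Real.pi_pos.le ht0]
      have h2 : 1 + t * ‖e‖ ≤ A * (1 + t) := by linarith [Real.pi_pos]
      calc _ ≤ (K * (1 + 2 * Real.pi + t * ‖e‖) ^ N *
            (c * ((1 + t * ‖e‖) ^ l * (B * Real.exp (-(σ * t))))) * I) * (1 + t) := by gcongr
        _ ≤ (K * (A * (1 + t)) ^ N *
            (c * ((A * (1 + t)) ^ l * (B * Real.exp (-(σ * t))))) * I) * (1 + t) := by gcongr
        _ = K * A ^ N * (c * (A ^ l * B)) * I * ((1 + t) ^ (N + l + 1) * Real.exp (-(σ * t))) := by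
          rw [mul_pow, mul_pow, pow_succ, pow_add]
          ring
        _ ≤ _ := by
          gcongr
          exact hE t ht0
    · by_cases hξ : ξ ∈ tsupport φ
      · have h1 : inner ℝ ξ (t • e) ≤ -(σ * t) := by
          rw [real_inner_smul_right]
          nlinarith [hσφ ξ hξ]
        have h2 := hB j hj ξ
        calc _ ≤ ‖iteratedFDeriv ℝ j φ ξ‖ * Real.exp (-(σ * t)) := by gcongr
          _ = (Real.exp (1 * ‖ξ‖) * ‖iteratedFDeriv ℝ j φ ξ‖) * Real.exp (-(σ * t)) *
              Real.exp (-(1 * ‖ξ‖)) := by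
            rw [Real.exp_neg (1 * ‖ξ‖)]
            field_simp
          _ ≤ _ := by gcongr
      · have h1 : iteratedFDeriv ℝ j φ ξ = 0 := by
          by_contra h
          exact hξ (support_iteratedFDeriv_subset j h)
        rw [h1, norm_zero, zero_mul]
        positivity
  by_contra hne
  have hpos : 0 < ‖planeIntegral f (t₀ • e) φ‖ := norm_pos_iff.2 hne
  have hM0 : 0 ≤ K * A ^ N * (c * (A ^ l * B)) * I * E := by positivity
  have h := hA (1 + K * A ^ N * (c * (A ^ l * B)) * I * E / ‖planeIntegral f (t₀ • e) φ‖)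
    (le_add_of_nonneg_right (by positivity))
  rw [mul_add, mul_div_cancel₀ _ hpos.ne'] at h
  linarith

/-- A linear functional that vanishes on functions with support in one of a family of open sets
vanishes on functions with support in their union. -/
theorem eq_zero_of_tsupport_subset_iUnion {O : Set (EuclideanSpace ℝ (Fin n))}
    (V : testSpace O →ₗ[ℂ] ℂ) {ι : Type} (U : ι → Set (EuclideanSpace ℝ (Fin n)))
    (hU : ∀ i, IsOpen (U i))
    (hV : ∀ i, ∀ φ (hφ : φ ∈ bumpSpace n), tsupport φ ⊆ U i →
      V ⟨φ, bumpSpace_le_testSpace O hφ⟩ = 0)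
    (hφ : φ ∈ bumpSpace n) (hφU : tsupport φ ⊆ ⋃ i, U i) :
    V ⟨φ, bumpSpace_le_testSpace O hφ⟩ = 0 := by
  obtain ⟨ρ, hρ⟩ := SmoothPartitionOfUnity.exists_isSubordinate 𝓘(ℝ, EuclideanSpace ℝ (Fin n))
    (isClosed_tsupport φ) U hU hφU
  -- By compactness only finitely many members of the partition of unity meet the support of `φ`, so
  -- linearity applies.
  have hfin := ρ.locallyFinite.finite_nonempty_inter_compact hφ.2.isCompact
  have hg : ∀ i, ContDiff ℝ ∞ fun ξ => ((ρ i ξ : ℝ) : ℂ) := fun i =>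
    Complex.ofRealCLM.contDiff.comp (ρ i).contMDiff.contDiff
  have hmem : ∀ i, (fun ξ => ((ρ i ξ : ℝ) : ℂ) * φ ξ) ∈ bumpSpace n := fun i =>
    mul_mem_bumpSpace (hg i) hφ
  have hsum : (⟨φ, bumpSpace_le_testSpace O hφ⟩ : testSpace O) =
      ∑ i ∈ hfin.toFinset, ⟨_, bumpSpace_le_testSpace O (hmem i)⟩ := by
    ext ξ
    rw [Submodule.coe_sum, Finset.sum_apply]
    by_cases hξ : ξ ∈ tsupport φ
    · have h1 := ρ.sum_eq_one hξ
      rw [finsum_eq_sum_of_support_subset (s := hfin.toFinset) _ fun i hi => ?_] at h1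
      · rw [← Finset.sum_mul, ← Complex.ofReal_sum, h1, Complex.ofReal_one, one_mul]
      · rw [Finite.coe_toFinset]
        exact ⟨ξ, hi, hξ⟩
    · simp [image_eq_zero_of_notMem_tsupport hξ]
  rw [hsum, map_sum]
  refine Finset.sum_eq_zero fun i _ => hV i _ (hmem i) ?_
  refine (tsupport_mul_subset_left).trans (subset_trans ?_ (hρ i))
  exact closure_mono fun ξ hξ h => hξ (by simp [h])

/-- The twist cancels the real exponential factor of `exp (i⟨ξ, x + iy⟩)`. What remains is a
modulated dilate of `η`, whose transform concentrates at `x/(2π)`. -/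
theorem twist_cutExp_fourier {η : EuclideanSpace ℝ (Fin n) → ℂ} (x y : EuclideanSpace ℝ (Fin n))
    (k : ℕ) (u : EuclideanSpace ℝ (Fin n)) :
    𝓕 (twist y (cutExp η (tubePt x y) k)) ((2 * Real.pi)⁻¹ • x + u) =
      ((k + 1 : ℝ) ^ n : ℝ) • 𝓕 (twist 0 η) ((k + 1 : ℝ) • u) := by
  have hk : (0 : ℝ) < k + 1 := by positivity
  have h1 : ∀ ξ, cutExp η (tubePt x y) k ξ *
      Complex.exp (phase (-tubePt ((2 * Real.pi) • ((2 * Real.pi)⁻¹ • x + u)) y) ξ) =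
      (fun ζ => η ζ * Complex.exp (phase (-tubePt ((2 * Real.pi) • (k + 1 : ℝ) • u) 0) ζ))
        ((k + 1 : ℝ)⁻¹ • ξ) := fun ξ => by
    have hneg : ∀ z : EuclideanSpace ℂ (Fin n), phase (-z) = -phase z := fun z => by
      rw [← neg_one_smul ℂ z, phase_smul]
      ext
      simp
    simp only [cutExp_eq]
    rw [mul_assoc, ← Complex.exp_add]
    simp only [hneg, _root_.neg_apply, phase_tubePt]
    congr 2
    simp only [inner_add_right, real_inner_smul_right, real_inner_smul_left, inner_zero_right]
    push_cast
    have hpi : (Real.pi : ℂ) ≠ 0 := Complex.ofReal_ne_zero.2 Real.pi_ne_zero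
    have hk' : (k + 1 : ℂ) ≠ 0 := by exact_mod_cast hk.ne'
    field_simp
    ring
  rw [fourier_twist, fourier_twist]
  have h2 := Measure.integral_comp_inv_smul (volume : Measure (EuclideanSpace ℝ (Fin n)))
    (fun ζ => η ζ * Complex.exp (phase (-tubePt ((2 * Real.pi) • (k + 1 : ℝ) • u) 0) ζ))
    (k + 1 : ℝ)
  rw [finrank_euclideanSpace_fin, abs_of_pos (by positivity)] at h2
  exact (integral_congr_ae (Eventually.of_forall h1)).trans h2

theorem planeIntegral_cutExp {η : EuclideanSpace ℝ (Fin n) → ℂ} (x y : EuclideanSpace ℝ (Fin n))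
    (k : ℕ) : planeIntegral f y (cutExp η (tubePt x y) k) =
      ∫ w, 𝓕 (twist 0 η) w * f (tubePt (x + (2 * Real.pi * (k + 1 : ℝ)⁻¹) • w) y) := by
  have hk : (0 : ℝ) < k + 1 := by positivity
  rw [planeIntegral, ← integral_add_left_eq_self _ ((2 * Real.pi)⁻¹ • x)]
  have h1 : ∀ u : EuclideanSpace ℝ (Fin n), (2 * Real.pi) • ((2 * Real.pi)⁻¹ • x + u) =
      x + (2 * Real.pi * (k + 1 : ℝ)⁻¹) • (k + 1 : ℝ) • u := fun u => by
    rw [smul_add, smul_smul, smul_smul, mul_inv_cancel₀ (by positivity), one_smul, mul_assoc,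
      inv_mul_cancel₀ hk.ne', mul_one]
  simp only [twist_cutExp_fourier, h1, smul_mul_assoc]
  rw [integral_smul, Measure.integral_comp_smul volume (fun w => 𝓕 (twist 0 η) w *
    f (tubePt (x + (2 * Real.pi * (k + 1 : ℝ)⁻¹) • w) y)), finrank_euclideanSpace_fin, smul_smul,
    abs_of_pos (by positivity), mul_inv_cancel₀ (by positivity), one_smul]

/-- After rescaling, the transform of `η` acts as an approximate identity at `x`: its integral is `η
0 = 1`, `f` is continuous on the plane, and dominated convergence applies. -/
theorem tendsto_planeIntegral_cutExp {C' : Set (EuclideanSpace ℝ (Fin n))} {ρ : ℝ}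
    (hf : PolyGrowth f N C' ρ) {z : EuclideanSpace ℂ (Fin n)} (hz : z ∈ truncTube C' ρ)
    {η : EuclideanSpace ℝ (Fin n) → ℂ} (hη : IsCutoff η) :
    Tendsto (fun k : ℕ => planeIntegral f (imPart z) (cutExp η z k)) atTop (𝓝 (f z)) := by
  obtain ⟨hd, K, hK0, hK⟩ := hf
  rw [mem_truncTube] at hz
  obtain ⟨x, y, rfl⟩ : ∃ x y, z = tubePt x y := ⟨_, _, (tubePt_rePart_imPart z).symm⟩
  rw [imPart_tubePt] at hz ⊢
  have hcont := continuous_comp_tubePt hd hz.1 hz.2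
  have hηd : TwistDecay 1 0 η := bumpSpace_twistDecay ⟨hη.1, hη.2.1⟩ 1 0
  have hηc := continuous_fourier_twist one_pos hηd
  have hone : ∫ w, 𝓕 (twist 0 η) w = 1 := by
    have h := integral_fourier_twist one_pos hηd 0
    rw [hη.2.2.self_of_nhds] at h
    simpa using h
  have hlim : f (tubePt x y) = ∫ w, 𝓕 (twist 0 η) w * f (tubePt x y) := by
    rw [integral_mul_const, hone, one_mul]
  simp only [planeIntegral_cutExp]
  rw [hlim]
  obtain ⟨D, -, hD⟩ := hηd.fourier_le one_pos (n + 1 + N)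
  refine tendsto_integral_of_dominated_convergence
    (fun w => (K * (1 + 2 * Real.pi + ‖x‖ + ‖y‖) ^ N * D) * (1 + ‖w‖) ^ (-((n + 1 : ℕ) : ℝ)))
    (fun k => (hηc.mul (hcont.comp (by fun_prop))).aestronglyMeasurable)
    ((integrable_one_add_norm_pow_neg n).const_mul _)
    (fun k => Eventually.of_forall fun w => ?_) (Eventually.of_forall fun w => ?_)
  · refine le_mul_rpow_neg_of_pow_mul_le (norm_nonneg w) ?_
    have h1 : 1 + ‖tubePt (x + (2 * Real.pi * (k + 1 : ℝ)⁻¹) • w) y‖ ≤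
        (1 + 2 * Real.pi + ‖x‖ + ‖y‖) * (1 + ‖w‖) := by
      have h2 := norm_tubePt_le (x + (2 * Real.pi * (k + 1 : ℝ)⁻¹) • w) y
      have h3 := norm_add_le x ((2 * Real.pi * (k + 1 : ℝ)⁻¹) • w)
      rw [norm_smul, Real.norm_of_nonneg (by positivity)] at h3
      have h4 : (k + 1 : ℝ)⁻¹ ≤ 1 := inv_le_one_of_one_le₀ (by linarith [k.cast_nonneg (α := ℝ)])
      have h5 : 2 * Real.pi * (k + 1 : ℝ)⁻¹ * ‖w‖ ≤ 2 * Real.pi * ‖w‖ := by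
        exact mul_le_mul_of_nonneg_right (mul_le_of_le_one_right (by positivity) h4) (norm_nonneg w)
      nlinarith [norm_nonneg x, norm_nonneg y, norm_nonneg w, Real.pi_pos,
        mul_nonneg (norm_nonneg x) (norm_nonneg w), mul_nonneg (norm_nonneg y) (norm_nonneg w)]
    have h2 : ‖f (tubePt (x + (2 * Real.pi * (k + 1 : ℝ)⁻¹) • w) y)‖ ≤
        K * ((1 + 2 * Real.pi + ‖x‖ + ‖y‖) ^ N * (1 + ‖w‖) ^ N) := by
      refine (hK _ ?_).trans ?_
      · rw [mem_truncTube, imPart_tubePt]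
        exact hz
      · rw [← mul_pow]
        gcongr
    rw [norm_mul]
    calc _ ≤ (1 + ‖w‖) ^ (n + 1) * (‖𝓕 (twist 0 η) w‖ *
          (K * ((1 + 2 * Real.pi + ‖x‖ + ‖y‖) ^ N * (1 + ‖w‖) ^ N))) := by gcongr
      _ = K * (1 + 2 * Real.pi + ‖x‖ + ‖y‖) ^ N *
          ((1 + ‖w‖) ^ (n + 1 + N) * ‖𝓕 (twist 0 η) w‖) := by
        rw [pow_add (1 + ‖w‖) (n + 1) N]
        ring
      _ ≤ _ := by
        gcongr
        exact hD w
  · refine Tendsto.const_mul _ ?_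
    have h1 : Tendsto (fun k : ℕ => x + (2 * Real.pi * (k + 1 : ℝ)⁻¹) • w) atTop (𝓝 x) := by
      have h2 := ((tendsto_one_div_add_atTop_nhds_zero_nat (𝕜 := ℝ)).const_mul
        (2 * Real.pi)).smul_const w
      have h3 := h2.const_add x
      simpa using h3
    exact (hcont.tendsto x).comp h1

/-- Existence of a functional with a given inverse Fourier-Laplace transform. -/
theorem exists_hasInvFourierLaplace (hn : 1 ≤ n) {O : Set (EuclideanSpace ℝ (Fin n))}
    (hC : IsOpenCone C) (hCconv : Convex ℝ C) (hC1 : n = 1 → C ≠ univ) (hO : IsOpen O)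
    (hr0 : ∀ C', 0 < r C') (hOr : ∃ C', IsSubcone C C' ∧ ∃ y ∈ C' ∩ O, r C' < ‖y‖)
    (hf : HolGrowth C r f) :
    ∃ V : testSpace O →ₗ[ℂ] ℂ, V ∈ expDualSupp O (dualCone C) ∧
      ∀ C', IsSubcone C C' → ∀ z ∈ truncTube C' (r C'), HasInvFourierLaplace V z (f z) := by
  obtain ⟨N, hfN⟩ := hf.exists_polyGrowth hC hr0
  obtain ⟨C₀, hC₀, y, ⟨hy, hyO⟩, hr⟩ := hOr
  obtain ⟨δ, hδ, hδO⟩ := Metric.nhds_basis_closedBall.mem_iff.1 (hO.mem_nhds hyO)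
  have hV := planeFunctional_mem_expDual (hfN C₀ hC₀) hy hr hδ hδO
  have hplane := planeFunctional_apply (hfN C₀ hC₀) hy hr hδ hδO
  generalize planeFunctional (hfN C₀ hC₀) hy hr hδ hδO = V at hV hplane
  refine ⟨V, ⟨hV, fun φ hφc hdisj => ?_⟩, fun C' hC' z hz η hη => ?_⟩
  -- A point outside `C*` satisfies `⟨ξ, e⟩ < 0` for some nonzero `e ∈ C`, so these half spaces
  -- cover the support of the test function.
  · refine eq_zero_of_tsupport_subset_iUnion V
      (fun e : {e : EuclideanSpace ℝ (Fin n) // e ∈ C ∧ e ≠ 0} =>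
        {ξ : EuclideanSpace ℝ (Fin n) | inner ℝ ξ (e : EuclideanSpace ℝ (Fin n)) < 0})
      (fun e => isOpen_lt (by fun_prop) continuous_const) (fun e φ hφ hφe => ?_)
      (φ := φ) ⟨φ.2.1, hφc⟩ fun ξ hξ => ?_
    · obtain ⟨C₁, hC₁, y₁, hy₁, hr₁, h⟩ :=
        exists_planeIntegral_eq_zero hC hr0 hfN e.2.1 e.2.2 hφ fun ξ hξ => hφe hξ
      rw [hplane, ← planeIntegral_eq hn hC hCconv hC1 hr0 hfN hC₀ hC₁ hy hr hy₁ hr₁ hφ, h, mul_zero]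
    · have h1 : ξ ∉ dualCone C := disjoint_left.1 hdisj hξ
      simp only [dualCone, mem_ofPred_eq, not_forall, not_le] at h1
      obtain ⟨e, he, hlt⟩ := h1
      exact mem_iUnion.2 ⟨⟨e, he, fun h => by simp [h] at hlt⟩, hlt⟩
  · have hpi : (((2 * Real.pi : ℝ) : ℂ) ^ n) ≠ 0 :=
      pow_ne_zero _ (Complex.ofReal_ne_zero.2 (by positivity))
    have hz' := mem_truncTube.1 hz
    -- The limit is computed on the plane through `z`; truncated exponentials have compact support,
    -- so their integral is the same as on the plane defining `V`.
    refine (tendsto_planeIntegral_cutExp (hfN C' hC') hz hη).congr fun k => ?_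
    rw [hplane, inv_mul_cancel_left₀ hpi]
    exact planeIntegral_eq hn hC hCconv hC1 hr0 hfN hC₀ hC' hy hr hz'.1 hz'.2
      (cutExp_mem_bumpSpace hη z k)

end Properties

end PWS

end

/-! ### The theorem -/

theorem mainTheorem1 (n : ℕ) (hn : 1 ≤ n)
    (C : Set (EuclideanSpace ℝ (Fin n))) (hC : PWS.IsOpenCone C) (hCconv : Convex ℝ C)
    (hCne : C.Nonempty) (hC1 : n = 1 → C ≠ Set.univ)
    (O : Set (EuclideanSpace ℝ (Fin n))) (hO : IsOpen O) (hOconv : Convex ℝ O)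
    (hOne : O.Nonempty) :
    (∀ (r : Set (EuclideanSpace ℝ (Fin n)) → ℝ) (f : EuclideanSpace ℂ (Fin n) → ℂ),
      (∀ C', 0 < r C') →
      (∃ C', PWS.IsSubcone C C' ∧ ∃ y ∈ C' ∩ O, r C' < ‖y‖) →
      PWS.HolGrowth C r f →
      ∃! V : PWS.testSpace O →ₗ[ℂ] ℂ,
        V ∈ PWS.expDualSupp O (PWS.dualCone C) ∧
        ∀ C', PWS.IsSubcone C C' → ∀ z ∈ PWS.truncTube C' (r C'),
          PWS.HasInvFourierLaplace V z (f z)) ∧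
    (∀ V ∈ PWS.expDualSupp O (PWS.dualCone C),
      ∃ r : Set (EuclideanSpace ℝ (Fin n)) → ℝ, (∀ C', 0 < r C') ∧
        ∃ f : EuclideanSpace ℂ (Fin n) → ℂ, PWS.HolGrowth C r f ∧
          ∀ C', PWS.IsSubcone C C' → ∀ z ∈ PWS.truncTube C' (r C'),
            ∀ w : ℂ, PWS.HasInvFourierLaplace V z w ↔ w = f z) := by
  refine ⟨fun r f hr hOr hf => ?_, fun V hV => PWS.exists_holGrowth_of_expDualSupp hC hV⟩
  obtain ⟨V, hV, hVf⟩ := PWS.exists_hasInvFourierLaplace hn hC hCconv hC1 hO hr hOr hf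
  exact ⟨V, ⟨hV, hVf⟩, fun W hW =>
    PWS.eq_of_hasInvFourierLaplace hn hC hCne hO hOne hW.1 hV hW.2 hVf⟩
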